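/- **Setting.** A *plane graph* is a finite connected graph with at least one edge, without loops (multiple edges are allowed), embedded in the plane and considered up to isotopy. A *corner* of a plane graph is an angle of a face $p$ at a vertex $v$ between two consecutive edges on the boundary of $p$; if the boundary of $p$ passes through $v$ several times, each passage is a separate corner. (For a $2$-connected graph the corners are exactly the pairs $(p,v)$ with $v\in p$.) Let $l(p)$ be the number of edges on the boundary of $p$, an edge being counted twice if $p$ lies on both of its sides; it is also the number of corners of $p$. Let $p_\infty$ be the unbounded face. Let $G$ be a plane graph with $c_2$ edges and with a root $v_0$, a vertex of $p_\infty$. An *admissible state* $(a,b)$ assigns an integer $a_p$ to each face $p$ and an integer $b_v$ to each vertex $v$, such that $a_{p_\infty}=0$, $b_{v_0}=0$ and $a_p+b_v\ge 0$ whenever $v$ is a vertex of $p$. Put $$A(a,b)=\sum_{p\ne p_\infty}\Big(l(p)a_p^2+2a_p\sum_{v\in p}b_v\Big)+2\sum_{e=(vw)}b_vb_w,\qquad B(a,b)=2\sum_v b_v+\sum_{p\ne p_\infty}(l(p)-2)a_p,$$ where the sum over $v\in p$ is over the corners of $p$ and the sum over $e$ is over all edges of $G$. With $(q)_n=\prod_{i=1}^n(1-q^i)$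 and $(q)_\infty=\prod_{i\ge1}(1-q^i)$, define $$\Phi_G(q)=(q)_\infty^{c_2}\sum_{(a,b)}(-1)^{B(a,b)}\frac{q^{\frac12(A(a,b)+B(a,b))}}{\prod_{(p,v)}(q)_{a_p+b_v}}\in\mathbb Z[[q]],$$ where the sum is over all admissible states and the product is over all corners $(p,v)$ of all faces, $p_\infty$ included. For an edge $e=uw$ on the boundary of $p_\infty$ and $r\ge3$, the edge connected sum $G\cdot P_r$ of $G$ with the $r$-gon $P_r$ along $e$ is obtained by drawing in $p_\infty$, alongside $e$, a new path with $r-1$ edges from $u$ to $w$ through $r-2$ new vertices, so that $e$ and the path bound a new bounded face with $r$ edges. The root of $G$ is still on the unbounded face, and is taken as the root of $G\cdot P_r$. For a positive integer $b$ let $$h_b(q)=\sum_{n\in\mathbb Z}\varepsilon_b(n)\,q^{\frac b2n(n+1)-n},\qquad \varepsilon_b(n)=\begin{cases}(-1)^n & b\text{ odd},\\ 1 & b\text{ even},\ n\ge0,\\ -1 & b\text{ even},\ n<0.\end{cases}$$ **Lemma.** For every plane graph $G$, every root of $G$ on the unbounded face, every edge $e$ on the boundary of the unbounded face and every $r\ge3$,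 and for every choice of root of $P_r$, the sums that define $\Phi_G$, $\Phi_{P_r}$ and $\Phi_{G\cdot P_r}$ converge in $\mathbb Z[[q]]$, $\Phi_{P_r}(q)=h_r(q)$, and $$\Phi_{G\cdot P_r}(q)=\Phi_G(q)\,\Phi_{P_r}(q)=\Phi_G(q)\,h_r(q).$$ -/

import Mathlib

open scoped PowerSeries PowerSeries.WithPiTopology

noncomputable section

/-- A combinatorial map on a set `D` of darts (oriented edges): `flip` reverses the orientation of
a dart, and `next x` is the dart that follows `x` on the boundary of the face to the left of `x`.
Loops and multiple edges are allowed. A plane drawing of a connected graph with at least one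
edge is, up to isotopy on the sphere, such a map that is connected and of genus zero. -/
structure DartMap (D : Type*) where
  next : Equiv.Perm D
  flip : Equiv.Perm D
  flip_flip : ∀ x, flip (flip x) = x
  flip_ne : ∀ x, flip x ≠ x

namespace DartMap

variable {D : Type*} (G : DartMap D)

/-- Rotation around the source of a dart: `next x` starts where `x` ends, and so does `flip x`;
the rotation takes `next x` to `flip x`. -/
def rot : Equiv.Perm D := G.flip * G.next⁻¹

/-- Faces are the cycles of `next`. -/
def Face : Type _ := Quotient (Equiv.Perm.SameCycle.setoid G.next)

/-- Vertices are the cycles of `rot`. -/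
def Vertex : Type _ := Quotient (Equiv.Perm.SameCycle.setoid G.rot)

/-- The face to the left of a dart. -/
def face (x : D) : G.Face := Quotient.mk _ x

/-- The vertex at which a dart starts. The dart `x` stands also for the corner of the face
`face x` at the vertex `vert x`; every corner of a face is obtained from exactly one dart. -/
def vert (x : D) : G.Vertex := Quotient.mk _ x

/-- Every dart can be reached from every other one. -/
def Connected : Prop :=
  ∀ x y : D, ∃ g ∈ Subgroup.closure ({G.next, G.flip} : Set (Equiv.Perm D)), g x = y

/-- No edge joins a vertex to itself. -/
def Loopless : Prop := ∀ x : D, G.vert (G.flip x) ≠ G.vert x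

section Finite

variable [Fintype D]

instance : Fintype G.Face :=
  haveI : Finite G.Face := inferInstanceAs (Finite (Quotient _))
  Fintype.ofFinite _

instance : Fintype G.Vertex :=
  haveI : Finite G.Vertex := inferInstanceAs (Finite (Quotient _))
  Fintype.ofFinite _

/-- The number `c₂` of edges: each edge consists of two darts. -/
def numEdges (_G : DartMap D) : ℕ := Fintype.card D / 2

/-- Euler's formula `V - E + F = 2`: a connected map is drawn on the sphere. -/
def GenusZero : Prop :=
  Fintype.card G.Vertex + Fintype.card G.Face = G.numEdges + 2

open Classical in
/-- `l(p)`: the number of edges (with multiplicity) on the boundary of the face `p`. -/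
def len (p : G.Face) : ℕ := (Finset.univ.filter fun x : D => G.face x = p).card

open Classical in
/-- `γ(p) = l(p) a_p² + 2 a_p (b₁ + ⋯ + b_{l(p)})`, where `b₁, …, b_{l(p)}` are the values of `b`
at the corners of `p`. -/
def gam (a : G.Face → ℤ) (b : G.Vertex → ℤ) (p : G.Face) : ℤ :=
  G.len p * a p ^ 2 + 2 * a p * ∑ x : D with G.face x = p, b (G.vert x)

open Classical in
/-- `A(a,b) = ∑_{p bounded} γ(p) + 2 ∑_{e = (v w)} b_v b_w`; the sum over all darts counts each
edge twice. The argument `o` is the unbounded face. -/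
def formA (o : G.Face) (a : G.Face → ℤ) (b : G.Vertex → ℤ) : ℤ :=
  (∑ p : G.Face with p ≠ o, G.gam a b p) + ∑ x : D, b (G.vert x) * b (G.vert (G.flip x))

open Classical in
/-- `B(a,b) = 2 ∑_v b_v + ∑_{p bounded} (l(p) - 2) a_p`. -/
def formB (o : G.Face) (a : G.Face → ℤ) (b : G.Vertex → ℤ) : ℤ :=
  2 * (∑ v : G.Vertex, b v) + ∑ p : G.Face with p ≠ o, ((G.len p : ℤ) - 2) * a p

/-- Admissible states of the map with unbounded face `o` and root vertex `v`. -/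
def State (o : G.Face) (v : G.Vertex) : Type _ :=
  {s : (G.Face → ℤ) × (G.Vertex → ℤ) //
    s.1 o = 0 ∧ s.2 v = 0 ∧ ∀ x : D, 0 ≤ s.1 (G.face x) + s.2 (G.vert x)}

end Finite

end DartMap

/-- `(q)_n = (1 - q)(1 - q²)⋯(1 - qⁿ)`. -/
def qPoch (n : ℕ) : ℤ⟦X⟧ := ∏ i ∈ Finset.range n, (1 - PowerSeries.X ^ (i + 1))

/-- `1 / (q)_n`; the constant coefficient of `(q)_n` is `1`. -/
def invQPoch (n : ℕ) : ℤ⟦X⟧ := PowerSeries.invOfUnit (qPoch n) 1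

/-- `(q)_∞ = ∏_{n ≥ 1} (1 - qⁿ)`. -/
def qPochInf : ℤ⟦X⟧ := ∏' n : ℕ, (1 - PowerSeries.X ^ (n + 1))

/-- The sign `ε_b(n)`. -/
def thetaSign (b : ℕ) (n : ℤ) : ℤ :=
  if Odd b then (-1) ^ n.natAbs else if 0 ≤ n then 1 else -1

/-- `h_b(q) = ∑_{n ∈ ℤ} ε_b(n) q^{b n (n + 1) / 2 - n}`. The division is exact, and the exponent is
nonnegative for `b ≥ 1`. -/
def thetaSeries (b : ℕ) : ℤ⟦X⟧ :=
  ∑' n : ℤ, PowerSeries.monomial ((b * (n * (n + 1)) / 2 - n).toNat) (thetaSign b n)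

namespace DartMap

section Phi

variable {D : Type*} [Fintype D] (G : DartMap D)

/-- The summand
`(-1)^{B(a,b)} q^{(A(a,b) + B(a,b)) / 2} / ∏_{(p,v) : v ∈ p} (q)_{a_p + b_v}`
of an admissible state; the product is over the corners. The integer `A + B` is always even, and
for admissible states of a connected plane graph without loops `A` and `B` are nonnegative. -/
def phiTerm (o : G.Face) (v : G.Vertex) (s : G.State o v) : ℤ⟦X⟧ :=
  (-1) ^ (G.formB o s.1.1 s.1.2).natAbs *
    PowerSeries.X ^ ((G.formA o s.1.1 s.1.2 + G.formB o s.1.1 s.1.2) / 2).toNat *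
    ∏ x : D, invQPoch (s.1.1 (G.face x) + s.1.2 (G.vert x)).toNat

/-- The series `Φ_G(q)` of the plane graph `G` with unbounded face `o` and root vertex `v`. -/
def phi (o : G.Face) (v : G.Vertex) : ℤ⟦X⟧ :=
  qPochInf ^ G.numEdges * ∑' s : G.State o v, G.phiTerm o v s

end Phi

/-- The polygon with `r` edges: `Sum.inl i` is the dart from the vertex `i` to the vertex `i + 1`,
with the interior of the polygon on its left, and `Sum.inr i` is its reverse, with the exterior on
its left. -/
def polygon (r : ℕ) : DartMap (Fin r ⊕ Fin r) where
  next := Equiv.sumCongr (finRotate r) (finRotate r)⁻¹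
  flip := Equiv.sumComm (Fin r) (Fin r)
  flip_flip := by rintro (i | i) <;> rfl
  flip_ne := by rintro (i | i) <;> simp

section Attach

variable {D : Type*} (G : DartMap D) (d : D) (r : ℕ) (hr : 3 ≤ r)

open Classical in
/-- Successor of a dart in the edge connected sum with an `r`-gon, see `attachPolygon`. -/
def attachNextFun : D ⊕ (Fin (r - 1) ⊕ Fin (r - 1)) → D ⊕ (Fin (r - 1) ⊕ Fin (r - 1))
  | Sum.inl e =>
      if e = d then Sum.inr (Sum.inr ⟨r - 2, by omega⟩)
      else if G.next e = d then Sum.inr (Sum.inl ⟨0, by omega⟩)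
      else Sum.inl (G.next e)
  | Sum.inr (Sum.inl i) =>
      if h : i.1 + 1 < r - 1 then Sum.inr (Sum.inl ⟨i.1 + 1, h⟩)
      else if G.next d = d then Sum.inr (Sum.inl ⟨0, by omega⟩)
      else Sum.inl (G.next d)
  | Sum.inr (Sum.inr i) =>
      if i.1 = 0 then Sum.inl d
      else Sum.inr (Sum.inr ⟨i.1 - 1, by omega⟩)

theorem attachNextFun_bijective : Function.Bijective (attachNextFun G d r hr) := by
  have hn : ∀ x y, G.next x = G.next y → x = y := fun x y h => G.next.injective h
  constructor
  · rintro (e | i | i) (f | j | j) h <;> simp only [attachNextFun] at h <;> split_ifs at h <;>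
      simp only [Sum.inl.injEq, Sum.inr.injEq, Fin.ext_iff, reduceCtorEq] at h ⊢ <;> grind
  · rintro (e | i | i)
    · by_cases h1 : e = d
      · exact ⟨Sum.inr (Sum.inr ⟨0, by omega⟩), by simp [attachNextFun, h1]⟩
      · by_cases h2 : G.next d = e
        · refine ⟨Sum.inr (Sum.inl ⟨r - 2, by omega⟩), ?_⟩
          have h3 : ¬ (r - 2 + 1 < r - 1) := by omega
          simp [attachNextFun, h3, h2, h1]
        · obtain ⟨f, rfl⟩ := G.next.surjective e
          have h3 : f ≠ d := fun h => h2 (by rw [h])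
          exact ⟨Sum.inl f, by simp [attachNextFun, h3, h1]⟩
    · by_cases h0 : i.1 = 0
      · obtain ⟨f, hf⟩ := G.next.surjective d
        have hi : i = ⟨0, by omega⟩ := Fin.ext h0
        by_cases h1 : f = d
        · refine ⟨Sum.inr (Sum.inl ⟨r - 2, by omega⟩), ?_⟩
          have h3 : ¬ (r - 2 + 1 < r - 1) := by omega
          rw [h1] at hf
          simp [attachNextFun, h3, hf, hi]
        · exact ⟨Sum.inl f, by simp [attachNextFun, h1, hf, hi]⟩
      · refine ⟨Sum.inr (Sum.inl ⟨i.1 - 1, by omega⟩), ?_⟩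
        have h3 : i.1 - 1 + 1 < r - 1 := by omega
        simp only [attachNextFun, dif_pos h3]
        congr 3
        omega
    · by_cases h0 : i.1 + 1 < r - 1
      · exact ⟨Sum.inr (Sum.inr ⟨i.1 + 1, h0⟩), by simp [attachNextFun]⟩
      · have hi : i = ⟨r - 2, by omega⟩ := Fin.ext (by simp; omega)
        exact ⟨Sum.inl d, by simp [attachNextFun, hi]⟩

/-- The edge connected sum of `G` with an `r`-gon along the edge of the dart `d`, on the left of
`d`. If `d` runs from `u` to `w`, a new path with `r - 1` edges (and `r - 2` new vertices) from `u`
to `w` is drawn inside the face on the left of `d`. `Sum.inr (Sum.inl i)` is the `i`-th dart `x_i`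
of this path, directed from `u` to `w`, and `Sum.inr (Sum.inr i)` is its reverse `y_i`. Thus that
face is divided into the `r`-gon with boundary `d, y_{r-2}, …, y_0` and a face on whose boundary
`d` is replaced by `x_0, …, x_{r-2}`. -/
def attachPolygon : DartMap (D ⊕ (Fin (r - 1) ⊕ Fin (r - 1))) where
  next := Equiv.ofBijective _ (attachNextFun_bijective G d r hr)
  flip := Equiv.sumCongr G.flip (Equiv.sumComm (Fin (r - 1)) (Fin (r - 1)))
  flip_flip := by
    rintro (e | i | i)
    · simp [G.flip_flip]
    · rfl
    · rfl
  flip_ne := by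
    rintro (e | i | i)
    · simpa using G.flip_ne e
    · simp
    · simp

/-- The unbounded face of the edge connected sum when the face on the left of `d` is the unbounded
face of `G`. -/
def attachOuter : (G.attachPolygon d r hr).Face :=
  (G.attachPolygon d r hr).face (Sum.inr (Sum.inl ⟨0, by omega⟩))

end Attach

end DartMap

end

/-! Put s = r - 2. A state of the connected sum is a state of `G` together with a label a of the new
face and labels b_1, …, b_s of the new vertices. Because the outer label is 0, the ends of the edge
carry labels x, y ≥ 0, and the summand factors as the summand of `G` times `extraTerm s x y a b`
(`stateTerm_attach`). The crux is `tsum_extraTerm`: after multiplication by (q)_∞^(s+1), the sum of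
these factors over a and b is h_r, whatever x and y are. The s + 1 new edges supply exactly this
power of (q)_∞.

To prove the crux, fix a and sum along the path. Euler's identity and the q-binomial theorem turn
each summation over an interior vertex into one application of the operator `kop` to a coefficient
sequence, so that the path sum becomes a series in powers of q^x (`pathSum_expansion`). Summing over
a then leaves, by a q-Chu–Vandermonde evaluation (`altSum_eq`), only the coefficient of index 0, and
there the initial sequence becomes `mu`, with μ(m) = (-1)^m q^(m(m+1)/2). Hence x and y enter only
through a factor q^(xy), which cancels (`tsum_pathSum`). What remains is `kop^[s] mu` at 0. The
operator is triangular, with eigenvectors `eigvec n` of eigenvalue μ(n); `mu` is their sum over n,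
so the value is a series in μ(n)^s, and this is the theta series (`kop_iterate_mu`,
`thetaSeries_eq`).

Convergence for `G` uses a spanning tree of the dual graph and a complementary spanning tree of `G`.
They distribute the edges over the nonroot faces and vertices, which splits A + B into nonnegative
pieces that control all labels (`exists_stateExp_bound`). The bound for the additional labels is
uniform in x and y, so the joint sum may be iterated.

The polygon is the same computation started from a single edge, whose own series is 1 by Euler's
identity. -/

noncomputable section

/-! ### X-adically small families and interchange of sums -/

/-- A family of power series that tends to `0` in the `X`-adic sense. -/
def XSmall {ι : Type*} (f : ι → ℤ⟦X⟧) : Prop :=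
  ∀ N : ℕ, {i | ¬ (PowerSeries.X ^ N ∣ f i)}.Finite

namespace XSmall

open PowerSeries

variable {ι κ : Type*} {f g : ι → ℤ⟦X⟧}

theorem of_dvd (hf : XSmall f) (h : ∀ i, f i ∣ g i) : XSmall g := fun N =>
  (hf N).subset fun _ hi h' => hi (h'.trans (h _))

theorem of_exponent (e : ι → ℕ) (he : ∀ N, {i | e i < N}.Finite) (h : ∀ i, X ^ e i ∣ f i) :
    XSmall f := fun N => (he N).subset fun i hi => by
  by_contra h'
  exact hi ((pow_dvd_pow X (not_lt.mp h')).trans (h i))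

theorem mul_left (hf : XSmall f) (c : ι → ℤ⟦X⟧) : XSmall fun i => c i * f i :=
  hf.of_dvd fun _ => dvd_mul_left _ _

theorem mul_right (hf : XSmall f) (c : ι → ℤ⟦X⟧) : XSmall fun i => f i * c i :=
  hf.of_dvd fun _ => dvd_mul_right _ _

theorem comp_injective (hf : XSmall f) {e : κ → ι} (he : Function.Injective e) :
    XSmall fun k => f (e k) := fun N => (hf N).preimage he.injOn

theorem add (hf : XSmall f) (hg : XSmall g) : XSmall fun i => f i + g i := fun N =>
  ((hf N).union (hg N)).subset fun i hi => by
    by_contra h'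
    simp only [Set.mem_union, Set.mem_ofPred_eq, not_or, not_not] at h'
    exact hi (dvd_add h'.1 h'.2)

theorem neg (hf : XSmall f) : XSmall fun i => - f i := hf.of_dvd fun _ => (dvd_neg.mpr dvd_rfl)

theorem sub (hf : XSmall f) (hg : XSmall g) : XSmall fun i => f i - g i := by
  simpa [sub_eq_add_neg] using hf.add hg.neg

theorem prodMul {g : κ → ℤ⟦X⟧} (hf : XSmall f) (hg : XSmall g) :
    XSmall fun p : ι × κ => f p.1 * g p.2 := fun N =>
  ((hf N).prod (hg N)).subset fun _ hp =>
    ⟨fun h => hp (h.mul_right _), fun h => hp (h.mul_left _)⟩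

theorem summable (hf : XSmall f) : Summable f := by
  rw [PowerSeries.WithPiTopology.summable_iff_summable_coeff]
  intro d
  refine summable_of_hasFiniteSupport ((hf (d + 1)).subset fun i hi h => hi ?_)
  exact PowerSeries.X_pow_dvd_iff.mp h d (Nat.lt_succ_self d)

theorem dvd_tsum (hf : XSmall f) {N : ℕ} (h : ∀ i, X ^ N ∣ f i) : X ^ N ∣ ∑' i, f i := by
  rw [PowerSeries.X_pow_dvd_iff]
  intro m hm
  rw [hf.summable.map_tsum (PowerSeries.coeff m) (PowerSeries.WithPiTopology.continuous_coeff ℤ m)]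
  rw [tsum_congr fun i => PowerSeries.X_pow_dvd_iff.mp (h i) m hm, tsum_zero]

theorem left_fiber {f : ι × κ → ℤ⟦X⟧} (hf : XSmall f) (i : ι) : XSmall fun k => f (i, k) :=
  hf.comp_injective (Prod.mk_right_injective i)

theorem right_fiber {f : ι × κ → ℤ⟦X⟧} (hf : XSmall f) (k : κ) : XSmall fun i => f (i, k) :=
  hf.comp_injective (Prod.mk_left_injective k)

theorem tsum_right {f : ι × κ → ℤ⟦X⟧} (hf : XSmall f) : XSmall fun i => ∑' k, f (i, k) := fun N =>
  ((hf N).image Prod.fst).subset fun i hi => by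
    by_contra h'
    refine hi ((hf.left_fiber i).dvd_tsum fun k => ?_)
    by_contra h2
    exact h' ⟨(i, k), h2, rfl⟩

theorem tsum_prod {f : ι × κ → ℤ⟦X⟧} (hf : XSmall f) : ∑' p, f p = ∑' i, ∑' k, f (i, k) :=
  hf.summable.tsum_prod' fun i => (hf.left_fiber i).summable

theorem tsum_comm {f : ι → κ → ℤ⟦X⟧} (hf : XSmall fun p : ι × κ => f p.1 p.2) :
    ∑' i, ∑' k, f i k = ∑' k, ∑' i, f i k :=
  (Summable.tsum_comm' (f := fun i k => f i k) hf.summable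
    (fun i => (hf.left_fiber i).summable) fun k => (hf.right_fiber k).summable).symm

theorem tsum_mul_left (hf : XSmall f) (c : ℤ⟦X⟧) : ∑' i, c * f i = c * ∑' i, f i :=
  hf.summable.tsum_mul_left c

theorem tsum_mul_right (hf : XSmall f) (c : ℤ⟦X⟧) : ∑' i, f i * c = (∑' i, f i) * c :=
  hf.summable.tsum_mul_right c

theorem tsum_add (hf : XSmall f) (hg : XSmall g) :
    ∑' i, (f i + g i) = ∑' i, f i + ∑' i, g i := hf.summable.tsum_add hg.summable

theorem tsum_sub (hf : XSmall f) (hg : XSmall g) :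
    ∑' i, (f i - g i) = ∑' i, f i - ∑' i, g i := hf.summable.tsum_sub hg.summable

theorem tsum_eq_zero_add {f : ℕ → ℤ⟦X⟧} (hf : XSmall f) : ∑' i, f i = f 0 + ∑' i, f (i + 1) :=
  hf.summable.tsum_eq_zero_add

end XSmall

theorem eq_of_forall_X_pow_dvd_sub {f g : ℤ⟦X⟧} (h : ∀ n : ℕ, PowerSeries.X ^ n ∣ f - g) :
    f = g := by
  ext m
  have := PowerSeries.X_pow_dvd_iff.mp (h (m + 1)) m (Nat.lt_succ_self m)
  simpa [sub_eq_zero] using this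

/-! ### q-factorials, Euler's identity, and the signed powers μ(a) -/

section qSeries

open PowerSeries

theorem qPoch_zero : qPoch 0 = 1 := by simp [qPoch]

theorem qPoch_succ (n : ℕ) : qPoch (n + 1) = qPoch n * (1 - X ^ (n + 1)) := by
  simp [qPoch, Finset.prod_range_succ]

theorem qPoch_mul_invQPoch (n : ℕ) : qPoch n * invQPoch n = 1 := by
  refine PowerSeries.mul_invOfUnit _ _ ?_
  induction n with
  | zero => simp [qPoch_zero]
  | succ n ih => simp [qPoch_succ, ih]

/-- `1 / (q)_n` for an integer `n`; it is `0` for `n < 0`. -/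
def iq (n : ℤ) : ℤ⟦X⟧ := if 0 ≤ n then invQPoch n.toNat else 0

theorem iq_of_neg {n : ℤ} (h : n < 0) : iq n = 0 := if_neg (not_le.mpr h)

theorem iq_natCast (n : ℕ) : iq n = invQPoch n := by simp [iq]

theorem qPoch_mul_iq (n : ℕ) : qPoch n * iq n = 1 := by rw [iq_natCast, qPoch_mul_invQPoch]

theorem iq_mul_qPoch (n : ℕ) : iq n * qPoch n = 1 := by rw [mul_comm, qPoch_mul_iq]

theorem iq_zero : iq 0 = 1 := by simpa [qPoch_zero] using qPoch_mul_iq 0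

theorem qPoch_ne_zero (n : ℕ) : qPoch n ≠ 0 := left_ne_zero_of_mul_eq_one (qPoch_mul_iq n)

theorem one_sub_mul_iq_succ (n : ℕ) : (1 - X ^ (n + 1)) * iq ((n : ℤ) + 1) = iq n := by
  refine mul_left_cancel₀ (qPoch_ne_zero n) ?_
  rw [← mul_assoc, ← qPoch_succ, qPoch_mul_iq]
  exact_mod_cast qPoch_mul_iq (n + 1)

theorem one_sub_mul_iq (n : ℕ) : (1 - X ^ n) * iq n = iq ((n : ℤ) - 1) := by
  cases n with
  | zero => simp [iq_of_neg]
  | succ n => simpa using one_sub_mul_iq_succ n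

theorem X_pow_dvd_qPoch_sub (n m : ℕ) : (X : ℤ⟦X⟧) ^ (n + 1) ∣ qPoch (n + m) - qPoch n := by
  induction m with
  | zero => simp
  | succ m ih =>
    have : qPoch (n + (m + 1)) - qPoch n
        = (qPoch (n + m) - qPoch n) - X ^ (n + 1) * (X ^ m * qPoch (n + m)) := by
      rw [← add_assoc, qPoch_succ]; ring
    rw [this]
    exact dvd_sub ih (dvd_mul_right _ _)

theorem X_pow_dvd_qPochInf_sub (n : ℕ) : (X : ℤ⟦X⟧) ^ (n + 1) ∣ qPochInf - qPoch n := by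
  have h := (PowerSeries.WithPiTopology.multipliable_one_sub_X_pow ℤ).tendsto_prod_tprod_nat
  rw [PowerSeries.X_pow_dvd_iff]
  intro m hm
  have h2 := ((PowerSeries.WithPiTopology.continuous_coeff ℤ m).tendsto _).comp h
  rw [nhds_discrete, Filter.tendsto_pure] at h2
  obtain ⟨k, hk⟩ := (h2.and (Filter.eventually_ge_atTop n)).exists
  obtain ⟨l, rfl⟩ := Nat.exists_eq_add_of_le hk.2
  have h3 := PowerSeries.X_pow_dvd_iff.mp (X_pow_dvd_qPoch_sub n l) m hm
  rw [map_sub] at h3 ⊢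
  rw [← h3, qPochInf, ← hk.1]
  rfl

theorem small_X_pow_mul (n : ℕ) (c : ℕ → ℤ⟦X⟧) : XSmall fun b : ℕ => X ^ (b * (n + 1)) * c b :=
  XSmall.of_exponent (fun b => b * (n + 1))
    (fun N => (Set.finite_lt_nat N).subset fun b hb => by
      simp only [Set.mem_ofPred_eq] at *; nlinarith) fun _ => dvd_mul_right _ _

/-- Euler: `∑_b q^{b (n + 1)} / (q)_b = (q)_n / (q)_∞`. -/
theorem qPochInf_mul_tsum (n : ℕ) :
    qPochInf * ∑' b : ℕ, X ^ (b * (n + 1)) * iq b = qPoch n := by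
  set g : ℕ → ℤ⟦X⟧ := fun n => ∑' b : ℕ, X ^ (b * (n + 1)) * iq b with hg
  -- The factor 1 - q^b in the difference of the two series cancels against 1 / (q)_b and shifts b
  -- by one. The constant g 0 is then determined by g n → 1.
  have hs : ∀ n, g (n + 1) = (1 - X ^ (n + 1)) * g n := by
    intro n
    have h1 : g n - g (n + 1) = X ^ (n + 1) * g n := by
      rw [hg]
      simp only
      rw [← XSmall.tsum_sub (small_X_pow_mul _ _) (small_X_pow_mul _ _),
        ← XSmall.tsum_mul_left (small_X_pow_mul _ _)]
      rw [XSmall.tsum_eq_zero_add ((small_X_pow_mul _ _).sub (small_X_pow_mul _ _))]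
      simp only [zero_mul, pow_zero, sub_self, zero_add]
      refine tsum_congr fun b => ?_
      have := one_sub_mul_iq_succ b
      push_cast
      rw [← this]
      ring
    linear_combination -h1
  have hp : ∀ n, g n = qPoch n * g 0 := by
    intro n
    induction n with
    | zero => simp [qPoch_zero]
    | succ n ih => rw [hs, ih, qPoch_succ]; ring
  have h1 : ∀ n, X ^ (n + 1) ∣ g n - 1 := by
    intro n
    rw [hg]
    simp only
    rw [XSmall.tsum_eq_zero_add (small_X_pow_mul _ _)]
    simp only [zero_mul, pow_zero, Nat.cast_zero, iq_zero, mul_one, add_sub_cancel_left]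
    refine XSmall.dvd_tsum ((small_X_pow_mul n fun b => iq b).comp_injective
      (add_left_injective 1)) fun b => ?_
    exact Dvd.dvd.mul_right (pow_dvd_pow _ (by nlinarith)) _
  have h0 : qPochInf * g 0 = 1 := by
    refine eq_of_forall_X_pow_dvd_sub fun n => ?_
    refine (pow_dvd_pow X n.le_succ).trans ?_
    have : qPochInf * g 0 - 1 = (qPochInf - qPoch n) * g 0 + (g n - 1) := by rw [hp n]; ring
    rw [this]
    exact dvd_add ((X_pow_dvd_qPochInf_sub n).mul_right _) (h1 n)
  change qPochInf * g n = _
  rw [hp, mul_left_comm, h0, mul_one]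

/-- `(-1)^a q^{a (a + 1) / 2}`. -/
def mu (a : ℤ) : ℤ⟦X⟧ := (-1) ^ a.natAbs * X ^ (a * (a + 1) / 2).toNat

theorem two_mul_half (a : ℤ) : 2 * (a * (a + 1) / 2) = a * (a + 1) :=
  Int.mul_ediv_cancel' (Int.even_mul_succ_self a).two_dvd

theorem half_nonneg (a : ℤ) : 0 ≤ a * (a + 1) / 2 := by
  have := two_mul_half a
  rcases le_or_gt 0 a with h | h <;> nlinarith

theorem neg_one_pow_eq_of_even {R : Type*} [Ring R] {m n : ℕ} (h : Even ((m : ℤ) - n)) :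
    (-1 : R) ^ m = (-1) ^ n := by
  rw [Int.even_sub, Int.even_coe_nat, Int.even_coe_nat] at h
  by_cases hn : Even n
  · rw [hn.neg_one_pow, (h.mpr hn).neg_one_pow]
  · have hm : ¬ Even m := fun hm => hn (h.mp hm)
    rw [(Nat.not_even_iff_odd.mp hn).neg_one_pow, (Nat.not_even_iff_odd.mp hm).neg_one_pow]

theorem even_natAbs_sub (a : ℤ) : Even ((a.natAbs : ℤ) - a) := by
  rw [Int.even_sub, Int.even_coe_nat, Int.natAbs_even]

/-- All comparisons of signs and triangular exponents go through this form: the doubled exponents in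
`h2` turn them into polynomial identities without division. -/
theorem mu_mul_X_pow {a b : ℤ} {l p q : ℕ} (h1 : Even (a - b - l))
    (h2 : a * (a + 1) + 2 * p = b * (b + 1) + 2 * q) :
    mu a * X ^ p = (-1) ^ l * mu b * X ^ q := by
  have hs : (-1 : ℤ⟦X⟧) ^ a.natAbs = (-1) ^ (l + b.natAbs) := by
    refine neg_one_pow_eq_of_even ?_
    have ha := even_natAbs_sub a
    have hb := even_natAbs_sub b
    have : ((a.natAbs : ℤ) - (l + b.natAbs : ℕ)) = (a.natAbs - a) - (b.natAbs - b) + (a - b - l) := by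
      push_cast; ring
    rw [this]
    exact (ha.sub hb).add h1
  have ha := two_mul_half a
  have hb := two_mul_half b
  have ha' := half_nonneg a
  have hb' := half_nonneg b
  have he : (a * (a + 1) / 2).toNat + p = (b * (b + 1) / 2).toNat + q := by omega
  rw [mu, mu, hs, mul_assoc, ← pow_add X, he]
  ring

theorem mu_zero : mu 0 = 1 := by simp [mu]

theorem small_mu (c : ℤ) : XSmall fun k : ℕ => mu (c + k) := by
  refine XSmall.of_exponent (fun k => ((c + k) * (c + k + 1) / 2).toNat) (fun N => ?_)
    fun k => dvd_mul_left _ _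
  refine (Set.finite_lt_nat (N + 2 + c.natAbs)).subset fun k hk => ?_
  simp only [Set.mem_ofPred_eq] at *
  have h1 := two_mul_half (c + k)
  by_contra h
  have h2 : (N : ℤ) + 2 ≤ c + k := by omega
  have h3 : (c + k) * (c + k + 1) / 2 < N := by omega
  nlinarith

end qSeries

/-! ### Euler's alternating series, the q-binomial theorem, a q-Chu–Vandermonde sum -/

section qIdentities

open PowerSeries

theorem two_mul_tri (k : ℕ) : 2 * (k * (k + 1) / 2) = k * (k + 1) :=
  Nat.mul_div_cancel' (Nat.even_mul_succ_self k).two_dvd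

theorem mu_natCast (k : ℕ) : mu k = (-1) ^ k * X ^ (k * (k + 1) / 2) := by
  have h : (((k : ℤ) * (k + 1) / 2)).toNat = k * (k + 1) / 2 := by
    exact_mod_cast Int.toNat_natCast (k * (k + 1) / 2)
  rw [mu, h, Int.natAbs_natCast]

/-- Apart from the factor μ(a), the left side depends on a and x only through a + x. This reduces
`tsum_mu` to a = 0 when a + x ≥ 0. -/
theorem mu_add_mul_X_pow {a : ℤ} {x n : ℕ} (h : a + x = n) (k : ℕ) :
    mu (a + k) * X ^ (x * k) = mu a * mu k * X ^ (n * k) := by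
  have h2 := two_mul_tri k
  have := mu_mul_X_pow (a := a + k) (b := a) (l := k) (p := x * k)
    (q := k * (k + 1) / 2 + n * k) (by simp) (by
      zify at h2
      push_cast
      rw [mul_add 2, h2, ← h]
      ring)
  rw [this, mu_natCast, pow_add]
  ring

theorem mu_succ_mul_X_pow {a : ℤ} {x n : ℕ} (h : a + x + 1 = n) :
    mu (a + 1) * X ^ x = -(mu a * X ^ n) := by
  have := mu_mul_X_pow (a := a + 1) (b := a) (l := 1) (p := x) (q := n) (by simp) (by
    rw [← h]; ring)
  rw [this]; ring

theorem small_mu_mul (a : ℤ) (c : ℕ → ℤ⟦X⟧) : XSmall fun k : ℕ => mu (a + k) * c k :=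
  (small_mu a).mul_right c

/-- The difference of the first two series contains (1 - q^k) / (q)_k = 1 / (q)_{k-1}; shifting k
gives the third. -/
theorem tsum_mu_step (a : ℤ) (x : ℕ) :
    ∑' k : ℕ, mu (a + k) * (X ^ (x * k) * iq k) =
      ∑' k : ℕ, mu (a + k) * (X ^ ((x + 1) * k) * iq k) +
        X ^ x * ∑' k : ℕ, mu (a + 1 + k) * (X ^ (x * k) * iq k) := by
  rw [← sub_eq_iff_eq_add', ← XSmall.tsum_sub (small_mu_mul _ _) (small_mu_mul _ _),
    ← XSmall.tsum_mul_left (small_mu_mul _ _),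
    XSmall.tsum_eq_zero_add ((small_mu_mul _ _).sub (small_mu_mul _ _))]
  simp only [mul_zero, sub_self, zero_add]
  refine tsum_congr fun k => ?_
  have h := one_sub_mul_iq_succ k
  rw [← h]
  push_cast
  rw [show a + ((k : ℤ) + 1) = a + 1 + k by ring]
  ring

/-- `∑_k (-1)^{a+k} q^{(a+k)(a+k+1)/2 + x k} / (q)_k = (-1)^a q^{a(a+1)/2} (q)_∞ / (q)_{a+x}`. -/
theorem tsum_mu (a : ℤ) (x : ℕ) :
    ∑' k : ℕ, mu (a + k) * (X ^ (x * k) * iq k) = mu a * (qPochInf * iq (a + x)) := by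
  set f : ℕ → ℤ⟦X⟧ := fun n => ∑' k : ℕ, mu (0 + k) * (X ^ (n * k) * iq k) with hf
  have hred : ∀ (a : ℤ) (x n : ℕ), a + x = n →
      ∑' k : ℕ, mu (a + k) * (X ^ (x * k) * iq k) = mu a * f n := by
    intro a x n h
    rw [hf, ← XSmall.tsum_mul_left (small_mu_mul _ _)]
    refine tsum_congr fun k => ?_
    rw [← mul_assoc, mu_add_mul_X_pow h, zero_add]
    ring
  have hstep : ∀ n, f n = (1 - X ^ (n + 1)) * f (n + 1) := by
    intro n
    have h1 := tsum_mu_step 0 n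
    rw [hred (0 + 1) n (n + 1) (by push_cast; ring)] at h1
    have h2 := mu_succ_mul_X_pow (a := 0) (x := n) (n := n + 1) (by push_cast; ring)
    rw [mu_zero] at h2
    change f n = f (n + 1) + _ at h1
    rw [h1]
    linear_combination f (n + 1) * h2
  have hprod : ∀ n, f 0 = qPoch n * f n := by
    intro n
    induction n with
    | zero => simp [qPoch_zero]
    | succ n ih => rw [ih, hstep n, qPoch_succ]; ring
  have hlim : ∀ n, X ^ n ∣ f n - 1 := by
    intro n
    rw [hf]
    simp only
    rw [XSmall.tsum_eq_zero_add (small_mu_mul _ _)]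
    simp only [Nat.cast_zero, add_zero, mu_zero, mul_zero, pow_zero, iq_zero, mul_one,
      add_sub_cancel_left]
    refine XSmall.dvd_tsum ((small_mu_mul 0 fun k => X ^ (n * k) * iq k).comp_injective
      (add_left_injective 1)) fun b => ?_
    exact ((pow_dvd_pow _ (by nlinarith)).mul_right _).mul_left _
  have h0 : f 0 = qPochInf := by
    refine eq_of_forall_X_pow_dvd_sub fun n => ?_
    have : f 0 - qPochInf = qPoch n * (f n - 1) - (qPochInf - qPoch n) := by rw [hprod n]; ring
    rw [this]
    exact dvd_sub ((hlim n).mul_left _) ((pow_dvd_pow X n.le_succ).trans (X_pow_dvd_qPochInf_sub n))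
  have hpos : ∀ (a : ℤ) (x : ℕ), 0 ≤ a + x →
      ∑' k : ℕ, mu (a + k) * (X ^ (x * k) * iq k) = mu a * (qPochInf * iq (a + x)) := by
    intro a x h
    obtain ⟨n, hn⟩ := Int.eq_ofNat_of_zero_le h
    rw [hred a x n hn, hn, ← h0, hprod n]
    linear_combination (-mu a * f n) * qPoch_mul_iq n
  -- The sum vanishes for a + x < 0. At a + x = -1 the two series of the step relation cancel, since
  -- μ(a+1) q^x = -μ(a); smaller values reduce to this one.
  have hneg : ∀ (m : ℕ) (a : ℤ) (x : ℕ), a + x + (m + 1) = 0 →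
      ∑' k : ℕ, mu (a + k) * (X ^ (x * k) * iq k) = 0 := by
    intro m
    induction m with
    | zero =>
      intro a x h
      have h2 := mu_succ_mul_X_pow (a := a) (x := x) (n := 0) (by push_cast at h ⊢; linarith)
      rw [tsum_mu_step, hpos a (x + 1) (by push_cast at h ⊢; linarith),
        hpos (a + 1) x (by push_cast at h ⊢; linarith)]
      have h3 : a + 1 + x = a + (x + 1 : ℕ) := by push_cast; ring
      rw [h3]
      linear_combination (qPochInf * iq (a + (x + 1 : ℕ))) * h2
    | succ m ih =>
      intro a x h
      push_cast at h
      rw [tsum_mu_step, ih a (x + 1) (by push_cast; linarith), ih (a + 1) x (by linarith)]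
      simp
  rcases le_or_gt 0 (a + x) with h | h
  · exact hpos a x h
  · rw [iq_of_neg h, mul_zero, mul_zero]
    exact hneg (-(a + x) - 1).toNat a x (by omega)

/-- With j + 1 = l + d, write 1 - q^(l+d) = (1 - q^l) + q^l (1 - q^d); each part lowers the index of
one denominator. -/
theorem sum_mu_step (a : ℤ) (x j : ℕ) :
    (1 - X ^ (j + 1)) * ∑ l ∈ Finset.range (j + 1 + 1),
        mu (a + l) * (X ^ (x * l) * iq l * iq ((j + 1 : ℕ) - l)) =
      X ^ x * ∑ l ∈ Finset.range (j + 1), mu (a + 1 + l) * (X ^ (x * l) * iq l * iq (j - l)) +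
        ∑ l ∈ Finset.range (j + 1), mu (a + l) * (X ^ ((x + 1) * l) * iq l * iq (j - l)) := by
  have key : ∀ l ∈ Finset.range (j + 1 + 1),
      (1 - X ^ (j + 1)) * (mu (a + l) * (X ^ (x * l) * iq l * iq ((j + 1 : ℕ) - l))) =
      mu (a + l) * (X ^ (x * l) * iq (l - 1) * iq ((j + 1 : ℕ) - l)) +
      mu (a + l) * (X ^ ((x + 1) * l) * iq l * iq (j - l)) := by
    intro l hl
    have hl' : l ≤ j + 1 := by simpa [Nat.lt_succ_iff] using hl
    obtain ⟨d, hd⟩ := Nat.exists_eq_add_of_le hl'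
    have h1 := one_sub_mul_iq l
    have h2 := one_sub_mul_iq d
    have e1 : ((j + 1 : ℕ) : ℤ) - l = d := by rw [hd]; push_cast; ring
    have e2 : (j : ℤ) - l = d - 1 := by rw [← e1]; push_cast; ring
    rw [e1, e2, ← h1, ← h2, hd]
    ring
  rw [Finset.mul_sum, Finset.sum_congr rfl key, Finset.sum_add_distrib]
  congr 1
  · rw [Finset.sum_range_succ', Finset.mul_sum]
    simp only [Nat.cast_zero, zero_sub, iq_of_neg (show (-1 : ℤ) < 0 by norm_num), mul_zero,
      zero_mul, add_zero]
    refine Finset.sum_congr rfl fun l _ => ?_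
    push_cast
    rw [show a + ((l : ℤ) + 1) = a + 1 + l by ring, show (l : ℤ) + 1 - 1 = l by ring,
      show (j : ℤ) + 1 - (l + 1) = j - l by ring]
    ring
  · rw [Finset.sum_range_succ]
    simp [iq_of_neg]

/-- The finite `q`-binomial theorem. -/
theorem sum_mu (a : ℤ) (x j N : ℕ) (h : a + x + j = N) :
    ∑ l ∈ Finset.range (j + 1), mu (a + l) * (X ^ (x * l) * iq l * iq (j - l)) =
      mu a * (qPoch N * iq (a + x) * iq j) := by
  induction j generalizing a x with
  | zero =>
    have h' : a + x = N := by simpa using h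
    simp only [zero_add, Finset.sum_range_one, Nat.cast_zero, add_zero, mul_zero, pow_zero, iq_zero,
      sub_zero, mul_one, h', qPoch_mul_iq]
  | succ j ih =>
    have hne : (1 - X ^ (j + 1) : ℤ⟦X⟧) ≠ 0 := by
      intro h0
      have := qPoch_succ j
      rw [h0, mul_zero] at this
      exact qPoch_ne_zero _ this
    refine mul_left_cancel₀ hne ?_
    have hj := one_sub_mul_iq_succ j
    push_cast at h
    rw [sum_mu_step, ih (a + 1) x (by linarith), ih a (x + 1) (by push_cast; linarith)]
    push_cast
    rw [← hj]
    have e : a + 1 + x = a + (x + 1) := by ring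
    rw [e]
    rcases lt_or_ge (a + (x + 1)) 0 with hn | hn
    · rw [iq_of_neg hn, iq_of_neg (show a + (x : ℤ) < 0 by linarith)]
      ring
    · obtain ⟨n, hn⟩ := Int.eq_ofNat_of_zero_le hn
      have h2 := mu_succ_mul_X_pow (a := a) (x := x) (n := n) (by linarith)
      have h3 := one_sub_mul_iq n
      rw [show a + (x : ℤ) = n - 1 by linarith, hn, ← h3]
      linear_combination (qPoch N * iq n * ((1 - X ^ (j + 1)) * iq (j + 1))) * h2

/-- The sum `∑_α (-1)^α q^{α (α - 1) / 2} (q)_{P - α} / ((q)_α (q)_{M - α} (q)_{P - α - y})`. -/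
def altSum (M P y : ℕ) : ℤ⟦X⟧ :=
  ∑ α ∈ Finset.range (M + 1),
    (-1) ^ α * X ^ (α * (α - 1) / 2) * (iq α * iq (M - α) * (qPoch (P - α) * iq (P - α - y)))

/-- With M + 1 = α + d, write 1 - q^(α+d) = (1 - q^d) + q^d (1 - q^α), and shift α in the second
part. -/
theorem altSum_step (M P y : ℕ) :
    (1 - X ^ (M + 1)) * altSum (M + 1) (P + 1) y =
      altSum M (P + 1) y - X ^ M * altSum M P y := by
  unfold altSum
  have key : ∀ α ∈ Finset.range (M + 1 + 1),
      (1 - X ^ (M + 1)) * ((-1) ^ α * X ^ (α * (α - 1) / 2) * (iq α * iq ((M + 1 : ℕ) - α) *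
        (qPoch (P + 1 - α) * iq ((P + 1 : ℕ) - α - y)))) =
      (-1) ^ α * X ^ (α * (α - 1) / 2) * (iq α * iq (M - α) *
        (qPoch (P + 1 - α) * iq ((P + 1 : ℕ) - α - y))) +
      (-1) ^ α * X ^ (α * (α - 1) / 2) * X ^ (M + 1 - α) * (iq (α - 1) * iq ((M + 1 : ℕ) - α) *
        (qPoch (P + 1 - α) * iq ((P + 1 : ℕ) - α - y))) := by
    intro α hα
    have hl' : α ≤ M + 1 := by simpa [Nat.lt_succ_iff] using hα
    obtain ⟨d, hd⟩ := Nat.exists_eq_add_of_le hl'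
    have h1 := one_sub_mul_iq α
    have h2 := one_sub_mul_iq d
    have e1 : ((M + 1 : ℕ) : ℤ) - α = d := by rw [hd]; push_cast; ring
    have e2 : (M : ℤ) - α = d - 1 := by rw [← e1]; push_cast; ring
    rw [e1, e2, ← h1, ← h2, hd, Nat.add_sub_cancel_left]
    ring
  rw [Finset.mul_sum, Finset.sum_congr rfl key, Finset.sum_add_distrib, sub_eq_add_neg]
  congr 1
  · rw [Finset.sum_range_succ]
    simp [iq_of_neg]
  · rw [Finset.sum_range_succ', Finset.mul_sum, ← Finset.sum_neg_distrib]
    simp only [Nat.cast_zero, zero_sub, iq_of_neg (show (-1 : ℤ) < 0 by norm_num), mul_zero,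
      zero_mul, add_zero]
    refine Finset.sum_congr rfl fun α hα => ?_
    have hα : α ≤ M := by simpa [Nat.lt_succ_iff] using hα
    have e1 : X ^ ((α + 1) * (α + 1 - 1) / 2) * X ^ (M + 1 - (α + 1))
        = (X : ℤ⟦X⟧) ^ M * X ^ (α * (α - 1) / 2) := by
      rw [← pow_add, ← pow_add]
      congr 1
      cases α with
      | zero => simp
      | succ β =>
        simp only [Nat.add_sub_cancel]
        have h1 := two_mul_tri β
        have h2 := two_mul_tri (β + 1)
        rw [show (β + 1) * β = β * (β + 1) by ring, show (β + 1 + 1) * (β + 1) = (β+1)*(β+1+1) by ring]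
        have h3 : (β + 1) * (β + 1 + 1) = β * (β + 1) + 2 * (β + 1) := by ring
        omega
    push_cast
    simp only [Nat.add_sub_add_right, Nat.add_sub_cancel] at e1
    rw [show (M : ℤ) + 1 - (α + 1) = M - α by ring,
      show (P : ℤ) + 1 - (α + 1) - y = P - α - y by ring, show (α : ℤ) + 1 - 1 = α by ring]
    linear_combination (-(-1) ^ α * (iq α * iq (M - α) * (qPoch (P - α) * iq (P - α - y)))) * e1

/-- A terminating q-Chu–Vandermonde sum. The factor `iq (y - M)` matters most: (q)_{P-α} /
(q)_{P-α-y} behaves as a polynomial of degree y in q^(-α), so its M-th q-difference is 0 for y < M.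
-/
theorem altSum_eq (M P y : ℕ) (h : M ≤ P) :
    altSum M P y = iq M * qPoch y * X ^ (M * (P - y)) *
      (qPoch (P - M) * iq (y - M) * iq (P - y)) := by
  induction M generalizing P with
  | zero =>
    simp only [altSum, zero_add, Finset.sum_range_one, pow_zero, Nat.zero_sub, mul_zero,
      Nat.zero_div, Nat.cast_zero, sub_zero, iq_zero, one_mul, mul_one, Nat.sub_zero, zero_mul]
    linear_combination (-qPoch P * iq (P - y)) * qPoch_mul_iq y
  | succ M ih =>
    obtain ⟨P, rfl⟩ : ∃ P', P = P' + 1 := ⟨P - 1, by omega⟩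
    have hne : (1 - X ^ (M + 1) : ℤ⟦X⟧) ≠ 0 := by
      intro h0
      have := qPoch_succ M
      rw [h0, mul_zero] at this
      exact qPoch_ne_zero _ this
    refine mul_left_cancel₀ hne ?_
    rw [altSum_step, ih (P + 1) (by omega), ih P (by omega)]
    have hM := one_sub_mul_iq_succ M
    rcases lt_or_ge (P + 1) y with hy | hy
    · rw [iq_of_neg (show ((P + 1 : ℕ) : ℤ) - y < 0 by omega),
        iq_of_neg (show (P : ℤ) - y < 0 by omega)]
      ring
    obtain ⟨t, ht⟩ := Nat.exists_eq_add_of_le hy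
    obtain ⟨s, rfl⟩ := Nat.exists_eq_add_of_le (show M ≤ P by omega)
    have e1 : ((M + s + 1 : ℕ) : ℤ) - y = t := by rw [ht]; push_cast; ring
    have e2 : ((M + s : ℕ) : ℤ) - y = t - 1 := by rw [← e1]; push_cast; ring
    have e3 : X ^ M * (X : ℤ⟦X⟧) ^ (M * (M + s - y)) * iq (t - 1) =
        X ^ (M * t) * ((1 - X ^ t) * iq t) := by
      rw [one_sub_mul_iq]
      cases t with
      | zero => simp [iq_of_neg]
      | succ t =>
        rw [show M + s - y = t by omega]
        ring
    rw [e1, e2, show M + s + 1 - y = t by omega, show M + s + 1 - M = s + 1 by omega,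
      show M + s - M = s by omega, show M + s + 1 - (M + 1) = s by omega, ← hM, qPoch_succ]
    push_cast
    rcases lt_or_ge y M with hyM | hyM
    · rw [iq_of_neg (show (y : ℤ) - M < 0 by omega), iq_of_neg (show (y : ℤ) - (M + 1) < 0 by omega)]
      ring
    obtain ⟨u, rfl⟩ := Nat.exists_eq_add_of_le hyM
    have h4 := one_sub_mul_iq u
    have hsu : s + 1 = t + u := by omega
    rw [show ((M + u : ℕ) : ℤ) - M = u by push_cast; ring,
      show ((M + u : ℕ) : ℤ) - (M + 1) = u - 1 by push_cast; ring, ← h4, hsu]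
    linear_combination (-(1 - X ^ (M + 1)) * iq (M + 1) * qPoch (M + u) * qPoch s * iq u) * e3

end qIdentities

/-! ### The operator `kop`, its eigenvectors, and the theta series -/

section BaileyOperator

open PowerSeries

/-- The operator `f ↦ (-1)^m q^{m (m + 1) / 2} ∑_k f (m + k) / (q)_k`. -/
def kop (f : ℕ → ℤ⟦X⟧) (m : ℕ) : ℤ⟦X⟧ := mu m * ∑' k : ℕ, iq k * f (m + k)

theorem small_mu_nat (c : ℕ → ℤ⟦X⟧) : XSmall fun m : ℕ => mu m * c m := by
  simpa using small_mu_mul 0 c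

theorem small_kop (f : ℕ → ℤ⟦X⟧) : XSmall (kop f) := small_mu_nat _

theorem small_kop_iterate {f : ℕ → ℤ⟦X⟧} (hf : XSmall f) (s : ℕ) : XSmall (kop^[s] f) := by
  cases s with
  | zero => exact hf
  | succ s => rw [Function.iterate_succ_apply']; exact small_kop _

theorem XSmall.kop_summand {f : ℕ → ℤ⟦X⟧} (hf : XSmall f) (m : ℕ) :
    XSmall fun k : ℕ => iq k * f (m + k) :=
  (hf.comp_injective (add_right_injective m)).mul_left fun k => iq k

/-- The operator is triangular: its value at n uses only the values of the sequence from n on. -/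
theorem kop_congr {f g : ℕ → ℤ⟦X⟧} {m : ℕ} (h : ∀ n, m ≤ n → f n = g n) :
    ∀ n, m ≤ n → kop f n = kop g n := fun n hn => by
  unfold kop
  congr 1
  exact tsum_congr fun k => by rw [h _ (by omega)]

theorem kop_iterate_congr {f g : ℕ → ℤ⟦X⟧} {m : ℕ} (h : ∀ n, m ≤ n → f n = g n) (s : ℕ) :
    ∀ n, m ≤ n → kop^[s] f n = kop^[s] g n := by
  induction s with
  | zero => exact h
  | succ s ih =>
    simp only [Function.iterate_succ_apply']
    exact kop_congr ih

theorem kop_iterate_sum {ι : Type*} (S : Finset ι) (w : ι → ℤ⟦X⟧) {f : ι → ℕ → ℤ⟦X⟧}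
    (hf : ∀ i, XSmall (f i)) (s : ℕ) (m : ℕ) :
    kop^[s] (fun n => ∑ i ∈ S, w i * f i n) m = ∑ i ∈ S, w i * kop^[s] (f i) m := by
  induction s generalizing m with
  | zero => rfl
  | succ s ih =>
    simp only [Function.iterate_succ_apply']
    rw [show kop^[s] (fun n => ∑ i ∈ S, w i * f i n) = fun m => ∑ i ∈ S, w i * kop^[s] (f i) m from
      funext ih]
    change mu m * ∑' k : ℕ, iq k * (∑ i ∈ S, w i * kop^[s] (f i) (m + k)) =
      ∑ i ∈ S, w i * (mu m * ∑' k : ℕ, iq k * kop^[s] (f i) (m + k))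
    simp only [Finset.mul_sum]
    rw [Summable.tsum_finsetSum, Finset.mul_sum]
    · refine Finset.sum_congr rfl fun i _ => ?_
      rw [mul_left_comm, ← XSmall.tsum_mul_left ((small_kop_iterate (hf i) s).kop_summand m)]
      congr 1
      exact tsum_congr fun k => by ring
    · intro i _
      refine XSmall.summable ?_
      exact (((small_kop_iterate (hf i) s).kop_summand m).mul_left fun _ => w i).of_dvd
        fun k => dvd_of_eq (mul_left_comm _ _ _)

theorem kop_iterate_const_mul (c : ℤ⟦X⟧) {f : ℕ → ℤ⟦X⟧} (hf : XSmall f) (s m : ℕ) :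
    kop^[s] (fun n => c * f n) m = c * kop^[s] f m := by
  simpa using kop_iterate_sum {()} (fun _ => c) (f := fun _ => f) (fun _ => hf) s m

/-- Eigenvectors of `kop`. -/
def eigvec (n m : ℕ) : ℤ⟦X⟧ :=
  (1 - X ^ (2 * n + 1)) * ((-1) ^ m * X ^ (n * (n - m) + m * (m + 1) / 2)) *
    (qPoch (n + m) * iq m * iq (n - m))

theorem eigvec_of_lt {n m : ℕ} (h : n < m) : eigvec n m = 0 := by
  rw [eigvec, iq_of_neg (show (n : ℤ) - m < 0 by omega), mul_zero, mul_zero]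

theorem small_eigvec : XSmall fun p : ℕ × ℕ => eigvec p.1 p.2 := by
  refine XSmall.of_exponent (fun p => max p.1 p.2) (fun N => ?_) fun p => ?_
  · refine ((Set.finite_lt_nat N).prod (Set.finite_lt_nat N)).subset fun p hp => ?_
    simp only [Set.mem_ofPred_eq, sup_lt_iff, Set.mem_prod] at *
    exact hp
  · obtain ⟨n, m⟩ := p
    rcases lt_or_ge n m with h | h
    · simp [eigvec_of_lt h]
    · simp only [max_eq_left h]
      refine Dvd.dvd.mul_right (Dvd.dvd.mul_left (Dvd.dvd.mul_left (pow_dvd_pow _ ?_) _) _) _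
      obtain ⟨d, rfl⟩ := Nat.exists_eq_add_of_le h
      have := two_mul_tri m
      rw [Nat.add_sub_cancel_left]
      rcases Nat.eq_zero_or_pos d with rfl | hd
      · nlinarith [Nat.le_mul_self m]
      · nlinarith [Nat.zero_le (m * (m + 1) / 2)]

/-- The sequence `eigvec n` is supported on m ≤ n, so the sum is finite. Reversing it, with α = n -
m - k, gives `altSum` with M = n - m, P = 2n and y = n. -/
theorem kop_eigvec (n m : ℕ) : kop (eigvec n) m = mu n * eigvec n m := by
  rcases lt_or_ge n m with h | h
  · rw [eigvec_of_lt h, kop, tsum_congr fun k => by rw [eigvec_of_lt (show n < m + k by omega),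
      mul_zero], tsum_zero, mul_zero, mul_zero]
  obtain ⟨N, rfl⟩ := Nat.exists_eq_add_of_le h
  have hsum : ∑' k : ℕ, iq k * eigvec (m + N) (m + k) =
      (1 - X ^ (2 * (m + N) + 1)) * mu (m + N : ℕ) *
        altSum N (2 * (m + N)) (m + N) := by
    rw [tsum_eq_sum (s := Finset.range (N + 1)) fun k hk => by
      rw [eigvec_of_lt (by simp at hk; omega), mul_zero], altSum, Finset.mul_sum,
      ← Finset.sum_range_reflect]
    refine Finset.sum_congr rfl fun α hα => ?_
    have hα : α ≤ N := by simpa [Nat.lt_succ_iff] using hα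
    obtain ⟨d, rfl⟩ := Nat.exists_eq_add_of_le hα
    rw [show α + d + 1 - 1 - α = d by omega, eigvec, mu_natCast]
    have e1 : (-1 : ℤ⟦X⟧) ^ (m + d) * X ^ ((m + (α + d)) * (m + (α + d) - (m + d)) +
        (m + d) * (m + d + 1) / 2) = (-1) ^ (m + (α + d)) * X ^ ((m + (α + d)) *
          (m + (α + d) + 1) / 2) * ((-1) ^ α * X ^ (α * (α - 1) / 2)) := by
      have h1 : (-1 : ℤ⟦X⟧) ^ (m + (α + d)) = (-1) ^ (m + d) * (-1) ^ α := by ring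
      have h2 : (-1 : ℤ⟦X⟧) ^ α * (-1) ^ α = 1 := by rw [← mul_pow]; simp
      have h3 : (m + (α + d)) * (m + (α + d) - (m + d)) + (m + d) * (m + d + 1) / 2 =
          (m + (α + d)) * (m + (α + d) + 1) / 2 + α * (α - 1) / 2 := by
        have h4 := two_mul_tri (m + d)
        have h5 := two_mul_tri (m + (α + d))
        rw [show m + (α + d) - (m + d) = α by omega]
        cases α with
        | zero => simp
        | succ β =>
          have h6 := two_mul_tri β
          rw [Nat.add_sub_cancel, mul_comm (β + 1) β]
          nlinarith
      rw [h1, h3, pow_add X]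
      linear_combination (-(-1) ^ (m + d) * (X ^ ((m + (α + d)) * (m + (α + d) + 1) / 2) *
        X ^ (α * (α - 1) / 2))) * h2
    rw [e1, show 2 * (m + (α + d)) - α = m + (α + d) + (m + d) by omega,
      show ((m + (α + d) : ℕ) : ℤ) - (m + d : ℕ) = α by push_cast; ring,
      show ((2 * (m + (α + d)) : ℕ) : ℤ) - α - (m + (α + d) : ℕ) = (m + d : ℕ) by push_cast; ring,
      show ((α + d : ℕ) : ℤ) - α = d by push_cast; ring]
    ring
  rw [kop, hsum, altSum_eq _ _ _ (by omega), eigvec, mu_natCast m,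
    show 2 * (m + N) - (m + N) = m + N by omega, show 2 * (m + N) - N = m + N + m by omega,
    show ((m + N : ℕ) : ℤ) - N = m by push_cast; ring,
    show ((m + N : ℕ) : ℤ) - m = N by push_cast; ring,
    show ((2 * (m + N) : ℕ) : ℤ) - (m + N : ℕ) = (m + N : ℕ) by push_cast; ring,
    show m + N - m = N by omega, pow_add X]
  linear_combination ((1 - X ^ (2 * (m + N) + 1)) * mu (m + N : ℕ) * X ^ (N * (m + N)) *
    (-1) ^ m * X ^ (m * (m + 1) / 2) * iq N * qPoch (m + N + m) * iq m) * qPoch_mul_iq (m + N)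

theorem kop_iterate_tsum_eigvec (s m : ℕ) :
    kop^[s] (fun m => ∑' n : ℕ, eigvec n m) m = ∑' n : ℕ, mu n ^ s * eigvec n m := by
  induction s generalizing m with
  | zero => simp
  | succ s ih =>
    rw [Function.iterate_succ_apply', funext ih, kop]
    have h1 : XSmall fun p : ℕ × ℕ => iq p.1 * (mu p.2 ^ s * eigvec p.2 (m + p.1)) := by
      have := small_eigvec.comp_injective (e := fun p : ℕ × ℕ => (p.2, m + p.1))
        (fun p q h => by ext <;> simp at h <;> omega)
      exact (this.mul_left fun p => iq p.1 * mu p.2 ^ s).of_dvd fun p =>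
        dvd_of_eq (by simp only []; ring)
    have h2 : ∀ k, XSmall fun n : ℕ => mu n ^ s * eigvec n (m + k) := fun k =>
      (small_eigvec.right_fiber (m + k)).mul_left _
    have h3 : ∀ n : ℕ, XSmall fun k : ℕ => iq k * eigvec n (m + k) := fun n =>
      XSmall.kop_summand (small_eigvec.left_fiber n) m
    have h4 : XSmall fun n : ℕ => ∑' k : ℕ, iq k * (mu n ^ s * eigvec n (m + k)) :=
      (h1.comp_injective Prod.swap_injective).tsum_right
    rw [tsum_congr fun k : ℕ => ((h2 k).tsum_mul_left (iq k)).symm, XSmall.tsum_comm h1,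
      ← h4.tsum_mul_left]
    refine tsum_congr fun n => ?_
    have h5 := kop_eigvec n m
    rw [kop] at h5
    calc mu m * ∑' k : ℕ, iq k * (mu n ^ s * eigvec n (m + k))
        = mu m * ∑' k : ℕ, mu n ^ s * (iq k * eigvec n (m + k)) := by
          congr 1; exact tsum_congr fun k => by ring
      _ = mu n ^ s * (mu m * ∑' k : ℕ, iq k * eigvec n (m + k)) := by
          rw [(h3 n).tsum_mul_left]; ring
      _ = mu n ^ (s + 1) * eigvec n m := by rw [h5]; ring

theorem small_X_pow_quad (a : ℕ) (c : ℕ → ℤ⟦X⟧) : XSmall fun j : ℕ => X ^ ((a + j) * j) * c j :=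
  XSmall.of_exponent (fun j => (a + j) * j)
    (fun N => (Set.finite_lt_nat (N + 1)).subset fun b hb => by
      simp only [Set.mem_ofPred_eq] at *; nlinarith) fun _ => dvd_mul_right _ _

/-- The normalization that makes the eigenvectors add up to `mu`. The sum telescopes for m = 0, and
passing from m to m + 1 multiplies it by 1 - q^(m+1). -/
theorem tsum_wellPoised (m : ℕ) :
    ∑' j : ℕ, X ^ ((m + j) * j) * ((1 - X ^ (2 * m + 2 * j + 1)) * qPoch (2 * m + j) * iq j) =
      qPoch m := by
  induction m with
  | zero =>
    have h : ∀ j : ℕ, X ^ ((0 + j) * j) * ((1 - X ^ (2 * 0 + 2 * j + 1)) * qPoch (2 * 0 + j) * iq j)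
        = X ^ ((0 + j) * j) * 1 - X ^ ((0 + (j + 1)) * (j + 1)) * 1 := by
      intro j
      simp only [mul_zero, zero_add]
      linear_combination (X ^ (j * j) * (1 - X ^ (2 * j + 1))) * qPoch_mul_iq j
    have h2 := small_X_pow_quad 0 fun _ => 1
    rw [tsum_congr h, XSmall.tsum_sub h2 (h2.comp_injective (add_left_injective 1)),
      h2.tsum_eq_zero_add, qPoch_zero]
    simp
  | succ m ih =>
    set t : ℕ → ℤ⟦X⟧ := fun j => X ^ ((m + 1 + j) * j) * (qPoch (2 * m + 1 + j) * iq j) with ht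
    have hts : XSmall t := small_X_pow_quad (m + 1) _
    have hW : ∑' j : ℕ, X ^ ((m + j) * j) *
        ((1 - X ^ (2 * m + 2 * j + 1)) * qPoch (2 * m + j) * iq j) =
        ∑' j, (t j + t j * X ^ (j + 1 + m)) := by
      -- Split 1 - q^(2m+2j+1) = (1 - q^j) + q^j (1 - q^(2m+j+1)); the first part is then shifted in
      -- j so that both are multiples of t j.
      have h1 : ∀ j : ℕ, X ^ ((m + j) * j) *
          ((1 - X ^ (2 * m + 2 * j + 1)) * qPoch (2 * m + j) * iq j) =
          X ^ ((m + j) * j) * (qPoch (2 * m + j) * iq (j - 1)) + t j := by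
        intro j
        rw [← one_sub_mul_iq, ht]
        simp only [show 2 * m + 1 + j = 2 * m + j + 1 by ring, qPoch_succ]
        ring
      rw [tsum_congr h1, XSmall.tsum_add (small_X_pow_quad m _) hts,
        XSmall.tsum_add hts (hts.mul_right _), add_comm]
      congr 1
      rw [(small_X_pow_quad m _).tsum_eq_zero_add]
      simp only [mul_zero, pow_zero, Nat.cast_zero, zero_sub, iq_of_neg (show (-1 : ℤ) < 0 by norm_num),
        zero_add]
      refine tsum_congr fun j => ?_
      rw [ht]
      push_cast
      simp only [add_sub_cancel_right, show 2 * m + (j + 1) = 2 * m + 1 + j by ring]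
      ring
    -- The difference between the two sides of the recursion is a shift: the term of index j + 1 on
    -- the left is the term of index j on the right.
    have htel : ∑' j, X ^ (m + 1) * (t j * (1 - X ^ j)) =
        ∑' j, t j * (X ^ (2 * m + 2 * j + 3) * (1 - X ^ (2 * m + 2 + j))) := by
      rw [((hts.mul_right _).mul_left _).tsum_eq_zero_add]
      simp only [pow_zero, sub_self, mul_zero, zero_add]
      refine tsum_congr fun j => ?_
      rw [ht]
      have := one_sub_mul_iq_succ j
      push_cast
      simp only [show 2 * m + 1 + (j + 1) = 2 * m + 1 + j + 1 by ring, qPoch_succ, ← this]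
      ring
    rw [qPoch_succ, ← ih, hW, ← sub_eq_zero,
      ← XSmall.tsum_mul_right (hts.add (hts.mul_right _)), ← XSmall.tsum_sub (small_X_pow_quad _ _)
        ((hts.add (hts.mul_right _)).mul_right _), ← sub_eq_zero.mpr htel,
      ← XSmall.tsum_sub ((hts.mul_right _).mul_left _) (hts.mul_right _)]
    refine tsum_congr fun j => ?_
    rw [ht]
    simp only [show 2 * (m + 1) + j = 2 * m + 1 + j + 1 by ring, qPoch_succ]
    ring

theorem tsum_eigvec (m : ℕ) : ∑' n : ℕ, eigvec n m = mu m := by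
  have hs := (small_eigvec.right_fiber m)
  rw [← hs.summable.sum_add_tsum_nat_add m, Finset.sum_eq_zero fun n hn =>
    eigvec_of_lt (Finset.mem_range.mp hn), zero_add]
  have h : ∀ j, eigvec (j + m) m = mu m * iq m * (X ^ ((m + j) * j) *
      ((1 - X ^ (2 * m + 2 * j + 1)) * qPoch (2 * m + j) * iq j)) := by
    intro j
    rw [eigvec, mu_natCast, show j + m - m = j by omega,
      show ((j + m : ℕ) : ℤ) - m = j by push_cast; ring, show j + m + m = 2 * m + j by ring,
      pow_add X]
    ring
  rw [tsum_congr h, XSmall.tsum_mul_left (small_X_pow_quad _ _), tsum_wellPoised, mul_assoc,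
    iq_mul_qPoch, mul_one]

/-- Decompose `mu` into eigenvectors, apply the eigenvalue s times, and evaluate at 0, where `eigvec
n 0` is q^(n²) (1 - q^(2n+1)). -/
theorem kop_iterate_mu (s : ℕ) :
    kop^[s] (fun m => mu m) 0 = ∑' n : ℕ, mu n ^ s * (X ^ (n * n) - X ^ ((n + 1) * (n + 1))) := by
  rw [← show (fun m => ∑' n : ℕ, eigvec n m) = fun m : ℕ => mu m from funext tsum_eigvec,
    kop_iterate_tsum_eigvec]
  refine tsum_congr fun n => ?_
  rw [eigvec]
  simp only [pow_zero, Nat.sub_zero, zero_mul, Nat.zero_div, add_zero, Nat.cast_zero, iq_zero,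
    sub_zero, mul_one, one_mul, qPoch_mul_iq]
  ring

/-- Pair n ≥ 0 with -(n+1). Both have the same n(n+1) and opposite signs ε, for either parity of s.
-/
theorem thetaSeries_eq (s : ℕ) :
    thetaSeries (s + 2) =
      ∑' n : ℕ, mu n ^ s * (X ^ (n * n) - X ^ ((n + 1) * (n + 1))) := by
  have hsq : XSmall fun n : ℕ => (X : ℤ⟦X⟧) ^ (n * n) := by
    simpa using small_X_pow_quad 0 fun _ => 1
  have hsq' : XSmall fun n : ℕ => (X : ℤ⟦X⟧) ^ ((n + 1) * (n + 1)) :=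
    hsq.comp_injective (add_left_injective 1)
  have hsign : ∀ n : ℕ, thetaSign (s + 2) n = (-1) ^ (n * s) ∧
      thetaSign (s + 2) (-(n + 1)) = -(-1) ^ (n * s) := by
    intro n
    unfold thetaSign
    have h1 : Odd (s + 2) ↔ Odd s := by simp [Nat.odd_add, parity_simps]
    simp only [h1]
    by_cases hs : Odd s
    · have h2 : (-1 : ℤ) ^ (n * s) = (-1) ^ n := by rw [mul_comm, pow_mul, hs.neg_one_pow]
      rw [if_pos hs, if_pos hs, h2, Int.natAbs_natCast, show (-((n : ℤ) + 1)).natAbs = n + 1 by omega]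
      exact ⟨rfl, by ring⟩
    · have h2 : (-1 : ℤ) ^ (n * s) = 1 := by
        rw [mul_comm, pow_mul, (Nat.not_odd_iff_even.mp hs).neg_one_pow, one_pow]
      rw [if_neg hs, if_neg hs, h2, if_pos (by positivity), if_neg (by omega)]
      exact ⟨rfl, rfl⟩
  have hX : ∀ (e : ℕ) (c : ℤ), (PowerSeries.monomial e) c = (c : ℤ⟦X⟧) * X ^ e := by
    intro e c
    rw [PowerSeries.monomial_eq_mk]
    ext k
    rw [← map_intCast (PowerSeries.C (R := ℤ)), PowerSeries.coeff_C_mul_X_pow]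
    simp
  have hmu : ∀ n : ℕ, mu n ^ s = (-1) ^ (n * s) * X ^ (s * (n * (n + 1) / 2)) := by
    intro n
    rw [mu_natCast, mul_pow, ← pow_mul, ← pow_mul, mul_comm s]
  have hexp : ∀ n : ℕ, ((s + 2 : ℕ) * ((n : ℤ) * (n + 1)) / 2) = (s * (n * (n + 1) / 2) : ℕ) +
      n * (n + 1) := by
    intro n
    have h1 := two_mul_tri n
    refine Int.ediv_eq_of_eq_mul_right two_ne_zero ?_
    zify at h1
    push_cast
    linear_combination (-(s : ℤ)) * h1
  have hpos : ∀ n : ℕ, PowerSeries.monomial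
      (((s + 2 : ℕ) * ((n : ℤ) * ((n : ℤ) + 1)) / 2 - (n : ℤ)).toNat) (thetaSign (s + 2) n)
      = mu n ^ s * X ^ (n * n) := by
    intro n
    rw [hX, (hsign n).1, hmu, hexp, show (((s * (n * (n + 1) / 2) : ℕ) : ℤ) + n * (n + 1) - n).toNat
      = s * (n * (n + 1) / 2) + n * n from by
        rw [show (((s * (n * (n + 1) / 2) : ℕ) : ℤ) + n * (n + 1) - n) =
          ((s * (n * (n + 1) / 2) + n * n : ℕ) : ℤ) by push_cast; ring, Int.toNat_natCast], pow_add X]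
    push_cast
    ring
  have hneg : ∀ n : ℕ, PowerSeries.monomial
      (((s + 2 : ℕ) * (-((n : ℤ) + 1) * (-((n : ℤ) + 1) + 1)) / 2 - -((n : ℤ) + 1)).toNat)
        (thetaSign (s + 2) (-((n : ℤ) + 1)))
      = -(mu n ^ s * X ^ ((n + 1) * (n + 1))) := by
    intro n
    rw [hX, (hsign n).2, hmu, show (-((n : ℤ) + 1) * (-((n : ℤ) + 1) + 1)) = n * (n + 1) by ring,
      hexp, show (((s * (n * (n + 1) / 2) : ℕ) : ℤ) + n * (n + 1) - -((n : ℤ) + 1)) =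
          ((s * (n * (n + 1) / 2) + (n + 1) * (n + 1) : ℕ) : ℤ) by push_cast; ring,
      Int.toNat_natCast, pow_add X]
    push_cast
    ring
  unfold thetaSeries
  have hs1 := hsq.mul_left fun n => mu n ^ s
  have hs2 := (hsq'.mul_left fun n => mu n ^ s)
  rw [tsum_of_nat_of_neg_add_one]
  · rw [tsum_congr hpos, tsum_congr hneg, tsum_neg, ← sub_eq_add_neg, ← XSmall.tsum_sub hs1 hs2]
    exact tsum_congr fun n => by ring
  · exact (summable_congr hpos).mpr hs1.summable
  · exact (summable_congr hneg).mpr hs2.neg.summable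

end BaileyOperator

/-! ### Summation along the new path -/

section PathSum

open PowerSeries

/-- Sums over the interior vertices of a path with `s` interior vertices that starts at a vertex
of label `x` and ends at a vertex of label `y`, next to a face of label `a`. -/
def pathSum (a : ℤ) (y : ℕ) : ℕ → ℕ → ℤ⟦X⟧
  | 0, x => X ^ (x * y) * iq (a + x)
  | s + 1, x => iq (a + x) * ∑' b : ℕ, X ^ (b * (a + x + 1).toNat) * iq b * pathSum a y s b

/-- Coefficients of the expansion of `pathSum a y 0 x` in powers of `q^x`. -/
def pathCoeff (a : ℤ) (y n : ℕ) : ℤ⟦X⟧ := mu (n - y) * (qPoch (n - a).toNat * iq (n - a - y))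

theorem small_pathCoeff (a : ℤ) (y : ℕ) : XSmall (pathCoeff a y) := by
  refine ((small_mu (-y)).mul_right fun n : ℕ => qPoch (n - a).toNat * iq (n - a - y)).of_dvd
    fun n => dvd_of_eq ?_
  rw [pathCoeff, neg_add_eq_sub]

theorem tsum_natCast_eq_of_shift {R : Type*} [AddCommGroup R] [TopologicalSpace R]
    [IsTopologicalAddGroup R] [T2Space R] {f g : ℕ → R} (hf : Summable f) (a : ℕ)
    (h0 : ∀ n < a, f n = 0) (h : ∀ n, f (n + a) = g n) : ∑' n, f n = ∑' n, g n := by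
  rw [← hf.sum_add_tsum_nat_add a, Finset.sum_eq_zero fun n hn => h0 n (Finset.mem_range.mp hn),
    zero_add, tsum_congr h]

/-- The coefficients vanish for m < a + y. With m = a + y + k, the factor (q)_{m-a} cancels and
`tsum_mu` remains. -/
theorem tsum_pathCoeff (a : ℤ) (x y : ℕ) (h : 0 ≤ a + y) :
    ∑' m : ℕ, X ^ (x * (m - a).toNat) * iq (m - a) * pathCoeff a y m =
      mu a * qPochInf * (X ^ (x * y) * iq (a + x)) := by
  obtain ⟨α, hα⟩ := Int.eq_ofNat_of_zero_le h
  have h1 := tsum_mu a x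
  have hs := (small_mu_mul a fun k => X ^ (x * k) * iq k).mul_left fun _ => X ^ (x * y)
  rw [tsum_natCast_eq_of_shift (g := fun k : ℕ => X ^ (x * y) *
    (mu (a + k) * (X ^ (x * k) * iq k))) ((small_pathCoeff a y).mul_left _).summable α,
    (small_mu_mul a _).tsum_mul_left, h1]
  · ring
  · intro n hn
    rw [pathCoeff, iq_of_neg (show (n : ℤ) - a - y < 0 by omega)]
    simp
  · intro k
    have e1 : ((k + α : ℕ) : ℤ) - a = (y + k : ℕ) := by push_cast; linarith
    have e2 : ((k + α : ℕ) : ℤ) - y = a + k := by push_cast; linarith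
    rw [pathCoeff, e1, e2, Int.toNat_natCast, show ((y + k : ℕ) : ℤ) - y = k by push_cast; ring]
    linear_combination (X ^ (x * (y + k)) * mu (a + k) * iq k) * qPoch_mul_iq (y + k)

/-- Up to a power of q, the quotient (q)_{m+L} / (q)_{m+L-l} is a polynomial of degree l in q^(m+L),
so the first L vanishing moments suffice. -/
theorem tsum_iq_sub_eq_zero {f : ℕ → ℤ⟦X⟧} (hf : XSmall f) {L : ℕ}
    (h : ∀ b < L, ∑' m : ℕ, X ^ (b * (m + L)) * iq (m + L) * f m = 0) {l : ℕ} (hl : l < L) :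
    ∑' m : ℕ, iq (m + L - l) * f m = 0 := by
  have key : ∀ l b : ℕ, l + b < L →
      ∑' m : ℕ, X ^ (b * (m + L)) * iq (m + L - l) * f m = 0 := by
    intro l
    induction l with
    | zero => intro b hb; simpa using h b (by omega)
    | succ l ih =>
      intro b hb
      have h1 := ih b (by omega)
      have h2 := ih (b + 1) (by omega)
      -- Since q^l (1 - q^(m+L-l)) = q^l - q^(m+L), the sum for l + 1, multiplied by q^l, is a
      -- combination of the sums for l at b and at b + 1.
      refine (mul_eq_zero.mp ?_).resolve_left (pow_ne_zero l X_ne_zero)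
      rw [← (hf.mul_left _).tsum_mul_left, ← mul_zero (X ^ l), ← h1, ← sub_zero (X ^ l * _), ← h2,
        ← (hf.mul_left _).tsum_mul_left, ← XSmall.tsum_sub ((hf.mul_left _).mul_left _)
          (hf.mul_left _)]
      refine tsum_congr fun m => ?_
      have h3 := one_sub_mul_iq (m + L - l)
      rw [show ((m + L - l : ℕ) : ℤ) = m + L - l by omega] at h3
      rw [show (m + L - (l + 1 : ℕ) : ℤ) = m + L - l - 1 by push_cast; ring, ← h3]
      have h4 : (X : ℤ⟦X⟧) ^ (m + L) = X ^ l * X ^ (m + L - l) := by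
        rw [← pow_add]; congr 1; omega
      rw [add_mul, pow_add, one_mul]
      linear_combination (X ^ (b * (m + L)) * iq (m + L - l) * f m) * h4
  simpa using key l 0 (by omega)

/-- Insert the expansion for s into the recursion. Euler's identity sums over b and gives (q)_{x+m};
the q-binomial theorem expands the result in powers of q^x again, with index l. The coefficient at p
= a + l is `kop` of the old sequence. -/
theorem pathSum_expansion (a : ℤ) (y : ℕ) (h : 0 ≤ a + y) (s x : ℕ) :
    (mu a * qPochInf) ^ (s + 1) * pathSum a y s x =
      ∑' m : ℕ, X ^ (x * (m - a).toNat) * iq (m - a) * kop^[s] (pathCoeff a y) m := by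
  induction s generalizing x with
  | zero => rw [Function.iterate_zero, id, tsum_pathCoeff a x y h, pathSum, zero_add, pow_one]
  | succ s ih =>
    set f := kop^[s] (pathCoeff a y) with hf
    have hfs : XSmall f := small_kop_iterate (small_pathCoeff a y) s
    have hkop : ∀ p : ℕ, kop f p = mu p * ∑' m : ℕ, iq (m - p) * f m := by
      intro p
      rw [kop]
      congr 1
      symm
      refine tsum_natCast_eq_of_shift (hfs.mul_left _).summable p (fun n hn => ?_) fun n => ?_
      · rw [iq_of_neg (by omega), zero_mul]
      · rw [add_comm p n]; congr 2; push_cast; ring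
    -- the double sum over `m` and the summation index of the `q`-binomial theorem
    have hds : XSmall fun p : ℕ × ℕ => mu (a + p.1) * (X ^ (x * p.1) * iq p.1) *
        (iq (p.2 - a - p.1) * f p.2) := by
      refine (((small_mu_mul a fun l => X ^ (x * l) * iq l).prodMul hfs).mul_left
        fun p => iq (p.2 - a - p.1)).of_dvd fun p => dvd_of_eq (mul_left_comm _ _ _)
    have hfin : ∀ m : ℕ, ∑' l : ℕ, mu (a + l) * (X ^ (x * l) * iq l) * (iq (m - a - l) * f m) =
        mu a * (qPoch (x + m) * iq (a + x) * iq (m - a)) * f m := by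
      intro m
      rcases lt_or_ge ((m : ℤ) - a) 0 with hm | hm
      · rw [iq_of_neg hm, tsum_congr fun l : ℕ => by
          rw [iq_of_neg (show (m : ℤ) - a - l < 0 by omega), zero_mul, mul_zero], tsum_zero]
        ring
      · obtain ⟨j, hj⟩ := Int.eq_ofNat_of_zero_le hm
        rw [hj, ← sum_mu a x j (x + m) (by push_cast; linarith), Finset.sum_mul,
          tsum_eq_sum (s := Finset.range (j + 1)) fun l hl => by
            rw [iq_of_neg (show (j : ℤ) - l < 0 by simp at hl; omega), zero_mul, mul_zero]]
        exact Finset.sum_congr rfl fun l _ => by ring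
    have hswap : ∑' l : ℕ, mu (a + l) * (X ^ (x * l) * iq l) * ∑' m : ℕ, iq (m - (a + l)) * f m =
        ∑' m : ℕ, mu a * (qPoch (x + m) * iq (a + x) * iq (m - a)) * f m := by
      rw [← tsum_congr hfin, ← XSmall.tsum_comm hds]
      refine tsum_congr fun l => ?_
      rw [← (hfs.mul_left _).tsum_mul_left]
      exact tsum_congr fun m => by rw [sub_add_eq_sub_sub]
    have hrhs : ∑' m : ℕ, X ^ (x * (m - a).toNat) * iq (m - a) * kop f m =
        ∑' l : ℕ, mu (a + l) * (X ^ (x * l) * iq l) * ∑' m : ℕ, iq (m - (a + l)) * f m := by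
      rcases le_or_gt 0 a with ha | ha
      · obtain ⟨A, rfl⟩ := Int.eq_ofNat_of_zero_le ha
        refine tsum_natCast_eq_of_shift ((small_kop f).mul_left _).summable A (fun n hn => ?_)
          fun n => ?_
        · rw [iq_of_neg (by omega)]; ring
        · rw [hkop, show ((n + A : ℕ) : ℤ) - A = n by push_cast; ring, Int.toNat_natCast,
            show ((n + A : ℕ) : ℤ) = A + n by push_cast; ring]
          ring
      -- For a = -L < 0 the index p = a + l also takes negative values, where `kop` is not defined.
      -- These L terms vanish: `pathSum` is 0 at b < L, which by induction gives the required
      -- vanishing moments.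
      · obtain ⟨L, hL⟩ := Int.eq_ofNat_of_zero_le (show 0 ≤ -a by omega)
        obtain rfl : a = -L := by omega
        have hzero : ∀ b < L, ∑' m : ℕ, X ^ (b * (m + L)) * iq (m + L) * f m = 0 := by
          intro b hb
          have h1 := ih b
          have h2 : pathSum (-L) y s b = 0 := by
            cases s <;> simp [pathSum, iq_of_neg (show -(L : ℤ) + b < 0 by omega)]
          rw [h2, mul_zero] at h1
          rw [h1]
          refine tsum_congr fun m => ?_
          rw [sub_neg_eq_add, show ((m : ℤ) + L).toNat = m + L by omega]
        symm
        refine tsum_natCast_eq_of_shift ((small_mu_mul _ _).mul_right _).summable L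
          (fun l hl => ?_) fun p => ?_
        · have := tsum_iq_sub_eq_zero hfs hzero hl
          rw [tsum_congr fun m : ℕ => by rw [show (m : ℤ) - (-L + l) = m + L - l by ring], this,
            mul_zero]
        · rw [hkop, show -(L : ℤ) + (p + L : ℕ) = p by push_cast; ring,
            show (p : ℤ) - -L = (p + L : ℕ) by push_cast; ring, Int.toNat_natCast]
          ring
    rw [Function.iterate_succ_apply', ← hf, hrhs, hswap, pathSum]
    rcases lt_or_ge (a + x) 0 with hx | hx
    · rw [iq_of_neg hx]
      simp
    obtain ⟨n, hn⟩ := Int.eq_ofNat_of_zero_le hx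
    have hn1 : (a + x + 1).toNat = n + 1 := by omega
    have hT : XSmall fun b : ℕ => X ^ (b * (n + 1)) * iq b * pathSum a y s b :=
      (small_X_pow_mul n fun b => iq b * pathSum a y s b).of_dvd fun b =>
        dvd_of_eq (mul_assoc _ _ _).symm
    have hE : ∀ b : ℕ, (mu a * qPochInf) ^ (s + 1) *
        (X ^ (b * (n + 1)) * iq b * pathSum a y s b) =
        ∑' m : ℕ, X ^ (b * (n + 1)) * iq b * (X ^ (b * (m - a).toNat) * iq (m - a) * f m) := by
      intro b
      rw [(hfs.mul_left _).tsum_mul_left, ← ih b]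
      ring
    have hds' : XSmall fun p : ℕ × ℕ => X ^ (p.1 * (n + 1)) * iq p.1 *
        (X ^ (p.1 * (p.2 - a).toNat) * iq (p.2 - a) * f p.2) := by
      refine (((small_X_pow_mul n fun b => iq b).prodMul hfs).mul_left
        fun p => X ^ (p.1 * (p.2 - a).toNat) * iq (p.2 - a)).of_dvd fun p => dvd_of_eq ?_
      ring
    have hsum : ∑' b : ℕ, (mu a * qPochInf) ^ (s + 1) *
        (X ^ (b * (n + 1)) * iq b * pathSum a y s b) =
        ∑' m : ℕ, iq (m - a) * f m *
          ∑' b : ℕ, X ^ (b * (n + (m - a).toNat + 1)) * iq b := by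
      rw [tsum_congr hE, XSmall.tsum_comm hds']
      refine tsum_congr fun m => ?_
      rw [← (small_X_pow_mul _ _).tsum_mul_left]
      exact tsum_congr fun b => by ring
    calc (mu a * qPochInf) ^ (s + 1 + 1) * (iq (a + x) *
          ∑' b : ℕ, X ^ (b * (a + x + 1).toNat) * iq b * pathSum a y s b)
        = mu a * iq (a + x) * (qPochInf * ∑' m : ℕ, iq (m - a) * f m *
            ∑' b : ℕ, X ^ (b * (n + (m - a).toNat + 1)) * iq b) := by
          rw [← hsum, hT.tsum_mul_left, hn1]
          ring
      _ = _ := by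
          rw [← ((hfs.mul_left fun m => iq (m - a)).mul_right _).tsum_mul_left,
            ← XSmall.tsum_mul_left (((hfs.mul_left fun m => iq (m - a)).mul_right _).mul_left _)]
          refine tsum_congr fun m => ?_
          rcases lt_or_ge ((m : ℤ) - a) 0 with hm | hm
          · rw [iq_of_neg hm]
            ring
          · have h1 := qPochInf_mul_tsum (n + (m - a).toNat)
            rw [show n + ((m : ℤ) - a).toNat = x + m by omega] at h1 ⊢
            linear_combination (mu a * iq (a + x) * iq (m - a) * f m) * h1

/-- For each value of the second index only finitely many first indices contribute, so smallness in
the second index alone is enough. -/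
theorem XSmall.of_triangle {f : ℕ × ℕ → ℤ⟦X⟧} {c : ℕ → ℤ⟦X⟧} (hc : XSmall c) (y : ℕ)
    (h : ∀ p, c p.2 ∣ f p) (h0 : ∀ p : ℕ × ℕ, p.2 + y < p.1 → f p = 0) : XSmall f := fun N => by
  refine ((hc N).biUnion fun m _ => (Set.finite_le_nat (m + y)).prod (Set.finite_singleton m)).subset
    fun p hp => ?_
  simp only [Set.mem_iUnion]
  refine ⟨p.2, fun h' => hp (h'.trans (h p)), ?_, rfl⟩
  by_contra hlt
  exact hp (by rw [h0 p (by simpa using hlt)]; exact dvd_zero _)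

/-- This is `altSum` with M = m + y and P = n + y. Its factor `iq (y - M)` is `iq (-m)`, which kills
every m > 0. -/
theorem sum_pathCoeff (m n y : ℕ) (h : m ≤ n) :
    ∑ α ∈ Finset.range (m + y + 1), (-1) ^ (α + y) * X ^ (α * (α - 1) / 2) *
      (iq α * iq ((m + y : ℕ) - α)) * pathCoeff (α - y) y n =
      (if m = 0 then X ^ (y * (y - 1) / 2) else 0) * mu n := by
  have h1 : ∑ α ∈ Finset.range (m + y + 1), (-1) ^ (α + y) * X ^ (α * (α - 1) / 2) *
      (iq α * iq ((m + y : ℕ) - α)) * pathCoeff (α - y) y n =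
      (-1) ^ y * mu (n - y) * altSum (m + y) (n + y) y := by
    rw [altSum, Finset.mul_sum]
    refine Finset.sum_congr rfl fun α hα => ?_
    have hα : α ≤ m + y := by simpa [Nat.lt_succ_iff] using hα
    rw [pathCoeff, show ((n : ℤ) - (α - y)).toNat = n + y - α by omega,
      show (n : ℤ) - (α - y) - y = (n + y : ℕ) - α - y by push_cast; ring]
    ring
  rw [h1, altSum_eq _ _ _ (by omega), show n + y - y = n by omega]
  split_ifs with hm
  · subst hm
    have h2 : (-1) ^ y * mu (n - y) * X ^ (y * n) = X ^ (y * (y - 1) / 2) * mu n := by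
      have h3 := mu_mul_X_pow (a := n) (b := n - y) (l := y) (p := y * (y - 1) / 2) (q := y * n)
        (by simp) (by
          cases y with
          | zero => simp
          | succ z =>
            have h4 := two_mul_tri z
            zify at h4
            rw [Nat.add_sub_cancel, mul_comm (z + 1) z]
            push_cast
            rw [h4]
            ring)
      rw [← h3, mul_comm]
    rw [← h2, zero_add, show n + y - y = n by omega, show ((n + y : ℕ) : ℤ) - y = n by push_cast; ring,
      sub_self, iq_zero]
    linear_combination ((-1) ^ y * mu (n - y) * X ^ (y * n) * (iq y * qPoch y)) * qPoch_mul_iq n +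
      ((-1) ^ y * mu (n - y) * X ^ (y * n)) * qPoch_mul_iq y
  · rw [iq_of_neg (show (y : ℤ) - (m + y : ℕ) < 0 by push_cast; omega)]
    ring

theorem pathSum_of_neg {a : ℤ} {x : ℕ} (h : a + x < 0) (y s : ℕ) : pathSum a y s x = 0 := by
  cases s <;> simp [pathSum, iq_of_neg h]

theorem small_pathSum (s x y : ℕ) : XSmall fun α : ℕ =>
    mu (α - y) ^ s * X ^ (α * (α - y + x : ℤ).toNat) * iq α * pathSum (α - y) y s x := by
  refine XSmall.of_exponent (fun α => α * (α - y + x : ℤ).toNat) (fun N => ?_) fun α =>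
    ((dvd_mul_left _ _).mul_right _).mul_right _
  refine (Set.finite_lt_nat (N + y + 1)).subset fun α hα => ?_
  simp only [Set.mem_ofPred_eq] at *
  by_contra h
  have h1 : 1 ≤ ((α : ℤ) - y + x).toNat := by omega
  nlinarith

/-- Here a = α - y. After `pathSum_expansion`, x occurs only in q^(x(m+y)). The sum over α commutes
with `kop^[s]` and by `sum_pathCoeff` selects m = 0. -/
theorem tsum_pathSum (s x y : ℕ) :
    qPochInf ^ (s + 1) * ∑' α : ℕ,
      mu (α - y) ^ s * X ^ (α * (α - y + x : ℤ).toNat) * iq α * pathSum (α - y) y s x =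
    X ^ (x * y) * kop^[s] (fun m => mu m) 0 := by
  set w : ℕ → ℕ → ℤ⟦X⟧ := fun m α => (-1) ^ (α + y) * X ^ (α * (α - 1) / 2) *
    (iq α * iq ((m + y : ℕ) - α)) with hw
  refine mul_left_cancel₀ (pow_ne_zero (y * (y - 1) / 2) X_ne_zero) ?_
  have hterm : ∀ α : ℕ, X ^ (y * (y - 1) / 2) * qPochInf ^ (s + 1) *
      (mu (α - y) ^ s * X ^ (α * (α - y + x : ℤ).toNat) * iq α * pathSum (α - y) y s x) =
      ∑' m : ℕ, X ^ (x * (m + y)) * (w m α * kop^[s] (pathCoeff (α - y) y) m) := by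
    intro α
    have h1 := pathSum_expansion (α - y) y (by omega) s x
    -- The auxiliary power q^(y(y-1)/2) is chosen to produce one more factor μ(a), completing the
    -- power s + 1 that the expansion needs.
    have h2 : X ^ (y * (y - 1) / 2) * (X ^ (α * (α - y + x : ℤ).toNat) * pathSum (α - y) y s x) =
        (-1) ^ (α + y) * mu (α - y) * X ^ (α * (α - 1) / 2 + α * x) * pathSum (α - y) y s x := by
      rcases lt_or_ge ((α : ℤ) - y + x) 0 with hx | hx
      · rw [pathSum_of_neg hx]; ring
      · rw [← mul_assoc, ← pow_add]
        congr 1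
        have h3 := mu_mul_X_pow (a := 0) (b := α - y) (l := α + y)
          (p := y * (y - 1) / 2 + α * ((α : ℤ) - y + x).toNat) (q := α * (α - 1) / 2 + α * x)
          ⟨-α, by push_cast; ring⟩ (by
            have h4 : ∀ k : ℕ, (2 * (k * (k - 1) / 2 : ℕ) : ℤ) = k * k - k := by
              intro k
              cases k with
              | zero => simp
              | succ z =>
                have h4 := two_mul_tri z
                zify at h4
                rw [Nat.add_sub_cancel, mul_comm (z + 1) z]
                push_cast
                linarith
            rw [Nat.cast_add, Nat.cast_add, Nat.cast_mul α (Int.toNat _), Int.toNat_of_nonneg hx,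
              Nat.cast_mul α x]
            linear_combination h4 y - h4 α)
        rw [mu_zero, one_mul] at h3
        exact h3
    calc _ = X ^ (y * (y - 1) / 2) * (X ^ (α * (α - y + x : ℤ).toNat) * pathSum (α - y) y s x) *
          (qPochInf ^ (s + 1) * mu (α - y) ^ s * iq α) := by ring
      _ = (-1) ^ (α + y) * X ^ (α * (α - 1) / 2 + α * x) * iq α *
          ((mu (α - y) * qPochInf) ^ (s + 1) * pathSum (α - y) y s x) := by rw [h2]; ring
      _ = _ := by
        rw [h1, ← ((small_kop_iterate (small_pathCoeff _ y) s).mul_left _).tsum_mul_left]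
        refine tsum_congr fun m => ?_
        rw [hw]
        simp only
        rw [show ((m + y : ℕ) : ℤ) - α = m - (α - y) by push_cast; ring]
        rcases lt_or_ge ((m : ℤ) - (α - y)) 0 with hm | hm
        · rw [iq_of_neg hm]; ring
        · have h3 : (X : ℤ⟦X⟧) ^ (α * x) * X ^ (x * ((m : ℤ) - (α - y)).toNat) =
              X ^ (x * (m + y)) := by
            rw [← pow_add, mul_comm α, ← mul_add]
            congr 2
            omega
          rw [pow_add, ← h3]
          ring
  have hds : XSmall fun p : ℕ × ℕ =>
      X ^ (x * (p.2 + y)) * (w p.2 p.1 * kop^[s] (pathCoeff (p.1 - y) y) p.2) := by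
    have hz : ∀ p : ℕ × ℕ, p.2 + y < p.1 →
        X ^ (x * (p.2 + y)) * (w p.2 p.1 * kop^[s] (pathCoeff (p.1 - y) y) p.2) = 0 := by
      intro p hp
      rw [hw]
      simp only
      rw [iq_of_neg (show ((p.2 + y : ℕ) : ℤ) - p.1 < 0 by omega)]
      ring
    -- The divisor must not depend on α: after at least one application of `kop` it is μ(m), and for
    -- s = 0 it is the factor μ(m - y) of the coefficient.
    cases s with
    | zero =>
      refine XSmall.of_triangle (small_mu (-y)) y (fun p => ?_) hz
      rw [neg_add_eq_sub]
      exact ((dvd_mul_right _ _).mul_left _).mul_left _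
    | succ s =>
      refine XSmall.of_triangle (small_mu 0) y (fun p => ?_) hz
      rw [zero_add, Function.iterate_succ_apply']
      exact ((dvd_mul_right _ _).mul_left _).mul_left _
  have hinner : ∀ m : ℕ, ∑' α : ℕ, X ^ (x * (m + y)) *
      (w m α * kop^[s] (pathCoeff (α - y) y) m) =
      X ^ (x * (m + y)) * ((if m = 0 then X ^ (y * (y - 1) / 2) else 0) *
        kop^[s] (fun m => mu m) m) := by
    intro m
    -- The evaluation of the combined coefficients holds only at n ≥ m; triangularity of `kop` makes
    -- this sufficient at m.
    rw [tsum_eq_sum (s := Finset.range (m + y + 1)) fun α hα => ?_, ← Finset.mul_sum,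
      ← kop_iterate_sum _ _ fun α : ℕ => small_pathCoeff _ _,
      kop_iterate_congr (fun n hn => sum_pathCoeff m n y hn) s m le_rfl,
      kop_iterate_const_mul _ (by simpa using small_mu 0)]
    rw [hw]
    simp only
    rw [iq_of_neg (show ((m + y : ℕ) : ℤ) - α < 0 by simp at hα; omega)]
    ring
  rw [← mul_assoc, ← (small_pathSum s x y).tsum_mul_left, tsum_congr hterm, XSmall.tsum_comm hds,
    tsum_congr hinner, tsum_eq_single 0 fun m hm => by rw [if_neg hm, zero_mul, mul_zero],
    if_pos rfl, zero_add]
  ring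

end PathSum

/-! ### The factor contributed by an attached polygon and its sum -/

section MultiSum

open PowerSeries

/-- The sequence `x, b_0, …, b_{s-1}, y`. -/
def pathFun {T : Type*} {s : ℕ} (x : T) (b : Fin s → T) (y : T) : Fin (s + 2) → T :=
  Fin.cons x (Fin.snoc (α := fun _ => T) b y)

section pathFun

variable {T : Type*} {s : ℕ} (x : T) (b : Fin s → T) (y : T)

theorem pathFun_zero : pathFun x b y 0 = x := rfl

theorem pathFun_last : pathFun x b y (Fin.last (s + 1)) = y := by
  rw [pathFun, ← Fin.succ_last, Fin.cons_succ, Fin.snoc_last]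

theorem pathFun_succ_castSucc (i : Fin s) : pathFun x b y i.castSucc.succ = b i := by
  rw [pathFun, Fin.cons_succ, Fin.snoc_castSucc]

theorem pathFun_succ (b : Fin (s + 1) → T) (i : Fin (s + 2)) :
    pathFun x b y i.succ = pathFun (b 0) (Fin.tail b) y i := by
  rw [pathFun, pathFun, Fin.cons_succ, Fin.cons_snoc_eq_snoc_cons, Fin.cons_self_tail]

theorem comp_pathFun {T' : Type*} (f : T → T') (i : Fin (s + 2)) :
    f (pathFun x b y i) = pathFun (f x) (f ∘ b) (f y) i := by
  refine Fin.cases ?_ (fun i => ?_) i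
  · rfl
  · refine Fin.lastCases ?_ (fun i => ?_) i
    · rw [Fin.succ_last, pathFun_last, pathFun_last]
    · rw [pathFun_succ_castSucc, pathFun_succ_castSucc]; rfl

end pathFun

/-- The exponent contributed by the vertices and edges of a path along a face of label `a`. -/
def pathExp (a : ℤ) (y : ℕ) : (s : ℕ) → ℕ → (Fin s → ℕ) → ℕ
  | 0, x, _ => x * y
  | s + 1, x, b => b 0 * (a + x + 1).toNat + pathExp a y s (b 0) (Fin.tail b)

/-- The summands of `pathSum`. -/
def pathTerm (a : ℤ) (y s x : ℕ) (b : Fin s → ℕ) : ℤ⟦X⟧ :=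
  X ^ pathExp a y s x b * (iq (a + x) * ∏ i, (iq (b i) * iq (a + b i)))

theorem pathTerm_cons (a : ℤ) (y s x b₀ : ℕ) (b : Fin s → ℕ) :
    pathTerm a y (s + 1) x (Fin.cons b₀ b) =
      iq (a + x) * (X ^ (b₀ * (a + x + 1).toNat) * iq b₀ * pathTerm a y s b₀ b) := by
  rw [pathTerm, pathTerm, pathExp, Fin.prod_univ_succ, Fin.tail_cons]
  simp only [Fin.cons_zero, Fin.cons_succ]
  ring

theorem sum_dvd_pathTerm (a : ℤ) (y s x : ℕ) (b : Fin s → ℕ) :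
    X ^ (∑ i, b i) ∣ pathTerm a y s x b := by
  induction s generalizing x with
  | zero => simp
  | succ s ih =>
    rw [← Fin.cons_self_tail b, pathTerm_cons, Fin.sum_univ_succ]
    simp only [Fin.cons_zero, Fin.cons_succ]
    rcases lt_or_ge (a + x) 0 with h | h
    · rw [iq_of_neg h, zero_mul]; exact dvd_zero _
    · rw [pow_add]
      refine (mul_dvd_mul (Dvd.dvd.mul_right (pow_dvd_pow _ ?_) _) (ih _ _)).mul_left _
      have : 1 ≤ (a + x + 1).toNat := by omega
      nlinarith

theorem finite_sum_lt (s N : ℕ) : {b : Fin s → ℕ | ∑ i, b i < N}.Finite := by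
  refine (Set.finite_Icc (0 : Fin s → ℕ) fun _ => N).subset fun b hb => ⟨fun i => Nat.zero_le _,
    fun i => ?_⟩
  have := Finset.single_le_sum (f := b) (fun i _ => Nat.zero_le _) (Finset.mem_univ i)
  exact this.trans (le_of_lt hb)

theorem small_pathTerm (a : ℤ) (y s x : ℕ) : XSmall (pathTerm a y s x) :=
  XSmall.of_exponent _ (finite_sum_lt s) (sum_dvd_pathTerm a y s x)

theorem tsum_pathTerm (a : ℤ) (y s x : ℕ) : ∑' b, pathTerm a y s x b = pathSum a y s x := by
  induction s generalizing x with
  | zero =>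
    rw [tsum_eq_single (fun i => i.elim0) fun b hb => absurd (Subsingleton.elim _ _) hb]
    simp [pathTerm, pathExp, pathSum]
  | succ s ih =>
    have hs : XSmall fun p : ℕ × (Fin s → ℕ) => pathTerm a y (s + 1) x (Fin.cons p.1 p.2) :=
      (small_pathTerm a y (s + 1) x).comp_injective (Fin.consEquiv fun _ => ℕ).injective
    rw [← (Fin.consEquiv fun _ => ℕ).tsum_eq]
    change ∑' p : ℕ × (Fin s → ℕ), pathTerm a y (s + 1) x (Fin.cons p.1 p.2) = _
    rw [hs.tsum_prod, pathSum]
    rcases lt_or_ge (a + x) 0 with h | h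
    · simp [pathTerm_cons, iq_of_neg h]
    obtain ⟨n, hn⟩ := Int.eq_ofNat_of_zero_le h
    have hn1 : (a + x + 1).toNat = n + 1 := by omega
    rw [← XSmall.tsum_mul_left]
    · refine tsum_congr fun b₀ => ?_
      simp only [pathTerm_cons]
      rw [(((small_pathTerm a y s b₀).mul_left _).tsum_mul_left),
        (small_pathTerm a y s b₀).tsum_mul_left, ih]
    · rw [hn1]
      exact (small_X_pow_mul n fun b => iq b * pathSum a y s b).of_dvd fun b =>
        dvd_of_eq (mul_assoc _ _ _).symm

theorem sum_pathFun_mul_succ {s : ℕ} (x y : ℤ) (b : Fin (s + 1) → ℤ) :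
    ∑ i : Fin (s + 2), pathFun x b y i.castSucc * pathFun x b y i.succ =
      x * b 0 + ∑ i : Fin (s + 1),
        pathFun (b 0) (Fin.tail b) y i.castSucc * pathFun (b 0) (Fin.tail b) y i.succ := by
  rw [Fin.sum_univ_succ]
  congr 1
  exact Finset.sum_congr rfl fun i _ => by rw [← Fin.succ_castSucc, pathFun_succ, pathFun_succ]

theorem pathExp_eq {a : ℤ} {y s x : ℕ} {b : Fin s → ℕ} (hx : 0 ≤ a + x) (hb : ∀ i, 0 ≤ a + b i) :
    (pathExp a y s x b : ℤ) = ∑ i : Fin (s + 1), pathFun (x : ℤ) (fun i => (b i : ℤ)) y i.castSucc *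
      pathFun (x : ℤ) (fun i => (b i : ℤ)) y i.succ + (a + 1) * ∑ i, (b i : ℤ) := by
  induction s generalizing x with
  | zero => simp [pathExp, pathFun, Fin.snoc]
  | succ s ih =>
    have h := ih (hb 0) fun i => hb i.succ
    rw [sum_pathFun_mul_succ, Fin.sum_univ_succ fun i => (b i : ℤ)]
    change ((b 0 * (a + x + 1).toNat + pathExp a y s (b 0) fun i => b i.succ : ℕ) : ℤ) = _
    rw [Nat.cast_add, h, Nat.cast_mul, Int.toNat_of_nonneg (by omega)]
    simp only [Fin.tail_def]
    ring

/-- The exponent by which a polygon with `s + 2` edges, attached along an edge whose ends have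
labels `x` and `y`, changes the exponent of a state; the new face has label `a`. -/
def extraExp (s : ℕ) (x y a : ℤ) (b : Fin s → ℤ) : ℤ :=
  s * (a * (a + 1) / 2) + a * a + a * (x + y) +
    ∑ i : Fin (s + 1), pathFun x b y i.castSucc * pathFun x b y i.succ + (a + 1) * ∑ i, b i

/-- The factor by which attaching a polygon changes the summand of a state. -/
def extraTerm (s : ℕ) (x y a : ℤ) (b : Fin s → ℤ) : ℤ⟦X⟧ :=
  (-1) ^ (s * a.natAbs) * X ^ (extraExp s x y a b).toNat *
    (iq (a + x) * iq (a + y) * ∏ i, (iq (b i) * iq (a + b i)))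

theorem sum_pathFun_mul_castSucc_succ_nonneg {s : ℕ} {x y : ℤ} {b : Fin s → ℤ} (hx : 0 ≤ x) (hy : 0 ≤ y)
    (hb : ∀ i, 0 ≤ b i) :
    0 ≤ ∑ i : Fin (s + 1), pathFun x b y i.castSucc * pathFun x b y i.succ := by
  have h : ∀ i, 0 ≤ pathFun x b y i := by
    intro i
    refine Fin.cases hx (fun i => ?_) i
    refine Fin.lastCases ?_ (fun i => ?_) i
    · rw [Fin.succ_last, pathFun_last]; exact hy
    · rw [pathFun_succ_castSucc]; exact hb i
  exact Finset.sum_nonneg fun i _ => mul_nonneg (h _) (h _)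

/-- Only the two end edges of the path are kept. They are distinct because there is an interior
vertex. -/
theorem sum_pathFun_mul_castSucc_succ_ge {s : ℕ} {x y n : ℤ} {b : Fin (s + 1) → ℤ} (hx : 0 ≤ x) (hy : 0 ≤ y)
    (hn : 0 ≤ n) (hb : ∀ i, n ≤ b i) :
    n * (x + y) ≤ ∑ i : Fin (s + 2), pathFun x b y i.castSucc * pathFun x b y i.succ := by
  rw [Fin.sum_univ_succ, Fin.sum_univ_castSucc]
  have h1 : pathFun x b y (Fin.castSucc 0) * pathFun x b y (Fin.succ 0) = x * b 0 := rfl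
  have h2 : pathFun x b y (Fin.last s).succ.castSucc * pathFun x b y (Fin.last s).succ.succ =
      b (Fin.last s) * y := by
    rw [← Fin.succ_castSucc, pathFun_succ_castSucc, Fin.succ_last, Fin.succ_last, pathFun_last]
  have h3 : 0 ≤ ∑ i : Fin s, pathFun x b y i.castSucc.succ.castSucc *
      pathFun x b y i.castSucc.succ.succ := by
    refine Finset.sum_nonneg fun i _ => ?_
    rw [← Fin.succ_castSucc, pathFun_succ_castSucc, Fin.succ_castSucc, pathFun_succ_castSucc]
    exact mul_nonneg (hn.trans (hb _)) (hn.trans (hb _))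
  rw [h1, h2]
  nlinarith [hb 0, hb (Fin.last s)]

theorem sum_add_castSucc_succ {s : ℕ} (x y a : ℤ) (b : Fin s → ℤ) :
    ∑ i : Fin (s + 1), (a + pathFun x b y i.castSucc) * (a + pathFun x b y i.succ) =
      (s + 1) * a ^ 2 + a * (x + y) + 2 * a * ∑ i, b i +
        ∑ i : Fin (s + 1), pathFun x b y i.castSucc * pathFun x b y i.succ := by
  have h1 : ∑ i : Fin (s + 1), pathFun x b y i.castSucc = x + ∑ i, b i := by
    rw [Fin.sum_univ_succ]
    congr 1
    exact Finset.sum_congr rfl fun i _ => by rw [← Fin.succ_castSucc, pathFun_succ_castSucc]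
  have h2 : ∑ i : Fin (s + 1), pathFun x b y i.succ = ∑ i, b i + y := by
    rw [Fin.sum_univ_castSucc, Fin.succ_last, pathFun_last]
    congr 1
    exact Finset.sum_congr rfl fun i _ => pathFun_succ_castSucc _ _ _ _
  have h3 : ∀ i : Fin (s + 1), (a + pathFun x b y i.castSucc) * (a + pathFun x b y i.succ) =
      a ^ 2 + a * pathFun x b y i.castSucc + a * pathFun x b y i.succ +
        pathFun x b y i.castSucc * pathFun x b y i.succ := fun i => by ring
  rw [Finset.sum_congr rfl fun i _ => h3 i, Finset.sum_add_distrib, Finset.sum_add_distrib,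
    Finset.sum_add_distrib, ← Finset.mul_sum, ← Finset.mul_sum, h1, h2, Finset.sum_const,
    Finset.card_univ, Fintype.card_fin, nsmul_eq_mul]
  push_cast
  ring

theorem two_mul_extraExp (s : ℕ) (x y a : ℤ) (b : Fin s → ℤ) :
    2 * extraExp s x y a b =
      ∑ i : Fin (s + 1), pathFun x b y i.castSucc * pathFun x b y i.succ +
      ∑ i : Fin (s + 1), (a + pathFun x b y i.castSucc) * (a + pathFun x b y i.succ) +
      ((a + x) * (a + y) - x * y) + 2 * ∑ i, b i + s * a := by
  rw [sum_add_castSucc_succ, extraExp]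
  linear_combination s * two_mul_half a

/-- The only terms that can be negative are a(x + y) and s a, for a < 0. Then b_i ≥ -a, so the end
edges of the path absorb the first and one copy of the sum of the b_i absorbs the second. The bound
is free of x and y. -/
theorem le_two_mul_extraExp {s : ℕ} (hs : 1 ≤ s) {x y a : ℤ} {b : Fin s → ℤ} (hx : 0 ≤ x)
    (hy : 0 ≤ y) (hax : 0 ≤ a + x) (hay : 0 ≤ a + y) (hb : ∀ i, 0 ≤ b i) (hab : ∀ i, 0 ≤ a + b i) :
    a ^ 2 + ∑ i, b i ≤ 2 * extraExp s x y a b := by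
  obtain ⟨s, rfl⟩ : ∃ t, s = t + 1 := ⟨s - 1, by omega⟩
  rw [two_mul_extraExp]
  have h1 : 0 ≤ ∑ i, (a + b i) := Finset.sum_nonneg fun i _ => hab i
  rw [Finset.sum_add_distrib, Finset.sum_const, Finset.card_univ, Fintype.card_fin,
    nsmul_eq_mul] at h1
  have h2 : 0 ≤ ∑ i : Fin (s + 2), (a + pathFun x b y i.castSucc) * (a + pathFun x b y i.succ) := by
    have := sum_pathFun_mul_castSucc_succ_nonneg hax hay hab
    simp only [comp_pathFun x b y (fun z => a + z)]
    exact this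
  rcases le_or_gt 0 a with ha | ha
  · have h3 := sum_pathFun_mul_castSucc_succ_nonneg hx hy hb
    nlinarith
  · have h3 := sum_pathFun_mul_castSucc_succ_ge (n := -a) hx hy (by omega)
      (show ∀ i, -a ≤ b i from fun i => by linarith [hab i])
    nlinarith

theorem extraTerm_eq_zero {s : ℕ} {x y a : ℤ} {b : Fin s → ℤ}
    (h : ¬ (0 ≤ a + x ∧ 0 ≤ a + y ∧ (∀ i, 0 ≤ b i) ∧ ∀ i, 0 ≤ a + b i)) :
    extraTerm s x y a b = 0 := by
  rw [extraTerm]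
  by_cases h1 : a + x < 0
  · simp [iq_of_neg h1]
  by_cases h2 : a + y < 0
  · simp [iq_of_neg h2]
  by_cases h3 : ∃ i, b i < 0 ∨ a + b i < 0
  · obtain ⟨i, hi⟩ := h3
    rw [Finset.prod_eq_zero (Finset.mem_univ i), mul_zero, mul_zero]
    rcases hi with hi | hi <;> simp [iq_of_neg hi]
  · push Not at h1 h2 h3
    exact absurd ⟨h1, h2, fun i => (h3 i).1, fun i => (h3 i).2⟩ h

theorem X_pow_dvd_extraTerm (s : ℕ) (x y a : ℤ) (b : Fin s → ℤ) :
    X ^ (extraExp s x y a b).toNat ∣ extraTerm s x y a b :=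
  (dvd_mul_left _ _).mul_right _

/-- For each bound, the polygon labels that give exponents below the bound lie in a finite set that
does not depend on the labels `x` and `y`. -/
theorem exists_finite_extraExp {s : ℕ} (hs : 1 ≤ s) (N : ℕ) :
    ∃ S : Set (ℤ × (Fin s → ℤ)), S.Finite ∧ ∀ (x y a : ℤ) (b : Fin s → ℤ), 0 ≤ x → 0 ≤ y →
      extraTerm s x y a b ≠ 0 → 0 ≤ extraExp s x y a b ∧
        (extraExp s x y a b < N → (a, b) ∈ S) := by
  refine ⟨Set.Icc (-(2 * N : ℤ)) (2 * N) ×ˢ Set.Icc (fun _ : Fin s => (0 : ℤ)) (fun _ => 2 * N),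
    (Set.finite_Icc _ _).prod (Set.finite_Icc _ _), ?_⟩
  intro x y a b hx hy hne
  have h := not_imp_comm.mp extraTerm_eq_zero hne
  have h1 := le_two_mul_extraExp hs hx hy h.1 h.2.1 h.2.2.1 h.2.2.2
  have h2 : 0 ≤ ∑ i, b i := Finset.sum_nonneg fun i _ => h.2.2.1 i
  refine ⟨by nlinarith, fun hN => ?_⟩
  simp only [Set.mem_prod, Set.mem_Icc, Pi.le_def]
  have h3 : a ^ 2 < 2 * N := by linarith
  refine ⟨⟨by nlinarith, by nlinarith⟩, fun i => h.2.2.1 i, fun i => ?_⟩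
  have := Finset.single_le_sum (f := b) (fun i _ => h.2.2.1 i) (Finset.mem_univ i)
  nlinarith

theorem small_extraTerm {s : ℕ} (hs : 1 ≤ s) (x y : ℕ) :
    XSmall fun p : ℤ × (Fin s → ℤ) => extraTerm s x y p.1 p.2 := fun N => by
  obtain ⟨S, hS, h⟩ := exists_finite_extraExp hs N
  refine hS.subset fun p hp => ?_
  by_cases hz : extraTerm s x y p.1 p.2 = 0
  · exact absurd (show X ^ N ∣ extraTerm s x y p.1 p.2 by rw [hz]; exact dvd_zero _) hp
  · have h1 := h x y p.1 p.2 (by positivity) (by positivity) hz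
    refine h1.2 ?_
    by_contra hlt
    exact hp ((pow_dvd_pow X (by omega)).trans (X_pow_dvd_extraTerm _ _ _ _ _))

/-- With a = α - y, the factor q^(xy) completes a² + a(x + y) to (a + x)(a + y) = α (a + x). -/
theorem X_pow_mul_extraTerm {s : ℕ} (hs : 1 ≤ s) (x y α : ℕ) (b : Fin s → ℕ) :
    X ^ (x * y) * extraTerm s x y (α - y) (fun i => (b i : ℤ)) =
      mu (α - y) ^ s * X ^ (α * (α - y + x : ℤ).toNat) * iq α * pathTerm (α - y) y s x b := by
  by_cases h : (0 : ℤ) ≤ α - y + x ∧ ∀ i, (0 : ℤ) ≤ α - y + b i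
  · have h1 := le_two_mul_extraExp hs (x := x) (y := y) (a := α - y) (b := fun i => (b i : ℤ))
      (by positivity) (by positivity) h.1 (by omega) (fun i => by positivity) h.2
    have h2 := pathExp_eq (y := y) h.1 h.2
    have h3 : 0 ≤ ∑ i, (b i : ℤ) := Finset.sum_nonneg fun i _ => by positivity
    have h4 : x * y + (extraExp s x y (α - y) (fun i => (b i : ℤ))).toNat =
        s * (((α : ℤ) - y) * (α - y + 1) / 2).toNat + α * (α - y + x : ℤ).toNat +
          pathExp (α - y) y s x b := by
      zify
      rw [Int.toNat_of_nonneg (by nlinarith), Int.toNat_of_nonneg (half_nonneg _),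
        Int.toNat_of_nonneg h.1, h2, extraExp]
      ring
    have h5 : X ^ (x * y) * (X : ℤ⟦X⟧) ^ (extraExp s x y (α - y) (fun i => (b i : ℤ))).toNat =
        X ^ (s * (((α : ℤ) - y) * (α - y + 1) / 2).toNat) * X ^ (α * (α - y + x : ℤ).toNat) *
          X ^ pathExp (α - y) y s x b := by
      rw [← pow_add, h4, pow_add, pow_add]
    rw [extraTerm, pathTerm, mu, sub_add_cancel, mul_pow, ← pow_mul, ← pow_mul, mul_comm _ s,
      mul_comm _ s]
    linear_combination ((-1) ^ (s * ((α : ℤ) - y).natAbs) * (iq (α - y + x) * iq α *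
      ∏ i, (iq (b i) * iq (α - y + b i)))) * h5
  · rw [extraTerm_eq_zero fun h' => h ⟨h'.1, h'.2.2.2⟩, pathTerm, mul_zero]
    by_cases hx : (0 : ℤ) ≤ α - y + x
    · obtain ⟨i, hi⟩ : ∃ i, (α : ℤ) - y + b i < 0 := by
        by_contra h'
        push Not at h'
        exact h ⟨hx, h'⟩
      rw [Finset.prod_eq_zero (Finset.mem_univ i)]
      · ring
      · rw [iq_of_neg hi, mul_zero]
    · rw [iq_of_neg (not_le.mp hx)]
      ring

theorem tsum_extraTerm {s : ℕ} (hs : 1 ≤ s) (x y : ℕ) :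
    qPochInf ^ (s + 1) * ∑' p : ℤ × (Fin s → ℤ), extraTerm s x y p.1 p.2 = thetaSeries (s + 2) := by
  refine mul_left_cancel₀ (pow_ne_zero (x * y) X_ne_zero) ?_
  -- The corner factors 1 / (q)_{a+y} and 1 / (q)_{b_i} vanish at negative indices, so natural
  -- parameters α = a + y and b_i exhaust the support.
  set j : ℕ × (Fin s → ℕ) → ℤ × (Fin s → ℤ) := fun p => (p.1 - y, fun i => (p.2 i : ℤ)) with hj
  have hinj : Function.Injective j := by
    rintro ⟨α, b⟩ ⟨β, c⟩ h
    simp only [hj, Prod.mk.injEq, sub_left_inj, Nat.cast_inj, funext_iff] at h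
    exact Prod.ext h.1 (funext h.2)
  have hsupp : Function.support (fun p : ℤ × (Fin s → ℤ) => extraTerm s x y p.1 p.2) ⊆
      Set.range j := by
    rintro ⟨a, b⟩ hp
    have h := not_imp_comm.mp extraTerm_eq_zero hp
    refine ⟨((a + y).toNat, fun i => (b i).toNat), ?_⟩
    rw [hj, Prod.mk.injEq]
    exact ⟨by simp only; omega, funext fun i => Int.toNat_of_nonneg (h.2.2.1 i)⟩
  have hsm := (small_extraTerm hs x y).comp_injective hinj
  rw [thetaSeries_eq, ← kop_iterate_mu, ← tsum_pathSum, ← hinj.tsum_eq hsupp, mul_left_comm,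
    ← hsm.tsum_mul_left, (hsm.mul_left fun _ => X ^ (x * y)).tsum_prod]
  congr 1
  refine tsum_congr fun α => ?_
  rw [← tsum_pathTerm, ← (small_pathTerm _ _ _ _).tsum_mul_left]
  exact tsum_congr fun b => X_pow_mul_extraTerm hs x y α b

end MultiSum

/-! ### Tree–cotree decomposition of a plane map -/

section SpanningTrees

/-- `ReachIn src tgt o n p`: the point `p` is joined to `o` by `n` steps from the source to the
target of an element of `E`. -/
def ReachIn {E P : Type*} (src tgt : E → P) (o : P) : ℕ → P → Prop
  | 0, p => p = o
  | n + 1, p => ∃ x, src x = p ∧ ReachIn src tgt o n (tgt x)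

/-- Breadth-first search: the rank is the distance to o, and the parent edge is the first step of a
shortest path. -/
theorem exists_parent {E P : Type*} (src tgt : E → P) (o : P)
    (h : ∀ p, ∃ n, ReachIn src tgt o n p) :
    ∃ (rank : P → ℕ) (t : {p // p ≠ o} → E),
      ∀ p, src (t p) = p ∧ rank (tgt (t p)) < rank p := by
  classical
  have h1 : ∀ p : {p // p ≠ o}, ∃ x, src x = p ∧ Nat.find (h (tgt x)) < Nat.find (h p) := by
    intro p
    have h2 := Nat.find_spec (h p)
    rcases hn : Nat.find (h p) with _ | n
    · rw [hn] at h2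
      exact absurd h2 p.2
    · rw [hn] at h2
      obtain ⟨x, hx, hr⟩ := h2
      exact ⟨x, hx, (Nat.find_min' _ hr).trans_lt (Nat.lt_succ_self n)⟩
  choose t ht using h1
  exact ⟨fun p => Nat.find (h p), t, ht⟩

theorem sum_eq_sum_subtype_ne {ι R : Type*} [Fintype ι] [AddCommMonoid R] (o : ι)
    [Fintype {i // i ≠ o}] (f : ι → R) (h : f o = 0) : ∑ i, f i = ∑ i : {i // i ≠ o}, f i := by
  classical
  rw [← Fintype.sum_subtype_add_sum_subtype (fun i => i ≠ o) f,
    Finset.sum_eq_zero (s := (Finset.univ : Finset {i // ¬ i ≠ o})) fun i _ => ?_, add_zero]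
  · exact Finset.sum_congr (by ext; simp) fun _ _ => rfl
  · rw [not_not.mp i.2, h]

end SpanningTrees

namespace DartMap

variable {D : Type*} (G : DartMap D)

theorem face_next (x : D) : G.face (G.next x) = G.face x :=
  Quotient.sound (Equiv.Perm.sameCycle_apply_left.mpr (Equiv.Perm.SameCycle.refl _ _))

theorem rot_next (x : D) : G.rot (G.next x) = G.flip x := by simp [rot]

theorem vert_next (x : D) : G.vert (G.next x) = G.vert (G.flip x) := by
  rw [← rot_next]
  exact Quotient.sound (Equiv.Perm.sameCycle_apply_right.mpr (Equiv.Perm.SameCycle.refl _ _))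

variable {G} in
theorem Connected.iff_of_invariant (h : G.Connected) {P : D → Prop}
    (hn : ∀ x, P (G.next x) ↔ P x) (hf : ∀ x, P (G.flip x) ↔ P x) (x y : D) : P x ↔ P y := by
  obtain ⟨g, hg, rfl⟩ := h x y
  clear h
  induction hg using Subgroup.closure_induction generalizing x with
  | mem g hg =>
    rcases hg with rfl | rfl
    · exact (hn x).symm
    · exact (hf x).symm
  | one => rfl
  | mul g₁ g₂ _ _ h₁ h₂ => exact (h₂ x).trans (h₁ _)
  | inv g _ h => simpa using (h (g⁻¹ x)).symm

theorem even_card [Fintype D] (G : DartMap D) : Even (Fintype.card D) := by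
  rw [← ZMod.natCast_eq_zero_iff_even]
  have h := Finset.sum_ninvolution (s := Finset.univ) (f := fun _ : D => (1 : ZMod 2)) G.flip
    (fun _ => by decide) (fun x _ => G.flip_ne x) (fun _ => Finset.mem_univ _) G.flip_flip
  simpa using h

/-- A spanning tree of the dual graph and a complementary spanning tree, rooted at `o` and `v₀`:
each face other than `o` and each vertex other than `v₀` is assigned an edge to its parent. -/
theorem exists_tree_cotree [Fintype D] (hc : G.Connected) (hg : G.GenusZero) (o : G.Face)
    (v₀ : G.Vertex) :
    ∃ (rank : G.Face → ℕ) (t : {p // p ≠ o} → D) (u : {v // v ≠ v₀} → D),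
      (∀ p, G.face (t p) = p ∧ rank (G.face (G.flip (t p))) < rank p) ∧
      (∀ v, G.vert (u v) = v) ∧
      Function.Bijective (fun i : ({p // p ≠ o} ⊕ {v // v ≠ v₀}) × Bool =>
        if i.2 then G.flip (Sum.elim t u i.1) else Sum.elim t u i.1) := by
  classical
  obtain ⟨x₀, hx₀⟩ : ∃ x, G.face x = o := Quotient.exists_rep o
  obtain ⟨y₀, hy₀⟩ : ∃ x, G.vert x = v₀ := Quotient.exists_rep v₀
  have hreach : ∀ p, ∃ n, ReachIn G.face (fun x => G.face (G.flip x)) o n p := by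
    intro p
    obtain ⟨x, rfl⟩ : ∃ x, G.face x = p := Quotient.exists_rep p
    refine (hc.iff_of_invariant (P := fun x => ∃ n, ReachIn G.face (fun x => G.face (G.flip x)) o n
      (G.face x)) (fun x => by rw [face_next]) (fun x => ?_) x₀ x).mp ⟨0, hx₀⟩
    constructor
    · rintro ⟨n, hn⟩; exact ⟨n + 1, x, rfl, hn⟩
    · rintro ⟨n, hn⟩; exact ⟨n + 1, G.flip x, rfl, by simpa [G.flip_flip] using hn⟩
  obtain ⟨rank, t, ht⟩ := exists_parent _ _ o hreach
  -- darts that do not belong to edges of the dual tree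
  let E := {x : D // ∀ p, x ≠ t p ∧ x ≠ G.flip (t p)}
  have hflipE : ∀ x : D, (∀ p, x ≠ t p ∧ x ≠ G.flip (t p)) →
      ∀ p, G.flip x ≠ t p ∧ G.flip x ≠ G.flip (t p) := by
    intro x hx p
    refine ⟨fun h => (hx p).2 (by rw [← h, G.flip_flip]), fun h => (hx p).1 (G.flip.injective h)⟩
  -- The edges outside the dual tree connect all vertices. The coboundary dg of the indicator of the
  -- reachable set vanishes on these edges and sums to 0 around each face; these facts force it to
  -- vanish on the dual tree too.
  have hreach' : ∀ v, ∃ n, ReachIn (fun x : E => G.vert x.1) (fun x => G.vert (G.flip x.1)) v₀ n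
      v := by
    set Q : G.Vertex → Prop := fun v =>
      ∃ n, ReachIn (fun x : E => G.vert x.1) (fun x => G.vert (G.flip x.1)) v₀ n v with hQ
    have hQE : ∀ x : D, (∀ p, x ≠ t p ∧ x ≠ G.flip (t p)) →
        (Q (G.vert (G.flip x)) ↔ Q (G.vert x)) := by
      intro x hx
      constructor
      · rintro ⟨n, hn⟩; exact ⟨n + 1, ⟨x, hx⟩, rfl, hn⟩
      · rintro ⟨n, hn⟩
        exact ⟨n + 1, ⟨G.flip x, hflipE x hx⟩, rfl, by simpa [G.flip_flip] using hn⟩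
    let g : G.Vertex → ℤ := fun v => if Q v then 1 else 0
    let dg : D → ℤ := fun x => g (G.vert (G.flip x)) - g (G.vert x)
    have hdg_flip : ∀ x, dg (G.flip x) = - dg x := fun x => by simp [dg, G.flip_flip]
    have hdgE : ∀ x : D, (∀ p, x ≠ t p ∧ x ≠ G.flip (t p)) → dg x = 0 := by
      intro x hx
      simp [dg, g, hQE x hx]
    have hsum : ∀ p, ∑ x with G.face x = p, dg x = 0 := by
      intro p
      simp only [dg]
      rw [Finset.sum_sub_distrib, sub_eq_zero]
      simp only [← vert_next]
      exact Finset.sum_equiv G.next (fun x => by simp [face_next]) fun x _ => rfl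
    -- Induction from the leaves of the dual tree towards its root: apart from t p, every tree dart
    -- on the face p is the flip of t q for a child q, which has larger rank.
    have hdgt : ∀ (k : ℕ) (p : {p // p ≠ o}), (∑ q, rank q) - rank p ≤ k → dg (t p) = 0 := by
      intro k
      induction k using Nat.strong_induction_on with
      | _ k ih =>
        intro p hp
        rw [← hsum p, Finset.sum_eq_single (t p)]
        · intro x hx hne
          by_cases hxE : ∀ p, x ≠ t p ∧ x ≠ G.flip (t p)
          · exact hdgE x hxE
          · have hfx : G.face x = p := by simpa using hx
            push Not at hxE
            obtain ⟨q, hq⟩ := hxE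
            by_cases hxq : x = t q
            · exfalso
              have : q = p := Subtype.ext (by rw [← (ht q).1, ← hxq, hfx])
              exact hne (by rw [hxq, this])
            · have hxq := hq hxq
              rw [hxq, hdg_flip, neg_eq_zero]
              have h1 := (ht q).2
              rw [← hxq, hfx] at h1
              have h2 : rank q ≤ ∑ q, rank q :=
                Finset.single_le_sum (f := rank) (fun _ _ => Nat.zero_le _) (Finset.mem_univ _)
              exact ih _ (by omega) q le_rfl
        · intro h
          exact absurd (by simpa using (ht p).1) h
    have hdg : ∀ x, dg x = 0 := by
      intro x
      by_cases hxE : ∀ p, x ≠ t p ∧ x ≠ G.flip (t p)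
      · exact hdgE x hxE
      · push Not at hxE
        obtain ⟨q, hq⟩ := hxE
        by_cases hxq : x = t q
        · rw [hxq]; exact hdgt _ q le_rfl
        · rw [hq hxq, hdg_flip, hdgt _ q le_rfl, neg_zero]
    have hQflip : ∀ x, Q (G.vert (G.flip x)) ↔ Q (G.vert x) := by
      intro x
      have := hdg x
      simp only [dg, g] at this
      split_ifs at this <;> simp_all
    intro v
    obtain ⟨x, rfl⟩ : ∃ x, G.vert x = v := Quotient.exists_rep v
    exact (hc.iff_of_invariant (P := fun x => Q (G.vert x)) (fun x => by rw [vert_next, hQflip])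
      hQflip y₀ x).mp ⟨0, hy₀⟩
  obtain ⟨rank', u, hu⟩ := exists_parent _ _ v₀ hreach'
  refine ⟨rank, t, fun v => (u v).1, ht, fun v => (hu v).1, ?_⟩
  rw [Fintype.bijective_iff_injective_and_card]
  constructor
  · have htt : ∀ p q, t p ≠ G.flip (t q) := by
      intro p q h
      have h1 := (ht p).2
      have h2 := (ht q).2
      rw [← h, (ht p).1] at h2
      rw [h, G.flip_flip, (ht q).1] at h1
      omega
    have huu : ∀ p q, (u p).1 ≠ G.flip (u q).1 := by
      intro p q h
      have h1 := (hu p).2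
      have h2 := (hu q).2
      rw [← h, (hu p).1] at h2
      rw [h, G.flip_flip, (hu q).1] at h1
      omega
    have htinj : Function.Injective t := fun p q h =>
      Subtype.ext (by rw [← (ht p).1, ← (ht q).1, h])
    have huinj : ∀ p q, (u p).1 = (u q).1 → p = q := fun p q h =>
      Subtype.ext (by rw [← (hu p).1, ← (hu q).1, h])
    have hut : ∀ p q, (u p).1 ≠ t q ∧ (u p).1 ≠ G.flip (t q) := fun p q => (u p).2 q
    have hfut : ∀ p q, G.flip (u p).1 ≠ t q ∧ G.flip (u p).1 ≠ G.flip (t q) :=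
      fun p q => hflipE _ (u p).2 q
    rintro ⟨p | p, _ | _⟩ ⟨q | q, _ | _⟩ h <;>
      simp only [Sum.elim_inl, Sum.elim_inr, if_true, Bool.false_eq_true, if_false] at h
    · rw [htinj h]
    · exact absurd h (htt p q)
    · exact absurd h.symm (hut q p).1
    · exact absurd h.symm (hfut q p).1
    · exact absurd h.symm (htt q p)
    · rw [htinj (G.flip.injective h)]
    · exact absurd h.symm (hut q p).2
    · exact absurd h.symm (hfut q p).2
    · exact absurd h (hut p q).1
    · exact absurd h (hut p q).2
    · rw [huinj _ _ h]
    · exact absurd h (huu p q)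
    · exact absurd h (hfut p q).1
    · exact absurd h (hfut p q).2
    · exact absurd h.symm (huu q p)
    · rw [huinj _ _ (G.flip.injective h)]
  · have h1 := hg
    unfold GenusZero numEdges at h1
    obtain ⟨k, hk⟩ := G.even_card
    have h2 : 0 < Fintype.card G.Face := Fintype.card_pos_iff.mpr ⟨o⟩
    have h3 : 0 < Fintype.card G.Vertex := Fintype.card_pos_iff.mpr ⟨v₀⟩
    rw [Fintype.card_prod, Fintype.card_sum, Fintype.card_subtype_compl, Fintype.card_subtype_compl,
      Fintype.card_subtype_eq, Fintype.card_subtype_eq, Fintype.card_bool]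
    omega

end DartMap

/-! ### Summands in terms of darts, and convergence for `G` -/

section StateTerm

open PowerSeries

variable {D F V : Type*} [Fintype D] [Fintype F] [Fintype V]

/-- The form `A + B` of a map whose darts have faces `fl` and source vertices `vl`. -/
def stateExp (flip : D → D) (fl : D → F) (vl : D → V) (a : F → ℤ) (b : V → ℤ) : ℤ :=
  ∑ x, ((a (fl x) + b (vl x)) * (a (fl x) + b (vl (flip x))) + a (fl x)) +
    2 * ∑ v, b v - 2 * ∑ p, a p

/-- The summand of a state; it is `0` if the state is not admissible. -/
def stateTerm (flip : D → D) (fl : D → F) (vl : D → V) (a : F → ℤ) (b : V → ℤ) : ℤ⟦X⟧ :=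
  (-1) ^ (∑ x, a (fl x)).natAbs * X ^ (stateExp flip fl vl a b / 2).toNat *
    ∏ x, iq (a (fl x) + b (vl x))

theorem nonneg_of_stateTerm_ne_zero {flip : D → D} {fl : D → F} {vl : D → V} {a : F → ℤ}
    {b : V → ℤ} (h : stateTerm flip fl vl a b ≠ 0) (x : D) : 0 ≤ a (fl x) + b (vl x) := by
  by_contra hx
  refine h ?_
  rw [stateTerm, Finset.prod_eq_zero (Finset.mem_univ x) (iq_of_neg (not_le.mp hx)), mul_zero]

/-- Integer labels of faces and vertices that vanish at `o` and at `v`. -/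
abbrev RootedLabels {F V : Type*} (o : F) (v : V) : Type _ :=
  {p : (F → ℤ) × (V → ℤ) // p.1 o = 0 ∧ p.2 v = 0}

end StateTerm

namespace DartMap

open PowerSeries

/-- The states of a map as labels of sets `F` and `V` that represent its faces and vertices. -/
def stateLabels {D F V : Type*} (G : DartMap D) (eF : G.Face ≃ F) (eV : G.Vertex ≃ V) (o : G.Face) (v : G.Vertex)
    (s : G.State o v) : RootedLabels (eF o) (eV v) :=
  ⟨(s.1.1 ∘ eF.symm, s.1.2 ∘ eV.symm), by simpa using s.2.1, by simpa using s.2.2.1⟩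

theorem stateLabels_injective {D F V : Type*} (G : DartMap D) (eF : G.Face ≃ F) (eV : G.Vertex ≃ V)
    (o : G.Face) (v : G.Vertex) : Function.Injective (G.stateLabels eF eV o v) := by
  rintro ⟨⟨a, b⟩, h⟩ ⟨⟨a', b'⟩, h'⟩ heq
  simp only [stateLabels, Subtype.mk.injEq, Prod.mk.injEq] at heq
  have h1 := eF.symm.surjective.injective_comp_right heq.1
  have h2 := eV.symm.surjective.injective_comp_right heq.2
  subst h1 h2
  rfl

variable {D : Type*} [Fintype D] (G : DartMap D)

/-- The target of x is the source of `next x`, on the same face; so A becomes a sum over darts of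
products of two consecutive corner values. -/
theorem sum_face_mul_vert_flip (a : G.Face → ℤ) (b : G.Vertex → ℤ) :
    ∑ x, a (G.face x) * b (G.vert (G.flip x)) = ∑ x, a (G.face x) * b (G.vert x) := by
  simp only [← vert_next]
  rw [← Equiv.sum_comp G.next fun x => a (G.face x) * b (G.vert x)]
  exact Finset.sum_congr rfl fun x _ => by rw [face_next]

theorem formA_eq {o : G.Face} {a : G.Face → ℤ} (b : G.Vertex → ℤ) (ha : a o = 0) :
    G.formA o a b =
      ∑ x, (a (G.face x) + b (G.vert x)) * (a (G.face x) + b (G.vert (G.flip x))) := by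
  let _ := Classical.decEq G.Face
  have h1 : ∑ p : G.Face with p ≠ o, G.gam a b p = ∑ p, G.gam a b p := by
    refine Finset.sum_filter_of_ne fun p _ hp hpo => hp ?_
    rw [gam, hpo, ha]
    ring
  have h2 : ∀ p, G.gam a b p =
      ∑ x with G.face x = p, (a (G.face x) ^ 2 + 2 * (a (G.face x) * b (G.vert x))) := by
    intro p
    rw [Finset.sum_congr rfl fun x hx => by rw [(Finset.mem_filter.mp hx).2], Finset.sum_add_distrib,
      gam, len, Finset.sum_const, nsmul_eq_mul, Finset.mul_sum]
    refine congrArg₂ _ (by congr!) (Finset.sum_congr (by congr!) fun x _ => by ring)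
  have h3 : ∀ x, (a (G.face x) + b (G.vert x)) * (a (G.face x) + b (G.vert (G.flip x))) =
      a (G.face x) ^ 2 + a (G.face x) * b (G.vert x) + a (G.face x) * b (G.vert (G.flip x)) +
        b (G.vert x) * b (G.vert (G.flip x)) := fun x => by ring
  rw [formA]
  simp only [h3, Finset.sum_add_distrib, sum_face_mul_vert_flip]
  refine congrArg₂ _ (Eq.trans (by congr!) (h1.trans ?_)) rfl
  simp only [h2]
  rw [Finset.sum_fiberwise]
  simp only [Finset.sum_add_distrib, ← Finset.mul_sum]
  ring

theorem formB_eq {o : G.Face} {a : G.Face → ℤ} (b : G.Vertex → ℤ) (ha : a o = 0) :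
    G.formB o a b = ∑ x, a (G.face x) + 2 * ∑ v, b v - 2 * ∑ p, a p := by
  let _ := Classical.decEq G.Face
  have h1 : ∑ p : G.Face with p ≠ o, ((G.len p : ℤ) - 2) * a p =
      ∑ p, ((G.len p : ℤ) - 2) * a p :=
    Finset.sum_filter_of_ne fun p _ hp hpo => hp (by rw [hpo, ha, mul_zero])
  have h2 : ∀ p, ((G.len p : ℤ) - 2) * a p = ∑ x with G.face x = p, a (G.face x) - 2 * a p := by
    intro p
    rw [Finset.sum_congr rfl fun x hx => by rw [(Finset.mem_filter.mp hx).2], len, Finset.sum_const,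
      nsmul_eq_mul, sub_mul]
  rw [formB]
  refine (congrArg₂ _ rfl (Eq.trans (by congr!) h1)).trans ?_
  simp only [h2]
  rw [Finset.sum_sub_distrib, Finset.sum_fiberwise, ← Finset.mul_sum]
  ring

theorem phiTerm_eq {o : G.Face} {v : G.Vertex} (s : G.State o v) :
    G.phiTerm o v s = stateTerm G.flip G.face G.vert s.1.1 s.1.2 := by
  obtain ⟨⟨a, b⟩, ha, hb, hab⟩ := s
  simp only at ha hb hab
  unfold phiTerm stateTerm
  congr 1
  · congr 1
    · refine neg_one_pow_eq_of_even ?_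
      have h1 := even_natAbs_sub (G.formB o a b)
      have h2 := even_natAbs_sub (∑ x, a (G.face x))
      have h3 : ((G.formB o a b).natAbs : ℤ) - (∑ x, a (G.face x)).natAbs =
          ((G.formB o a b).natAbs - G.formB o a b) -
            ((∑ x, a (G.face x)).natAbs - ∑ x, a (G.face x)) +
            2 * (∑ v, b v - ∑ p, a p) := by
        rw [G.formB_eq b ha]; ring
      rw [h3]
      exact (h1.sub h2).add (even_two_mul _)
    · congr 3
      rw [G.formA_eq b ha, G.formB_eq b ha, stateExp, Finset.sum_add_distrib]
      ring
  · exact Finset.prod_congr rfl fun x _ => (if_pos (hab x)).symm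

/-- For δ < 0 both x and y are at least -δ, so xy ≥ δ², and it remains to use δ² + δ ≥ 0 and (δ +
1)² ≥ 0. -/
theorem summand_bounds {x y δ : ℤ} (hx : 0 ≤ x) (hy : 0 ≤ y) (hx' : 0 ≤ x + δ) (hy' : 0 ≤ y + δ) :
    |δ| ≤ x * y + (x + δ) * (y + δ) + δ + 1 ∧ 0 ≤ x * y + (x + δ) * (y + δ) + δ := by
  have h1 := mul_nonneg hx hy
  have h2 := mul_nonneg hx' hy'
  rcases le_or_gt 0 δ with h | h
  · rw [abs_of_nonneg h]
    constructor <;> linarith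
  · rw [abs_of_neg h]
    constructor <;> nlinarith [sq_nonneg (δ + 1)]

/-- Charge -2 a_p to the edge assigned to p and 2 b_v to the edge assigned to v. Every charged edge
is nonnegative; a face edge bounds the jump of a to the parent face, and a vertex edge bounds a
corner value at v. -/
theorem exists_stateExp_bound (hc : G.Connected) (hg : G.GenusZero) (o : G.Face) (v₀ : G.Vertex) :
    ∃ K : ℕ, ∀ (a : G.Face → ℤ) (b : G.Vertex → ℤ), a o = 0 → b v₀ = 0 →
      (∀ x, 0 ≤ a (G.face x) + b (G.vert x)) →
      0 ≤ stateExp G.flip G.face G.vert a b ∧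
      (∀ p, |a p| ≤ K * (stateExp G.flip G.face G.vert a b + 1)) ∧
      ∀ v, |b v| ≤ K * (stateExp G.flip G.face G.vert a b + 1) := by
  obtain ⟨rank, t, u, ht, hu, hbij⟩ := G.exists_tree_cotree hc hg o v₀
  classical
  -- The sum of ranks bounds the depth of every face in the dual tree; the additional 1 pays for
  -- passing from a face to a vertex.
  refine ⟨∑ p, rank p + 1, fun a b ha hb hab => ?_⟩
  set S := stateExp G.flip G.face G.vert a b with hS
  let h : D → ℤ := fun x => (a (G.face x) + b (G.vert x)) * (a (G.face x) + b (G.vert (G.flip x))) +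
    a (G.face x)
  have hab' : ∀ x, 0 ≤ a (G.face x) + b (G.vert (G.flip x)) := fun x => by
    rw [← G.face_next, ← G.vert_next]; exact hab _
  let g : {p // p ≠ o} → ℤ := fun p => h (t p) + h (G.flip (t p)) - 2 * a p
  let k : {v // v ≠ v₀} → ℤ := fun v => h (u v) + h (G.flip (u v)) + 2 * b v
  have hsum : S = ∑ p, g p + ∑ v, k v := by
    have h1 : ∑ x, h x = ∑ i : {p // p ≠ o} ⊕ {v // v ≠ v₀},
        (h (Sum.elim t u i) + h (G.flip (Sum.elim t u i))) := by
      rw [← hbij.sum_comp h, Fintype.sum_prod_type]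
      refine Finset.sum_congr rfl fun i _ => ?_
      rw [Fintype.sum_bool, add_comm]
      rfl
    rw [hS, stateExp]
    change ∑ x, h x + _ - _ = _
    rw [h1, Fintype.sum_sum_type, sum_eq_sum_subtype_ne o a ha, sum_eq_sum_subtype_ne v₀ b hb]
    simp only [g, k, Finset.sum_add_distrib, Finset.sum_sub_distrib, ← Finset.mul_sum, Sum.elim_inl,
      Sum.elim_inr]
    ring
  have hg' : ∀ p : {p // p ≠ o}, |a (G.face (G.flip (t p))) - a p| ≤ g p + 1 ∧ 0 ≤ g p := by
    intro p
    have h1 := hab (t p)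
    have h2 := hab' (t p)
    have h3 := hab (G.flip (t p))
    have h4 := hab' (G.flip (t p))
    rw [G.flip_flip] at h4
    rw [(ht p).1] at h1 h2
    have h5 := summand_bounds (δ := a (G.face (G.flip (t p))) - a p) h1 h2 (by linarith)
      (by linarith)
    simp only [g, h, G.flip_flip, (ht p).1]
    constructor <;> nlinarith [h5.1, h5.2]
  have hk : ∀ v : {v // v ≠ v₀}, a (G.face (u v)) + b v ≤ k v ∧ 0 ≤ k v := by
    intro v
    have h1 := hab (u v)
    have h2 := hab' (u v)
    have h3 := hab (G.flip (u v))
    have h4 := hab' (G.flip (u v))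
    rw [G.flip_flip] at h4
    rw [hu v] at h1 h4
    simp only [k, h, G.flip_flip, hu v]
    constructor <;> nlinarith [mul_nonneg h1 h2, mul_nonneg h3 h4]
  have hg0 : 0 ≤ ∑ p, g p := Finset.sum_nonneg fun p _ => (hg' p).2
  have hk0 : 0 ≤ ∑ v, k v := Finset.sum_nonneg fun p _ => (hk p).2
  have hgS : ∀ p, g p ≤ S := fun p => by
    have := Finset.single_le_sum (fun i _ => (hg' i).2) (Finset.mem_univ p)
    linarith
  have hkS : ∀ v, k v ≤ S := fun p => by
    have := Finset.single_le_sum (fun i _ => (hk i).2) (Finset.mem_univ p)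
    linarith
  have hS0 : 0 ≤ S := by linarith
  -- Follow the dual tree to the root, where a is 0; each step changes a by at most S + 1.
  have hrank : ∀ (n : ℕ) (p : G.Face), rank p ≤ n → |a p| ≤ rank p * (S + 1) := by
    intro n
    induction n with
    | zero =>
      intro p hp
      by_cases hpo : p = o
      · rw [hpo, ha, abs_zero]; positivity
      · have := (ht ⟨p, hpo⟩).2
        simp only at this
        omega
    | succ n ih =>
      intro p hp
      by_cases hpo : p = o
      · rw [hpo, ha, abs_zero]; positivity
      · have h1 := (ht ⟨p, hpo⟩).2
        have h2 := (hg' ⟨p, hpo⟩).1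
        have h3 := hgS ⟨p, hpo⟩
        simp only at h1 h2
        have h4 := ih _ (by omega : rank (G.face (G.flip (t ⟨p, hpo⟩))) ≤ n)
        have h5 : |a p| ≤ |a (G.face (G.flip (t ⟨p, hpo⟩)))| +
            |a (G.face (G.flip (t ⟨p, hpo⟩))) - a p| := by
          have := abs_sub (a (G.face (G.flip (t ⟨p, hpo⟩))))
            (a (G.face (G.flip (t ⟨p, hpo⟩))) - a p)
          simpa using this
        have h6 : ((rank (G.face (G.flip (t ⟨p, hpo⟩))) : ℕ) : ℤ) + 1 ≤ rank p := by exact_mod_cast h1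
        nlinarith
  have hR : ∀ p, (rank p : ℤ) ≤ (∑ p, rank p : ℕ) := fun p => by
    exact_mod_cast Finset.single_le_sum (f := rank) (fun _ _ => Nat.zero_le _) (Finset.mem_univ p)
  have hap : ∀ p, |a p| ≤ (∑ p, rank p : ℕ) * (S + 1) := fun p =>
    (hrank _ p le_rfl).trans (mul_le_mul_of_nonneg_right (hR p) (by linarith))
  have hR0 : (0 : ℤ) ≤ (∑ p, rank p : ℕ) := by positivity
  refine ⟨hS0, fun p => ?_, fun v => ?_⟩
  · have := hap p
    rw [Nat.cast_add, Nat.cast_one, add_mul]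
    linarith
  · rw [Nat.cast_add, Nat.cast_one, add_mul]
    by_cases hv : v = v₀
    · rw [hv, hb, abs_zero]; positivity
    · have h1 := hap (G.face (u ⟨v, hv⟩))
      have h2 := (hk ⟨v, hv⟩).1
      have h3 := hkS ⟨v, hv⟩
      have h4 := hab (u ⟨v, hv⟩)
      rw [hu] at h4
      simp only at h2 h4
      rw [abs_le] at h1 ⊢
      constructor <;> linarith

theorem stateExp_nonneg (hc : G.Connected) (hg : G.GenusZero) {o : G.Face} {v : G.Vertex}
    (p : RootedLabels o v) (h : stateTerm G.flip G.face G.vert p.1.1 p.1.2 ≠ 0) :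
    0 ≤ stateExp G.flip G.face G.vert p.1.1 p.1.2 := by
  obtain ⟨K, hK⟩ := G.exists_stateExp_bound hc hg o v
  exact (hK _ _ p.2.1 p.2.2 (nonneg_of_stateTerm_ne_zero h)).1

theorem small_stateTerm (hc : G.Connected) (hg : G.GenusZero) (o : G.Face) (v : G.Vertex) :
    XSmall fun p : RootedLabels o v => stateTerm G.flip G.face G.vert p.1.1 p.1.2 := fun N => by
  obtain ⟨K, hK⟩ := G.exists_stateExp_bound hc hg o v
  have hfin : (Set.Icc (fun _ : G.Face => -(K * (2 * N + 1) : ℤ)) (fun _ => K * (2 * N + 1)) ×ˢ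
    Set.Icc (fun _ : G.Vertex => -(K * (2 * N + 1) : ℤ)) (fun _ => K * (2 * N + 1))).Finite := by
    classical
    exact (Set.finite_Icc _ _).prod (Set.finite_Icc _ _)
  refine (hfin.preimage Subtype.val_injective.injOn).subset fun p hp => ?_
  have hne : stateTerm G.flip G.face G.vert p.1.1 p.1.2 ≠ 0 := fun h0 =>
    hp (show X ^ N ∣ stateTerm G.flip G.face G.vert p.1.1 p.1.2 by rw [h0]; exact dvd_zero _)
  obtain ⟨h1, h2, h3⟩ := hK _ _ p.2.1 p.2.2 (nonneg_of_stateTerm_ne_zero hne)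
  have h4 : stateExp G.flip G.face G.vert p.1.1 p.1.2 < 2 * N := by
    by_contra h
    refine hp (Dvd.dvd.trans (pow_dvd_pow X ?_) ((dvd_mul_left _ _).mul_right _))
    omega
  have h5 : (K : ℤ) * (stateExp G.flip G.face G.vert p.1.1 p.1.2 + 1) ≤ K * (2 * N + 1) :=
    mul_le_mul_of_nonneg_left (by linarith) (by positivity)
  simp only [Set.mem_preimage, Set.mem_prod, Set.mem_Icc, Pi.le_def]
  exact ⟨⟨fun q => by linarith [(abs_le.mp (h2 q)).1], fun q => by linarith [(abs_le.mp (h2 q)).2]⟩,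
    fun q => by linarith [(abs_le.mp (h3 q)).1], fun q => by linarith [(abs_le.mp (h3 q)).2]⟩

section Labels

variable {F V : Type*} [Fintype F] [Fintype V] (eF : G.Face ≃ F) (eV : G.Vertex ≃ V) (o : G.Face)
  (v : G.Vertex)

theorem stateTerm_stateLabels (s : G.State o v) :
    stateTerm G.flip (fun x => eF (G.face x)) (fun x => eV (G.vert x))
      (G.stateLabels eF eV o v s).1.1 (G.stateLabels eF eV o v s).1.2 = G.phiTerm o v s := by
  rw [phiTerm_eq, stateTerm, stateTerm, stateExp, stateExp]
  simp only [stateLabels, Function.comp_apply, Equiv.symm_apply_apply]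
  rw [eF.symm.sum_comp s.1.1, eV.symm.sum_comp s.1.2]

theorem support_subset_range_stateLabels :
    (Function.support fun p : RootedLabels (eF o) (eV v) =>
      stateTerm G.flip (fun x => eF (G.face x)) (fun x => eV (G.vert x)) p.1.1 p.1.2) ⊆
      Set.range (G.stateLabels eF eV o v) := by
  rintro ⟨⟨a, b⟩, ha, hb⟩ hp
  refine ⟨⟨(a ∘ eF, b ∘ eV), ha, hb, fun x => nonneg_of_stateTerm_ne_zero hp x⟩, ?_⟩
  simp [stateLabels, Function.comp_def]

theorem summable_phiTerm (h : XSmall fun p : RootedLabels (eF o) (eV v) =>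
    stateTerm G.flip (fun x => eF (G.face x)) (fun x => eV (G.vert x)) p.1.1 p.1.2) :
    Summable (G.phiTerm o v) := by
  refine (h.comp_injective (G.stateLabels_injective eF eV o v)).summable.congr fun s => ?_
  exact G.stateTerm_stateLabels eF eV o v s

theorem tsum_phiTerm :
    ∑' s, G.phiTerm o v s = ∑' p : RootedLabels (eF o) (eV v),
      stateTerm G.flip (fun x => eF (G.face x)) (fun x => eV (G.vert x)) p.1.1 p.1.2 := by
  rw [← (G.stateLabels_injective eF eV o v).tsum_eq (G.support_subset_range_stateLabels eF eV o v)]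
  exact tsum_congr fun s => (G.stateTerm_stateLabels eF eV o v s).symm

end Labels

end DartMap

/-! ### Joint summation over the labels of `G` and the additional labels -/

section ExtraSum

open PowerSeries

/-- The finite exceptional set of additional labels is the same for all x and y, so the joint
exceptional set lies in a product of finite sets. -/
theorem small_mul_extraTerm {ι : Type*} {s : ℕ} (hs : 1 ≤ s) {f : ι → ℤ⟦X⟧} (hf : XSmall f)
    (x y : ι → ℤ) (hxy : ∀ i, f i ≠ 0 → 0 ≤ x i ∧ 0 ≤ y i) :
    XSmall fun p : ι × (ℤ × (Fin s → ℤ)) => f p.1 * extraTerm s (x p.1) (y p.1) p.2.1 p.2.2 :=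
  fun N => by
  obtain ⟨S, hS, h⟩ := exists_finite_extraExp hs N
  refine ((hf N).prod hS).subset fun ⟨i, a, b⟩ hp => ?_
  have h1 : ¬ X ^ N ∣ f i := fun h' => hp (h'.mul_right _)
  have h2 : ¬ X ^ N ∣ extraTerm s (x i) (y i) a b := fun h' => hp (h'.mul_left _)
  have hi : f i ≠ 0 := fun h' => h1 (by rw [h']; exact dvd_zero _)
  have he : extraTerm s (x i) (y i) a b ≠ 0 := fun h' => h2 (by rw [h']; exact dvd_zero _)
  refine ⟨h1, (h (x i) (y i) a b (hxy i hi).1 (hxy i hi).2 he).2 ?_⟩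
  by_contra hlt
  exact h2 ((pow_dvd_pow X (by omega)).trans (X_pow_dvd_extraTerm _ _ _ _ _))

theorem tsum_mul_extraTerm {ι : Type*} {s : ℕ} (hs : 1 ≤ s) {f : ι → ℤ⟦X⟧} (hf : XSmall f)
    (x y : ι → ℤ) (hxy : ∀ i, f i ≠ 0 → 0 ≤ x i ∧ 0 ≤ y i) :
    qPochInf ^ (s + 1) * ∑' p : ι × (ℤ × (Fin s → ℤ)),
      f p.1 * extraTerm s (x p.1) (y p.1) p.2.1 p.2.2 = (∑' i, f i) * thetaSeries (s + 2) := by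
  have h := small_mul_extraTerm hs hf x y hxy
  rw [h.tsum_prod, ← h.tsum_right.tsum_mul_left, ← hf.tsum_mul_right]
  refine tsum_congr fun i => ?_
  by_cases hi : f i = 0
  · simp [hi]
  · obtain ⟨m, hm⟩ := Int.eq_ofNat_of_zero_le (hxy i hi).1
    obtain ⟨n, hn⟩ := Int.eq_ofNat_of_zero_le (hxy i hi).2
    simp only [hm, hn]
    rw [(small_extraTerm hs m n).tsum_mul_left, mul_left_comm, tsum_extraTerm hs]

theorem prod_pathFun_castSucc {T : Type*} {M : Type*} [CommMonoid M] {s : ℕ} (x : T) (b : Fin s → T)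
    (y : T) (f : T → M) :
    ∏ i : Fin (s + 1), f (pathFun x b y i.castSucc) = f x * ∏ i, f (b i) := by
  rw [Fin.prod_univ_succ]
  refine congrArg₂ _ rfl (Finset.prod_congr rfl fun i _ => ?_)
  rw [← Fin.succ_castSucc, pathFun_succ_castSucc]

theorem prod_pathFun_succ {T : Type*} {M : Type*} [CommMonoid M] {s : ℕ} (x : T) (b : Fin s → T)
    (y : T) (f : T → M) :
    ∏ i : Fin (s + 1), f (pathFun x b y i.succ) = (∏ i, f (b i)) * f y := by
  rw [Fin.prod_univ_castSucc, Fin.succ_last, pathFun_last]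
  refine congrArg₂ _ (Finset.prod_congr rfl fun i _ => ?_) rfl
  rw [pathFun_succ_castSucc]

end ExtraSum

/-! ### Faces and vertices of the edge connected sum -/

namespace DartMap

section Labels

variable {D : Type*} (G : DartMap D)

/-- Cycles are identified with explicit labels: invariance makes the labelling descend to the
quotient, and ψ shows that equal labels mean equal cycles. -/
theorem exists_equiv_of_labels {D Q F : Type*} {mk : D → Q} (hmk : Function.Surjective mk)
    {fl : D → F} (hfl : Function.Surjective fl) (h : ∀ x y, mk x = mk y → fl x = fl y)
    (ψ : F → Q) (hψ : ∀ x, ψ (fl x) = mk x) : ∃ e : Q ≃ F, ∀ x, e (mk x) = fl x := by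
  have hinv : ∀ p, fl (Function.surjInv hmk (ψ p)) = p := by
    intro p
    obtain ⟨x, rfl⟩ := hfl p
    exact h _ _ ((Function.surjInv_eq hmk _).trans (hψ x))
  refine ⟨⟨fun q => fl (Function.surjInv hmk q), ψ, fun q => ?_, hinv⟩, fun x => ?_⟩
  · simp only [hψ, Function.surjInv_eq]
  · exact h _ _ (Function.surjInv_eq hmk _)

theorem eq_of_sameCycle {D F : Type*} {σ : Equiv.Perm D} {fl : D → F} (h : ∀ x, fl (σ x) = fl x)
    {x y : D} (hxy : σ.SameCycle x y) : fl x = fl y := by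
  obtain ⟨i, rfl⟩ := hxy
  induction i using Int.induction_on with
  | zero => rfl
  | succ i ih => rw [ih, add_comm, zpow_add, zpow_one, Equiv.Perm.mul_apply, h]
  | pred i ih =>
    rw [ih, ← h ((σ ^ (-(i : ℤ) - 1)) x), ← Equiv.Perm.mul_apply, ← zpow_one_add]
    congr 3
    ring

theorem face_surjective : Function.Surjective G.face := Quotient.exists_rep

theorem vert_surjective : Function.Surjective G.vert := Quotient.exists_rep

theorem exists_faceEquiv {F : Type*} (fl : D → F) (hfl : Function.Surjective fl)
    (hn : ∀ x, fl (G.next x) = fl x) (ψ : F → G.Face) (hψ : ∀ x, ψ (fl x) = G.face x) :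
    ∃ e : G.Face ≃ F, ∀ x, e (G.face x) = fl x :=
  exists_equiv_of_labels G.face_surjective hfl
    (fun _ _ hxy => eq_of_sameCycle hn (Quotient.exact hxy)) ψ hψ

theorem exists_vertexEquiv {V : Type*} (vl : D → V) (hvl : Function.Surjective vl)
    (hn : ∀ x, vl (G.next x) = vl (G.flip x)) (ψ : V → G.Vertex) (hψ : ∀ x, ψ (vl x) = G.vert x) :
    ∃ e : G.Vertex ≃ V, ∀ x, e (G.vert x) = vl x := by
  have h : ∀ x, vl (G.rot x) = vl x := fun x => by
    obtain ⟨y, rfl⟩ := G.next.surjective x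
    rw [rot_next, hn]
  exact exists_equiv_of_labels G.vert_surjective hvl
    (fun _ _ hxy => eq_of_sameCycle h (Quotient.exact hxy)) ψ hψ

end Labels

section AttachLabels

variable {D : Type*} (G : DartMap D) (d : D) (s : ℕ) (hr : 3 ≤ s + 2)

theorem attach_next (r : ℕ) (hr : 3 ≤ r) (x : D ⊕ (Fin (r - 1) ⊕ Fin (r - 1))) :
    (G.attachPolygon d r hr).next x = attachNextFun G d r hr x := rfl

theorem attach_next_inl_self : (G.attachPolygon d (s + 2) hr).next (Sum.inl d) =
    Sum.inr (Sum.inr (Fin.last s)) := by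
  rw [attach_next]
  simp only [attachNextFun, if_true]
  rfl

theorem attach_next_inl_of_next_eq {e : D} (he : e ≠ d) (h : G.next e = d) :
    (G.attachPolygon d (s + 2) hr).next (Sum.inl e) = Sum.inr (Sum.inl (0 : Fin (s + 1))) := by
  rw [attach_next]
  simp only [attachNextFun, if_neg he, if_pos h]
  rfl

theorem attach_next_inl_of_ne {e : D} (he : e ≠ d) (h : G.next e ≠ d) :
    (G.attachPolygon d (s + 2) hr).next (Sum.inl e) = Sum.inl (G.next e) := by
  rw [attach_next]
  simp only [attachNextFun, if_neg he, if_neg h]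

theorem attach_next_fwd (i : Fin s) : (G.attachPolygon d (s + 2) hr).next
    (Sum.inr (Sum.inl i.castSucc)) = Sum.inr (Sum.inl i.succ) := by
  rw [attach_next]
  have h : (i.castSucc : Fin (s + 1)).1 + 1 < s + 2 - 1 := by simp
  simp only [attachNextFun]
  rw [dif_pos h]
  rfl

theorem attach_next_fwd_last (hd : G.next d ≠ d) : (G.attachPolygon d (s + 2) hr).next
    (Sum.inr (Sum.inl (Fin.last s))) = Sum.inl (G.next d) := by
  rw [attach_next]
  have h : ¬ ((Fin.last s : Fin (s + 1)).1 + 1 < s + 2 - 1) := by simp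
  simp only [attachNextFun]
  rw [dif_neg h, if_neg hd]

theorem attach_next_bwd_zero : (G.attachPolygon d (s + 2) hr).next
    (Sum.inr (Sum.inr (0 : Fin (s + 1)))) = Sum.inl d := by
  rw [attach_next]
  have h : (0 : Fin (s + 1)).1 = 0 := rfl
  simp only [attachNextFun]
  rw [if_pos h]

theorem attach_next_bwd (i : Fin s) : (G.attachPolygon d (s + 2) hr).next
    (Sum.inr (Sum.inr i.succ)) = Sum.inr (Sum.inr i.castSucc) := by
  rw [attach_next]
  have h : ¬ (i.succ : Fin (s + 1)).1 = 0 := by simp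
  simp only [attachNextFun]
  rw [if_neg h]
  rfl

open Classical in
/-- The faces of the edge connected sum: `none` is the new polygon. -/
def attachFace : D ⊕ (Fin (s + 1) ⊕ Fin (s + 1)) → Option G.Face
  | Sum.inl e => if e = d then none else some (G.face e)
  | Sum.inr (Sum.inl _) => some (G.face d)
  | Sum.inr (Sum.inr _) => none

/-- The vertices of the new path in the edge connected sum. -/
def attachPath : Fin (s + 2) → G.Vertex ⊕ Fin s :=
  pathFun (Sum.inl (G.vert d)) Sum.inr (Sum.inl (G.vert (G.flip d)))

/-- The source vertices of the darts of the edge connected sum. -/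
def attachVert : D ⊕ (Fin (s + 1) ⊕ Fin (s + 1)) → G.Vertex ⊕ Fin s
  | Sum.inl e => Sum.inl (G.vert e)
  | Sum.inr (Sum.inl i) => G.attachPath d s i.castSucc
  | Sum.inr (Sum.inr i) => G.attachPath d s i.succ

theorem exists_attach_faceEquiv (hd : G.next d ≠ d) :
    ∃ e : (G.attachPolygon d (s + 2) hr).Face ≃ Option G.Face,
      ∀ x, e ((G.attachPolygon d (s + 2) hr).face x) = G.attachFace d s x := by
  classical
  set A := G.attachPolygon d (s + 2) hr with hA
  have hfwd : ∀ i : Fin (s + 1), A.face (Sum.inr (Sum.inl i)) =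
      A.face (Sum.inr (Sum.inl (0 : Fin (s + 1)))) := by
    intro i
    induction i using Fin.induction with
    | zero => rfl
    | succ i ih => rw [← ih, ← G.attach_next_fwd d s hr, face_next]
  have hbwd : ∀ i : Fin (s + 1), A.face (Sum.inr (Sum.inr i)) = A.face (Sum.inl d) := by
    intro i
    induction i using Fin.induction with
    | zero => rw [← G.attach_next_bwd_zero d s hr, face_next]
    | succ i ih => rw [← ih, ← G.attach_next_bwd d s hr, face_next]
  -- The dart d moves to the new polygon, so the old face to its left is represented by the first
  -- path dart, which replaces d on the outer boundary.
  let φ : D → A.Face := fun e =>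
    if e = d then A.face (Sum.inr (Sum.inl (0 : Fin (s + 1)))) else A.face (Sum.inl e)
  have hφ : ∀ e, φ (G.next e) = φ e := by
    intro e
    by_cases he : e = d
    · subst he
      simp only [φ, if_neg hd, if_true]
      rw [← G.attach_next_fwd_last e s hr hd, face_next, hfwd]
    · by_cases hn : G.next e = d
      · simp only [φ, if_neg he, if_pos hn]
        rw [← G.attach_next_inl_of_next_eq d s hr he hn, face_next]
      · simp only [φ, if_neg he, if_neg hn]
        rw [← G.attach_next_inl_of_ne d s hr he hn, face_next]
  refine A.exists_faceEquiv (G.attachFace d s) ?_ ?_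
    (fun q => q.elim (A.face (Sum.inl d)) (Quotient.lift φ fun _ _ h => eq_of_sameCycle hφ h)) ?_
  · rintro (_ | q)
    · exact ⟨Sum.inl d, by simp [attachFace]⟩
    · obtain ⟨e, rfl⟩ := G.face_surjective q
      by_cases he : e = d
      · exact ⟨Sum.inr (Sum.inl (0 : Fin (s + 1))), by simp [attachFace, he]⟩
      · exact ⟨Sum.inl e, by simp [attachFace, he]⟩
  · rintro (e | i | i)
    · by_cases he : e = d
      · subst he
        rw [hA, attach_next_inl_self]
        simp [attachFace]
      · by_cases hn : G.next e = d
        · rw [hA, attach_next_inl_of_next_eq _ _ _ _ he hn]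
          simp only [attachFace, if_neg he]
          rw [← hn, face_next]
        · rw [hA, attach_next_inl_of_ne _ _ _ _ he hn]
          simp [attachFace, he, hn, face_next]
    · refine Fin.lastCases ?_ (fun i => ?_) (i : Fin (s + 1))
      · rw [hA, attach_next_fwd_last _ _ _ _ hd]
        simp [attachFace, hd, face_next]
      · rw [hA, attach_next_fwd]
        rfl
    · refine Fin.cases ?_ (fun i => ?_) (i : Fin (s + 1))
      · rw [hA, attach_next_bwd_zero]
        simp [attachFace]
      · rw [hA, attach_next_bwd]
        rfl
  · rintro (e | i | i)
    · by_cases he : e = d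
      · simp only [attachFace, if_pos he, Option.elim]
        rw [he]
      · simp only [attachFace, if_neg he, Option.elim]
        change φ e = _
        simp only [φ, if_neg he]
    · change φ d = _
      rw [hfwd]
      simp only [φ, if_true]
    · exact (hbwd i).symm

theorem attachPath_last : G.attachPath d s (Fin.last (s + 1)) = Sum.inl (G.vert (G.flip d)) :=
  pathFun_last _ _ _

theorem attachPath_succ_castSucc (i : Fin s) : G.attachPath d s i.castSucc.succ = Sum.inr i :=
  pathFun_succ_castSucc _ _ _ _

theorem exists_attach_vertexEquiv (hd : G.next d ≠ d) :
    ∃ e : (G.attachPolygon d (s + 2) hr).Vertex ≃ G.Vertex ⊕ Fin s,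
      ∀ x, e ((G.attachPolygon d (s + 2) hr).vert x) = G.attachVert d s x := by
  classical
  set A := G.attachPolygon d (s + 2) hr with hA
  have hfl : ∀ e, A.flip (Sum.inl e) = Sum.inl (G.flip e) := fun e => rfl
  have hff : ∀ i : Fin (s + 1), A.flip (Sum.inr (Sum.inl i)) = Sum.inr (Sum.inr i) := fun i => rfl
  have hfb : ∀ i : Fin (s + 1), A.flip (Sum.inr (Sum.inr i)) = Sum.inr (Sum.inl i) := fun i => rfl
  have h0 : A.vert (Sum.inr (Sum.inl (0 : Fin (s + 1)))) = A.vert (Sum.inl d) := by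
    rw [← G.attach_next_bwd_zero d s hr, vert_next, hfb]
  have hlast : A.vert (Sum.inr (Sum.inr (Fin.last s))) = A.vert (Sum.inl (G.flip d)) := by
    rw [← G.attach_next_inl_self d s hr, vert_next, hfl]
  have hmid : ∀ i : Fin s, A.vert (Sum.inr (Sum.inl i.succ)) =
      A.vert (Sum.inr (Sum.inr i.castSucc)) := by
    intro i
    rw [← G.attach_next_fwd d s hr, vert_next, hff]
  have hφ : ∀ e, A.vert (Sum.inl (G.rot e)) = A.vert (Sum.inl e) := by
    intro e
    obtain ⟨e, rfl⟩ := G.next.surjective e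
    rw [rot_next]
    by_cases he : e = d
    · subst he
      rw [← hlast, ← G.attach_next_fwd_last e s hr hd, vert_next, hff]
    · rw [← hfl, ← vert_next]
      by_cases hn : G.next e = d
      · rw [G.attach_next_inl_of_next_eq d s hr he hn, hn, h0]
      · rw [G.attach_next_inl_of_ne d s hr he hn]
  refine A.exists_vertexEquiv (G.attachVert d s) ?_ ?_
    (Sum.elim (Quotient.lift (fun e => A.vert (Sum.inl e)) fun _ _ h =>
        eq_of_sameCycle (σ := G.rot) (fl := fun e => A.vert (Sum.inl e)) hφ h)
      fun i => A.vert (Sum.inr (Sum.inl i.succ))) ?_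
  · rintro (q | i)
    · obtain ⟨e, rfl⟩ := G.vert_surjective q
      exact ⟨Sum.inl e, rfl⟩
    · refine ⟨Sum.inr (Sum.inl i.succ), ?_⟩
      change G.attachPath d s i.succ.castSucc = _
      rw [← Fin.succ_castSucc, attachPath_succ_castSucc]
  · rintro (e | i | i)
    · rw [hfl]
      by_cases he : e = d
      · subst he
        rw [hA, attach_next_inl_self]
        exact attachPath_last _ _ _
      · by_cases hn : G.next e = d
        · rw [hA, attach_next_inl_of_next_eq _ _ _ _ he hn]
          change Sum.inl _ = Sum.inl _
          rw [← vert_next, hn]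
        · rw [hA, attach_next_inl_of_ne _ _ _ _ he hn]
          change Sum.inl _ = Sum.inl _
          rw [vert_next]
    · rw [hff]
      refine Fin.lastCases ?_ (fun i => ?_) (i : Fin (s + 1))
      · rw [hA, attach_next_fwd_last _ _ _ _ hd]
        change Sum.inl _ = G.attachPath d s (Fin.last s).succ
        rw [Fin.succ_last, attachPath_last, vert_next]
      · rw [hA, attach_next_fwd]
        rfl
    · rw [hfb]
      refine Fin.cases ?_ (fun i => ?_) (i : Fin (s + 1))
      · rw [hA, attach_next_bwd_zero]
        rfl
      · rw [hA, attach_next_bwd]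
        rfl
  · rintro (e | i | i)
    · rfl
    · refine Fin.cases ?_ (fun i => ?_) (i : Fin (s + 1))
      · exact h0.symm
      · change Sum.elim _ _ (G.attachPath d s i.succ.castSucc) = _
        rw [← Fin.succ_castSucc, attachPath_succ_castSucc]
        rfl
    · refine Fin.lastCases ?_ (fun i => ?_) (i : Fin (s + 1))
      · change Sum.elim _ _ (G.attachPath d s (Fin.last s).succ) = _
        rw [Fin.succ_last, attachPath_last]
        exact hlast.symm
      · change Sum.elim _ _ (G.attachPath d s i.castSucc.succ) = _
        rw [attachPath_succ_castSucc]
        exact hmid i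

end AttachLabels

end DartMap

/-! ### Factorization of the series of the edge connected sum -/

/-- Labels of a map and labels of an additional face and of additional vertices. -/
def rootedLabelsEquiv {F V : Type*} (s : ℕ) (o : F) (v : V) :
    RootedLabels o v × (ℤ × (Fin s → ℤ)) ≃
      RootedLabels (some o : Option F) (Sum.inl v : V ⊕ Fin s) where
  toFun p := ⟨(fun q => q.elim p.2.1 p.1.1.1, Sum.elim p.1.1.2 p.2.2), p.1.2⟩
  invFun p := (⟨(p.1.1 ∘ some, p.1.2 ∘ Sum.inl), p.2⟩, (p.1.1 none, p.1.2 ∘ Sum.inr))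
  left_inv _ := rfl
  right_inv p := by
    refine Subtype.ext (Prod.ext ?_ ?_)
    · funext q
      cases q <;> rfl
    · exact Sum.elim_comp_inl_inr _

namespace DartMap

open PowerSeries

section Labelled

variable {D F V : Type*} [Fintype D] [Fintype F] [Fintype V] (G : DartMap D) {eF : G.Face ≃ F}
  {eV : G.Vertex ≃ V} {o : G.Face} {v : G.Vertex} {fl : D → F} {vl : D → V} {o' : F} {v' : V}

theorem summable_phiTerm_of_labels (hfl : ∀ x, eF (G.face x) = fl x)
    (hvl : ∀ x, eV (G.vert x) = vl x) (ho : eF o = o') (hv : eV v = v')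
    (h : XSmall fun p : RootedLabels o' v' => stateTerm G.flip fl vl p.1.1 p.1.2) :
    Summable (G.phiTerm o v) := by
  subst ho hv
  obtain rfl : (fun x => eF (G.face x)) = fl := funext hfl
  obtain rfl : (fun x => eV (G.vert x)) = vl := funext hvl
  exact G.summable_phiTerm eF eV o v h

theorem tsum_phiTerm_of_labels (hfl : ∀ x, eF (G.face x) = fl x)
    (hvl : ∀ x, eV (G.vert x) = vl x) (ho : eF o = o') (hv : eV v = v') :
    ∑' s, G.phiTerm o v s =
      ∑' p : RootedLabels o' v', stateTerm G.flip fl vl p.1.1 p.1.2 := by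
  subst ho hv
  obtain rfl : (fun x => eF (G.face x)) = fl := funext hfl
  obtain rfl : (fun x => eV (G.vert x)) = vl := funext hvl
  exact G.tsum_phiTerm eF eV o v

end Labelled

section AttachTerm

variable {D : Type*} (G : DartMap D) (d : D) (s : ℕ) (hr : 3 ≤ s + 2)

variable (a : G.Face → ℤ) (b : G.Vertex → ℤ) (a₀ : ℤ) (β : Fin s → ℤ)

open Classical in
theorem elim_attachFace_inl (ha : a (G.face d) = 0) (e : D) :
    (G.attachFace d s (Sum.inl e)).elim a₀ a = a (G.face e) + if e = d then a₀ else 0 := by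
  by_cases he : e = d
  · simp [attachFace, he, ha]
  · simp [attachFace, he]

/-- The reversal of the darts of the edge connected sum. -/
def attachFlip : D ⊕ (Fin (s + 1) ⊕ Fin (s + 1)) → D ⊕ (Fin (s + 1) ⊕ Fin (s + 1)) :=
  Sum.map G.flip Sum.swap

theorem elim_attachVert_fwd (i : Fin (s + 1)) :
    Sum.elim b β (G.attachVert d s (Sum.inr (Sum.inl i))) =
      pathFun (b (G.vert d)) β (b (G.vert (G.flip d))) i.castSucc :=
  comp_pathFun (Sum.inl (G.vert d)) _ _ (Sum.elim b β) i.castSucc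

theorem elim_attachVert_bwd (i : Fin (s + 1)) :
    Sum.elim b β (G.attachVert d s (Sum.inr (Sum.inr i))) =
      pathFun (b (G.vert d)) β (b (G.vert (G.flip d))) i.succ :=
  comp_pathFun (Sum.inl (G.vert d)) _ _ (Sum.elim b β) i.succ

theorem next_ne_self (hl : G.Loopless) : G.next d ≠ d := fun h =>
  hl d (by rw [← vert_next, h])

theorem end_labels_nonneg (hab : ∀ x, 0 ≤ a (G.face x) + b (G.vert x)) (ha : a (G.face d) = 0) :
    0 ≤ b (G.vert d) ∧ 0 ≤ b (G.vert (G.flip d)) := by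
  have h1 := hab d
  have h2 := hab (G.next d)
  rw [face_next, vert_next] at h2
  rw [ha, zero_add] at h1 h2
  exact ⟨h1, h2⟩

variable [Fintype D]

theorem prod_attach {M : Type*} [CommMonoid M] (f : D ⊕ (Fin (s + 1) ⊕ Fin (s + 1)) → M) :
    ∏ x, f x = (∏ e, f (Sum.inl e)) * ((∏ i, f (Sum.inr (Sum.inl i))) *
      ∏ i, f (Sum.inr (Sum.inr i))) := by
  rw [Fintype.prod_sum_type, Fintype.prod_sum_type]

theorem sum_attach {M : Type*} [AddCommMonoid M] (f : D ⊕ (Fin (s + 1) ⊕ Fin (s + 1)) → M) :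
    ∑ x, f x = (∑ e, f (Sum.inl e)) + ((∑ i, f (Sum.inr (Sum.inl i))) +
      ∑ i, f (Sum.inr (Sum.inr i))) := by
  rw [Fintype.sum_sum_type, Fintype.sum_sum_type]

theorem sum_elim_attachFace (ha : a (G.face d) = 0) :
    ∑ x, (G.attachFace d s x).elim a₀ a = ∑ e, a (G.face e) + (s + 2) * a₀ := by
  classical
  rw [sum_attach]
  simp only [G.elim_attachFace_inl d s a a₀ ha]
  simp only [attachFace, Option.elim, ha, Finset.sum_add_distrib, Finset.sum_ite_eq',
    Finset.mem_univ, if_true, Finset.sum_const, Finset.card_univ, Fintype.card_fin, nsmul_eq_mul]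
  push_cast
  ring

/-- Among the old darts only d changes its face label, from 0 to a₀. This gives the correction (a₀ +
x)(a₀ + y) - xy; the rest comes from the two sides of the path. -/
theorem stateExp_attach (ha : a (G.face d) = 0) :
    stateExp (G.attachFlip s) (G.attachFace d s) (G.attachVert d s)
      (fun q => q.elim a₀ a) (Sum.elim b β) =
    stateExp G.flip G.face G.vert a b +
      2 * extraExp s (b (G.vert d)) (b (G.vert (G.flip d))) a₀ β := by
  classical
  have h1 : ∀ e, ((a (G.face e) + if e = d then a₀ else 0) + b (G.vert e)) *
      ((a (G.face e) + if e = d then a₀ else 0) + b (G.vert (G.flip e))) =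
      (a (G.face e) + b (G.vert e)) * (a (G.face e) + b (G.vert (G.flip e))) +
        if e = d then (a₀ + b (G.vert d)) * (a₀ + b (G.vert (G.flip d))) -
          b (G.vert d) * b (G.vert (G.flip d)) else 0 := by
    intro e
    by_cases he : e = d
    · simp only [he, if_true, ha]; ring
    · simp only [if_neg he]; ring
  rw [stateExp, stateExp, two_mul_extraExp, Finset.sum_add_distrib,
    G.sum_elim_attachFace d s a a₀ ha, sum_attach, Fintype.sum_option, Fintype.sum_sum_type]
  simp only [attachFlip, Sum.map_inl, Sum.map_inr, Sum.swap_inl, Sum.swap_inr,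
    G.elim_attachFace_inl d s a a₀ ha, elim_attachVert_fwd, elim_attachVert_bwd]
  simp only [attachVert, Sum.elim_inl, Sum.elim_inr, h1]
  simp only [attachFace, Option.elim, ha, zero_add, Finset.sum_add_distrib, Finset.sum_ite_eq',
    Finset.mem_univ, if_true]
  rw [Finset.sum_congr rfl fun i _ => mul_comm
    (a₀ + pathFun (b (G.vert d)) β (b (G.vert (G.flip d))) (Fin.succ i)) _]
  ring

theorem prod_iq_attach (ha : a (G.face d) = 0) :
    ∏ x, iq ((G.attachFace d s x).elim a₀ a + Sum.elim b β (G.attachVert d s x)) =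
    (∏ x, iq (a (G.face x) + b (G.vert x))) *
      (iq (a₀ + b (G.vert d)) * iq (a₀ + b (G.vert (G.flip d))) *
        ∏ i, (iq (β i) * iq (a₀ + β i))) := by
  classical
  rw [prod_attach]
  simp only [G.elim_attachFace_inl d s a a₀ ha, elim_attachVert_fwd, elim_attachVert_bwd]
  simp only [attachVert, Sum.elim_inl, attachFace, Option.elim, ha, zero_add]
  rw [prod_pathFun_castSucc _ _ _ iq, prod_pathFun_succ _ _ _ fun z => iq (a₀ + z),
    Finset.prod_mul_distrib, ← Finset.mul_prod_erase _ _ (Finset.mem_univ d),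
    ← Finset.mul_prod_erase _ _ (Finset.mem_univ d)]
  rw [Finset.prod_congr rfl fun x hx => by rw [if_neg (Finset.ne_of_mem_erase hx), add_zero]]
  simp only [ha, if_true, zero_add]
  ring

theorem stateTerm_attach (hc : G.Connected) (hg : G.GenusZero) (hs : 1 ≤ s) {v : G.Vertex}
    (ha : a (G.face d) = 0) (hb : b v = 0) :
    stateTerm (G.attachFlip s) (G.attachFace d s) (G.attachVert d s)
      (fun q => q.elim a₀ a) (Sum.elim b β) =
    stateTerm G.flip G.face G.vert a b *
      extraTerm s (b (G.vert d)) (b (G.vert (G.flip d))) a₀ β := by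
  -- Vanishing factors are treated apart: `toNat` is additive only on nonnegative exponents, which
  -- are guaranteed when both factors are nonzero.
  by_cases h1 : stateTerm G.flip G.face G.vert a b = 0
  · have h : ∏ x, iq (a (G.face x) + b (G.vert x)) = 0 := by
      rw [stateTerm] at h1
      simpa [X_ne_zero] using h1
    rw [h1, zero_mul, stateTerm, prod_iq_attach _ _ _ _ _ _ _ ha, h, zero_mul, mul_zero]
  by_cases h2 : extraTerm s (b (G.vert d)) (b (G.vert (G.flip d))) a₀ β = 0
  · have h : iq (a₀ + b (G.vert d)) * iq (a₀ + b (G.vert (G.flip d))) *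
        ∏ i, (iq (β i) * iq (a₀ + β i)) = 0 := by
      rw [extraTerm] at h2
      rcases mul_eq_zero.mp h2 with h2 | h2
      · simp [X_ne_zero] at h2
      · exact h2
    rw [h2, mul_zero, stateTerm, prod_iq_attach _ _ _ _ _ _ _ ha, h, mul_zero, mul_zero]
  have hab := nonneg_of_stateTerm_ne_zero h1
  obtain ⟨hx, hy⟩ := G.end_labels_nonneg d a b hab ha
  have hS := G.stateExp_nonneg hc hg ⟨(a, b), ha, hb⟩ h1
  have hE : 0 ≤ extraExp s (b (G.vert d)) (b (G.vert (G.flip d))) a₀ β := by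
    obtain ⟨h3, h4, h5, h6⟩ := not_not.mp (mt extraTerm_eq_zero h2)
    have := le_two_mul_extraExp hs hx hy h3 h4 h5 h6
    have := Finset.sum_nonneg fun i (_ : i ∈ Finset.univ) => h5 i
    nlinarith [sq_nonneg a₀]
  have hsign : (-1 : ℤ⟦X⟧) ^ (∑ x, (G.attachFace d s x).elim a₀ a).natAbs =
      (-1) ^ (∑ x, a (G.face x)).natAbs * (-1) ^ (s * a₀.natAbs) := by
    rw [← pow_add, G.sum_elim_attachFace d s a a₀ ha]
    refine neg_one_pow_eq_of_even ?_
    have h3 := even_natAbs_sub (∑ e, a (G.face e) + (s + 2) * a₀)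
    have h4 := even_natAbs_sub (∑ e, a (G.face e))
    have h5 := (even_natAbs_sub a₀).mul_left s
    have h6 := ((h3.sub h4).sub h5).add (even_two_mul a₀)
    refine (congrArg Even ?_).mp h6
    push_cast
    ring
  have hS2 : 0 ≤ stateExp G.flip G.face G.vert a b / 2 := Int.ediv_nonneg hS zero_le_two
  rw [stateTerm, stateTerm, extraTerm, prod_iq_attach _ _ _ _ _ _ _ ha,
    stateExp_attach _ _ _ _ _ _ _ ha, hsign, Int.add_mul_ediv_left _ _ two_ne_zero,
    Int.toNat_add hS2 hE, pow_add]
  ring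

theorem numEdges_attachPolygon :
    (G.attachPolygon d (s + 2) hr).numEdges = G.numEdges + (s + 1) := by
  rw [numEdges, numEdges]
  simp only [Fintype.card_sum, Fintype.card_fin]
  omega

/-- Looplessness gives `G.next d ≠ d`, so the old outer face keeps a dart after d is replaced. -/
theorem attach_phi (hc : G.Connected) (hg : G.GenusZero) (hl : G.Loopless) (hs : 1 ≤ s) (ρ : D) :
    Summable ((G.attachPolygon d (s + 2) hr).phiTerm (G.attachOuter d (s + 2) hr)
      ((G.attachPolygon d (s + 2) hr).vert (Sum.inl ρ))) ∧
    (G.attachPolygon d (s + 2) hr).phi (G.attachOuter d (s + 2) hr)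
        ((G.attachPolygon d (s + 2) hr).vert (Sum.inl ρ)) =
      G.phi (G.face d) (G.vert ρ) * thetaSeries (s + 2) := by
  have hd := G.next_ne_self d hl
  obtain ⟨eF, heF⟩ := G.exists_attach_faceEquiv d s hr hd
  obtain ⟨eV, heV⟩ := G.exists_attach_vertexEquiv d s hr hd
  have ho : eF (G.attachOuter d (s + 2) hr) = some (G.face d) := heF _
  have hv : eV ((G.attachPolygon d (s + 2) hr).vert (Sum.inl ρ)) = Sum.inl (G.vert ρ) := heV _
  have hf := G.small_stateTerm hc hg (G.face d) (G.vert ρ)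
  have hxy : ∀ p : RootedLabels (G.face d) (G.vert ρ),
      stateTerm G.flip G.face G.vert p.1.1 p.1.2 ≠ 0 →
        0 ≤ p.1.2 (G.vert d) ∧ 0 ≤ p.1.2 (G.vert (G.flip d)) := fun p hp =>
    G.end_labels_nonneg d p.1.1 p.1.2 (nonneg_of_stateTerm_ne_zero hp) p.2.1
  have hterm : ∀ p : RootedLabels (G.face d) (G.vert ρ) × (ℤ × (Fin s → ℤ)),
      stateTerm (G.attachFlip s) (G.attachFace d s) (G.attachVert d s)
        (rootedLabelsEquiv s (G.face d) (G.vert ρ) p).1.1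
        (rootedLabelsEquiv s (G.face d) (G.vert ρ) p).1.2 =
      stateTerm G.flip G.face G.vert p.1.1.1 p.1.1.2 *
        extraTerm s (p.1.1.2 (G.vert d)) (p.1.1.2 (G.vert (G.flip d))) p.2.1 p.2.2 := fun p =>
    G.stateTerm_attach d s _ _ _ _ hc hg hs p.1.2.1 p.1.2.2
  constructor
  · refine (G.attachPolygon d (s + 2) hr).summable_phiTerm_of_labels heF heV ho hv ?_
    have h := (small_mul_extraTerm hs hf (fun p => p.1.2 (G.vert d))
      (fun p => p.1.2 (G.vert (G.flip d))) hxy).comp_injective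
        (rootedLabelsEquiv s (G.face d) (G.vert ρ)).symm.injective
    simp only [← hterm, Equiv.apply_symm_apply] at h
    exact h
  · rw [phi, phi, (G.attachPolygon d (s + 2) hr).tsum_phiTerm_of_labels heF heV ho hv,
      ← (rootedLabelsEquiv s (G.face d) (G.vert ρ)).tsum_eq, numEdges_attachPolygon, pow_add,
      mul_assoc, mul_assoc]
    refine congrArg _ ?_
    refine (congrArg _ (tsum_congr hterm)).trans ?_
    rw [tsum_mul_extraTerm hs hf (fun p => p.1.2 (G.vert d)) (fun p => p.1.2 (G.vert (G.flip d))) hxy,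
      G.tsum_phiTerm_of_labels (eF := Equiv.refl _) (eV := Equiv.refl _) (fun _ => rfl)
        (fun _ => rfl) rfl rfl]
    rfl

end AttachTerm

end DartMap

/-! ### The polygon -/

namespace DartMap

open PowerSeries

section Polygon

variable (s : ℕ) (k : Fin (s + 2))

theorem polygon_next_inl (i : Fin (s + 2)) :
    (polygon (s + 2)).next (Sum.inl i) = Sum.inl (i + 1) :=
  congrArg Sum.inl (finRotate_apply i)

theorem polygon_next_inr (i : Fin (s + 2)) :
    (polygon (s + 2)).next (Sum.inr (i + 1)) = Sum.inr i := by
  rw [← finRotate_apply]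
  exact congrArg Sum.inr ((finRotate (s + 2)).symm_apply_apply i)

/-- The inner face of the polygon is `true`, the outer face is `false`. -/
def polygonFace : Fin (s + 2) ⊕ Fin (s + 2) → Bool :=
  Sum.elim (fun _ => true) fun _ => false

/-- The vertices of the polygon, numbered such that the source of `Sum.inr k` is `0`. -/
def polygonVert : Fin (s + 2) ⊕ Fin (s + 2) → Fin (s + 2) :=
  Sum.elim (fun i => i - (k + 1)) fun i => i - k

theorem exists_polygon_faceEquiv : ∃ e : (polygon (s + 2)).Face ≃ Bool,
    ∀ x, e ((polygon (s + 2)).face x) = polygonFace s x := by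
  have hl : ∀ i : Fin (s + 2), (polygon (s + 2)).face (Sum.inl i) =
      (polygon (s + 2)).face (Sum.inl 0) := by
    intro i
    induction i using Fin.induction with
    | zero => rfl
    | succ i ih => rw [← ih, ← Fin.coeSucc_eq_succ, ← polygon_next_inl, face_next]
  have hr : ∀ i : Fin (s + 2), (polygon (s + 2)).face (Sum.inr i) =
      (polygon (s + 2)).face (Sum.inr 0) := by
    intro i
    induction i using Fin.induction with
    | zero => rfl
    | succ i ih => rw [← ih, ← polygon_next_inr s i.castSucc, Fin.coeSucc_eq_succ, face_next]
  refine exists_faceEquiv _ (polygonFace s) ?_ ?_ (fun q => (polygon (s + 2)).face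
    (cond q (Sum.inl 0) (Sum.inr 0))) ?_
  · rintro (_ | _)
    · exact ⟨Sum.inr 0, rfl⟩
    · exact ⟨Sum.inl 0, rfl⟩
  · rintro (i | i) <;> rfl
  · rintro (i | i)
    · exact (hl i).symm
    · exact (hr i).symm

theorem exists_polygon_vertexEquiv : ∃ e : (polygon (s + 2)).Vertex ≃ Fin (s + 2),
    ∀ x, e ((polygon (s + 2)).vert x) = polygonVert s k x := by
  refine exists_vertexEquiv _ (polygonVert s k) ?_ ?_ (fun j => (polygon (s + 2)).vert
    (Sum.inl (j + (k + 1)))) ?_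
  · exact fun j => ⟨Sum.inr (j + k), add_sub_cancel_right j k⟩
  · rintro (i | i)
    · rw [polygon_next_inl]
      exact add_sub_add_right_eq_sub i k 1
    · obtain ⟨i, rfl⟩ : ∃ j, i = j + 1 := ⟨i - 1, (sub_add_cancel i 1).symm⟩
      rw [polygon_next_inr]
      exact (add_sub_add_right_eq_sub i k 1).symm
  · rintro (i | i)
    · exact congrArg _ (congrArg _ (sub_add_cancel i (k + 1)))
    · change (polygon (s + 2)).vert (Sum.inl (i - k + (k + 1))) = _
      rw [← add_assoc, sub_add_cancel, ← polygon_next_inl, vert_next]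
      rfl

/-- States of a polygon: the label `y` of the last vertex, the label of the inner face, and the
labels of the vertices between the root and the last vertex. -/
def polygonLabels : ℤ × (ℤ × (Fin s → ℤ)) ≃ RootedLabels false (0 : Fin (s + 2)) where
  toFun p := ⟨(fun q => cond q p.2.1 0, pathFun 0 p.2.2 p.1), rfl, rfl⟩
  invFun p := (p.1.2 (Fin.last (s + 1)), p.1.1 true, fun i => p.1.2 i.castSucc.succ)
  left_inv p := by
    simp only [pathFun_last, pathFun_succ_castSucc, cond_true]
  right_inv := by
    rintro ⟨⟨a, b⟩, ha, hb⟩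
    refine Subtype.ext (Prod.ext ?_ ?_)
    · funext q
      cases q
      · exact ha.symm
      · rfl
    · funext i
      change pathFun 0 (fun i : Fin s => b i.castSucc.succ) (b (Fin.last (s + 1))) i = b i
      refine Fin.cases hb.symm (fun i => ?_) i
      refine Fin.lastCases ?_ (fun i => ?_) i
      · rw [Fin.succ_last, pathFun_last]
      · rw [pathFun_succ_castSucc]

variable (y a : ℤ) (β : Fin s → ℤ)

/-- The reversal of the darts of the polygon. -/
def polygonFlip : Fin (s + 2) ⊕ Fin (s + 2) → Fin (s + 2) ⊕ Fin (s + 2) := Sum.swap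

theorem stateExp_polygon :
    stateExp (polygonFlip s) (polygonFace s) (polygonVert s k) (fun q => cond q a 0)
      (pathFun 0 β y) = 2 * (extraExp s 0 y a β + y) := by
  -- The edges of the cycle are those of the path from the root label 0 to y, together with the
  -- closing edge, which gives the term g y 0.
  have h1 : ∀ g : ℤ → ℤ → ℤ,
      ∑ i : Fin (s + 2), g (pathFun 0 β y (i - (k + 1))) (pathFun 0 β y (i - k)) =
        ∑ i : Fin (s + 1), g (pathFun 0 β y i.castSucc) (pathFun 0 β y i.succ) + g y 0 := by
    intro g
    have h2 := Equiv.sum_comp (Equiv.subRight (k + 1)) fun i : Fin (s + 2) =>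
      g (pathFun 0 β y i) (pathFun 0 β y (i + 1))
    simp only [Equiv.subRight_apply] at h2
    rw [Fin.sum_univ_castSucc fun i : Fin (s + 2) =>
      g (pathFun 0 β y i) (pathFun 0 β y (i + 1)), Fin.last_add_one, pathFun_last, pathFun_zero] at h2
    simp only [Fin.coeSucc_eq_succ] at h2
    rw [← h2]
    refine Finset.sum_congr rfl fun i _ => ?_
    rw [← sub_sub, sub_add_cancel]
  have h2 := h1 fun u v => (a + u) * (a + v)
  have h3 := h1 fun u v => v * u
  have h4 : ∑ i, pathFun 0 β y i = ∑ i, β i + y := by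
    rw [Fin.sum_univ_succ, Fin.sum_univ_castSucc, Fin.succ_last, pathFun_last, pathFun_zero]
    simp only [pathFun_succ_castSucc, zero_add]
  rw [stateExp, mul_add, two_mul_extraExp, h4, Fintype.sum_sum_type]
  simp only [polygonFlip, polygonFace, polygonVert, Sum.elim_inl, Sum.elim_inr, Sum.swap_inl,
    Sum.swap_inr, cond_true, cond_false, Finset.sum_add_distrib, h2, Fintype.sum_bool, zero_add,
    add_zero, h3, Finset.sum_const, Finset.card_univ, Fintype.card_fin, nsmul_eq_mul]
  simp only [mul_comm (pathFun 0 β y (Fin.succ _))]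
  push_cast
  ring

theorem prod_iq_polygon :
    ∏ x, iq (cond (polygonFace s x) a 0 + pathFun 0 β y (polygonVert s k x)) =
      iq y * (iq (a + 0) * iq (a + y) * ∏ i, (iq (β i) * iq (a + β i))) := by
  have h1 : ∀ (c : Fin (s + 2)) (g : ℤ → ℤ⟦X⟧), ∏ i, g (pathFun 0 β y (i - c)) =
      g 0 * ((∏ i, g (β i)) * g y) := by
    intro c g
    have h2 := Equiv.prod_comp (Equiv.subRight c) fun i : Fin (s + 2) => g (pathFun 0 β y i)
    simp only [Equiv.subRight_apply] at h2
    rw [h2, Fin.prod_univ_succ, prod_pathFun_succ, pathFun_zero]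
  rw [Fintype.prod_sum_type]
  simp only [polygonFace, polygonVert, Sum.elim_inl, Sum.elim_inr, cond_true, cond_false, zero_add]
  rw [h1 _ iq, h1 _ fun z => iq (a + z), Finset.prod_mul_distrib, iq_zero]
  ring

/-- The polygon is a path attached to its closing edge, whose ends have labels 0 and y. The summand
of that single edge is q^y / (q)_y. -/
theorem stateTerm_polygon (hs : 1 ≤ s) :
    stateTerm (polygonFlip s) (polygonFace s) (polygonVert s k) (fun q => cond q a 0)
      (pathFun 0 β y) = (X ^ y.toNat * iq y) * extraTerm s 0 y a β := by
  rcases lt_or_ge y 0 with hy | hy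
  · rw [stateTerm, prod_iq_polygon, iq_of_neg hy, zero_mul, mul_zero, mul_zero, zero_mul]
  by_cases h2 : extraTerm s 0 y a β = 0
  · have h : iq (a + 0) * iq (a + y) * ∏ i, (iq (β i) * iq (a + β i)) = 0 := by
      rw [extraTerm] at h2
      rcases mul_eq_zero.mp h2 with h2 | h2
      · simp [X_ne_zero] at h2
      · exact h2
    rw [h2, mul_zero, stateTerm, prod_iq_polygon, h, mul_zero, mul_zero]
  have hE : 0 ≤ extraExp s 0 y a β := by
    obtain ⟨h3, h4, h5, h6⟩ := not_not.mp (mt extraTerm_eq_zero h2)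
    have := le_two_mul_extraExp hs le_rfl hy h3 h4 h5 h6
    have := Finset.sum_nonneg fun i (_ : i ∈ Finset.univ) => h5 i
    nlinarith [sq_nonneg a]
  have hsign : (-1 : ℤ⟦X⟧) ^ (∑ x, cond (polygonFace s x) a 0).natAbs =
      (-1) ^ (s * a.natAbs) := by
    refine neg_one_pow_eq_of_even ?_
    have h3 : ∑ x, cond (polygonFace s x) a 0 = (s + 2) * a := by
      rw [Fintype.sum_sum_type]
      simp [polygonFace]
    rw [h3]
    have h4 := even_natAbs_sub ((s + 2) * a)
    have h5 := (even_natAbs_sub a).mul_left s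
    have h6 := (h4.sub h5).add (even_two_mul a)
    refine (congrArg Even ?_).mp h6
    push_cast
    ring
  rw [stateTerm, extraTerm, prod_iq_polygon, stateExp_polygon, hsign,
    Int.mul_ediv_cancel_left _ two_ne_zero, Int.toNat_add hE hy, pow_add]
  ring

theorem small_X_pow_toNat_mul_iq : XSmall fun y : ℤ => X ^ y.toNat * iq y := fun N => by
  refine (Set.finite_Icc (0 : ℤ) N).subset fun y hy => ?_
  have h1 : 0 ≤ y := by
    by_contra h
    exact hy (by simp only [iq_of_neg (not_le.mp h), mul_zero, dvd_zero])
  refine ⟨h1, ?_⟩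
  by_contra h
  exact hy ((pow_dvd_pow X (by omega)).mul_right _)

theorem qPochInf_mul_tsum_int : qPochInf * ∑' y : ℤ, X ^ y.toNat * iq y = 1 := by
  have h := qPochInf_mul_tsum 0
  rw [qPoch_zero] at h
  rw [← h, ← (Nat.cast_injective (R := ℤ)).tsum_eq]
  · simp
  · intro y hy
    have h1 : 0 ≤ y := by
      by_contra h
      exact hy (by simp only [iq_of_neg (not_le.mp h), mul_zero])
    exact ⟨y.toNat, Int.toNat_of_nonneg h1⟩

/-- Of the s + 2 factors (q)_∞, s + 1 are used by the sum over the path and the face. The last one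
cancels the sum of q^y / (q)_y over y. -/
theorem polygon_phi (hs : 1 ≤ s) :
    Summable ((polygon (s + 2)).phiTerm ((polygon (s + 2)).face (Sum.inr k))
      ((polygon (s + 2)).vert (Sum.inr k))) ∧
    (polygon (s + 2)).phi ((polygon (s + 2)).face (Sum.inr k))
      ((polygon (s + 2)).vert (Sum.inr k)) = thetaSeries (s + 2) := by
  obtain ⟨eF, heF⟩ := exists_polygon_faceEquiv s
  obtain ⟨eV, heV⟩ := exists_polygon_vertexEquiv s k
  have ho : eF ((polygon (s + 2)).face (Sum.inr k)) = false := heF _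
  have hv : eV ((polygon (s + 2)).vert (Sum.inr k)) = 0 := (heV _).trans (sub_self k)
  have hxy : ∀ y : ℤ, X ^ y.toNat * iq y ≠ 0 → 0 ≤ (0 : ℤ) ∧ 0 ≤ y := fun y hy => by
    refine ⟨le_rfl, ?_⟩
    by_contra h
    exact hy (by rw [iq_of_neg (not_le.mp h), mul_zero])
  have hterm : ∀ p : ℤ × (ℤ × (Fin s → ℤ)),
      stateTerm (polygonFlip s) (polygonFace s) (polygonVert s k) (polygonLabels s p).1.1
        (polygonLabels s p).1.2 = (X ^ p.1.toNat * iq p.1) * extraTerm s 0 p.1 p.2.1 p.2.2 :=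
    fun p => stateTerm_polygon s k _ _ _ hs
  have hnum : (polygon (s + 2)).numEdges = s + 1 + 1 := by
    rw [numEdges, Fintype.card_sum, Fintype.card_fin]
    omega
  constructor
  · refine (polygon (s + 2)).summable_phiTerm_of_labels heF heV ho hv ?_
    have h := (small_mul_extraTerm hs small_X_pow_toNat_mul_iq (fun _ => 0) (fun y => y)
      hxy).comp_injective (polygonLabels s).symm.injective
    simp only [← hterm, Equiv.apply_symm_apply] at h
    exact h
  · rw [phi, (polygon (s + 2)).tsum_phiTerm_of_labels heF heV ho hv, ← (polygonLabels s).tsum_eq,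
      hnum, pow_succ', mul_assoc]
    refine (congrArg _ (congrArg _ (tsum_congr hterm))).trans ?_
    rw [tsum_mul_extraTerm hs small_X_pow_toNat_mul_iq (fun _ => 0) (fun y => y) hxy, ← mul_assoc,
      qPochInf_mul_tsum_int, one_mul]

end Polygon

end DartMap

end

theorem lemma1p4 {D : Type*} [Fintype D] (G : DartMap D)
    (hconn : G.Connected) (hplane : G.GenusZero) (hloop : G.Loopless)
    (d ρ : D) (hρ : G.face ρ = G.face d)
    (r : ℕ) (hr : 3 ≤ r) (k : Fin r) :
    Summable (G.phiTerm (G.face d) (G.vert ρ)) ∧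
    Summable ((DartMap.polygon r).phiTerm ((DartMap.polygon r).face (Sum.inr k))
      ((DartMap.polygon r).vert (Sum.inr k))) ∧
    Summable ((G.attachPolygon d r hr).phiTerm (G.attachOuter d r hr)
      ((G.attachPolygon d r hr).vert (Sum.inl ρ))) ∧
    (G.attachPolygon d r hr).phi (G.attachOuter d r hr)
        ((G.attachPolygon d r hr).vert (Sum.inl ρ)) =
      G.phi (G.face d) (G.vert ρ) *
        (DartMap.polygon r).phi ((DartMap.polygon r).face (Sum.inr k))
          ((DartMap.polygon r).vert (Sum.inr k)) ∧
    (DartMap.polygon r).phi ((DartMap.polygon r).face (Sum.inr k))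
        ((DartMap.polygon r).vert (Sum.inr k)) = thetaSeries r := by
  obtain ⟨s, rfl⟩ : ∃ s, r = s + 2 := ⟨r - 2, by omega⟩
  have hs : 1 ≤ s := by omega
  obtain ⟨hP, hP'⟩ := DartMap.polygon_phi s k hs
  obtain ⟨hA, hA'⟩ := G.attach_phi d s hr hconn hplane hloop hs ρ
  refine ⟨?_, hP, hA, ?_, hP'⟩
  · exact G.summable_phiTerm_of_labels (eF := Equiv.refl _) (eV := Equiv.refl _) (fun _ => rfl)
      (fun _ => rfl) rfl rfl (G.small_stateTerm hconn hplane (G.face d) (G.vert ρ))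
  · rw [hA', hP']
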